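/- For every integer $m\ge 1$ there exists a connected Liouville domain of dimension $2m$ whose boundary is disconnected. Here a Liouville domain of dimension $2m$ is a compact smooth $2m$-dimensional manifold $W$ with boundary together with a symplectic form $\omega$ that admits a global smooth primitive $\lambda$ on $W$ ($d\lambda=\omega$) whose restriction $\alpha=\lambda|_{\partial W}$ is a positive contact form, that is, $\alpha\wedge(d\alpha)^{m-1}>0$ on $\partial W$, where $W$ is oriented by $\omega^m$ and $\partial W$ carries the boundary orientation. (Thus $(W,\omega)$ is an exact symplectic filling of the contact manifold $(\partial W,\ker\alpha)$.) -/

import Mathlib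

open Set
open scoped Manifold ContDiff

noncomputable section

/-! ### Exterior algebra of a real vector space -/

/-- The wedge product `a ∧ b` of two alternating forms on a real vector space, with the convention
`(a ∧ b)(v) = 1 / (k! l!) ∑_σ sign σ * a (v_σ(1), …, v_σ(k)) * b (v_σ(k+1), …, v_σ(k+l))`
(so that `(dx ∧ dy)(u, v) = dx u * dy v - dx v * dy u`). -/
def altWedge {E : Type*} [AddCommGroup E] [Module ℝ E] {k l : ℕ}
    (a : E [⋀^Fin k]→ₗ[ℝ] ℝ) (b : E [⋀^Fin l]→ₗ[ℝ] ℝ) : E [⋀^Fin (k + l)]→ₗ[ℝ] ℝ :=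
  ((k.factorial * l.factorial : ℝ)⁻¹) • MultilinearMap.alternatization
    (((LinearMap.mul' ℝ ℝ).compMultilinearMap
      (a.toMultilinearMap.domCoprod b.toMultilinearMap)).domDomCongr finSumFinEquiv)

/-- The wedge power `w ∧ ⋯ ∧ w` (`m` factors) of a `2`-form `w`. -/
def altWedgePow {E : Type*} [AddCommGroup E] [Module ℝ E] (w : E [⋀^Fin 2]→ₗ[ℝ] ℝ) :
    (m : ℕ) → E [⋀^Fin (2 * m)]→ₗ[ℝ] ℝ
  | 0 => (AlternatingMap.constOfIsEmpty ℝ E (Fin 0) (1 : ℝ) : E [⋀^Fin 0]→ₗ[ℝ] ℝ)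
  | m + 1 => altWedge (altWedgePow w m) w

/-! ### Differential forms on a manifold (possibly with boundary) -/

section Forms

variable {E : Type*} [NormedAddCommGroup E] [NormedSpace ℝ E] {H : Type*} [TopologicalSpace H]
  (I : ModelWithCorners ℝ E H) {M : Type*} [TopologicalSpace M] [ChartedSpace H M]

/-- A (not necessarily smooth) differential `k`-form on `M`: an alternating `k`-linear form on
each tangent space. -/
abbrev DiffForm (M : Type*) [TopologicalSpace M] [ChartedSpace H M] (k : ℕ) :=
  ∀ x : M, TangentSpace I x [⋀^Fin k]→L[ℝ] ℝ

variable {I}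

/-- The local expression of a form in the chart at `x₀`: its pullback by the inverse chart. -/
def DiffForm.inChart {k : ℕ} (Ω : DiffForm I M k) (x₀ : M) (y : E) : E [⋀^Fin k]→L[ℝ] ℝ :=
  (Ω ((extChartAt I x₀).symm y)).compContinuousLinearMap
    (mfderivWithin 𝓘(ℝ, E) I (extChartAt I x₀).symm (range I) y)

/-- A form is smooth if its local expressions are smooth. -/
def DiffForm.IsSmooth {k : ℕ} (Ω : DiffForm I M k) : Prop :=
  ∀ x₀ : M, ContDiffOn ℝ ∞ (Ω.inChart x₀) (extChartAt I x₀).target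

/-- The exterior derivative of a form on a manifold, computed at `x` in the chart at `x`. -/
def DiffForm.d {k : ℕ} (Ω : DiffForm I M k) : DiffForm I M (k + 1) := fun x =>
  (extDerivWithin (Ω.inChart x) (range I) (extChartAt I x x)).compContinuousLinearMap
    (mfderiv I 𝓘(ℝ, E) (extChartAt I x) x)

/-- The pullback `f^* Ω` of a form by a map `f : N → M`. -/
def DiffForm.pullback {E' : Type*} [NormedAddCommGroup E'] [NormedSpace ℝ E']
    {H' : Type*} [TopologicalSpace H'] {J : ModelWithCorners ℝ E' H'}
    {N : Type*} [TopologicalSpace N] [ChartedSpace H' N] {k : ℕ}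
    (Ω : DiffForm I M k) (f : N → M) : DiffForm J N k := fun x =>
  (Ω (f x)).compContinuousLinearMap (mfderiv J I f x)

/-- The `2m`-form `Ω ∧ ⋯ ∧ Ω` (`m` factors) of a differential `2`-form `Ω`, at the point `x`. -/
def DiffForm.wedgePowAt (Ω : DiffForm I M 2) (m : ℕ) (x : M) :
    TangentSpace I x [⋀^Fin (2 * m)]→ₗ[ℝ] ℝ :=
  altWedgePow (Ω x).toAlternatingMap m

/-- The `(2m+1)`-form `α ∧ (dα)^m` of a differential `1`-form `α`, at the point `x`. -/
def DiffForm.contactVolumeAt (α : DiffForm I M 1) (m : ℕ) (x : M) :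
    TangentSpace I x [⋀^Fin (1 + 2 * m)]→ₗ[ℝ] ℝ :=
  altWedge (α x).toAlternatingMap (DiffForm.wedgePowAt α.d m x)

/-- A symplectic form: a smooth closed nondegenerate `2`-form. -/
structure DiffForm.IsSymplectic (Ω : DiffForm I M 2) : Prop where
  smooth : Ω.IsSmooth
  closed : Ω.d = 0
  nondegenerate : ∀ (x : M) (v : TangentSpace I x), v ≠ 0 →
    ∃ w : TangentSpace I x, Ω x ![v, w] ≠ 0

/-- A contact form on a manifold of dimension `2m+1`: a smooth `1`-form `α` such that
`α ∧ (dα)^m` vanishes nowhere. -/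
structure DiffForm.IsContact (α : DiffForm I M 1) (m : ℕ) : Prop where
  smooth : α.IsSmooth
  nonvanishing : ∀ x : M, α.contactVolumeAt m x ≠ 0

end Forms

/-! ### Liouville domains -/

/-- A tangent vector at a boundary point of a manifold with boundary points strictly outward if
its `0`-th coordinate is negative; the local model is the half-space `{y | 0 ≤ y 0}`. -/
def IsOutward {k : ℕ} [NeZero k] {W : Type*} [TopologicalSpace W]
    [ChartedSpace (EuclideanHalfSpace k) W] {q : W} (ν : TangentSpace (𝓡∂ k) q) : Prop :=
  (EuclideanSpace.proj (0 : Fin k) : EuclideanSpace ℝ (Fin k) →L[ℝ] ℝ)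
    (mfderiv (𝓡∂ k) 𝓘(ℝ, EuclideanSpace ℝ (Fin k)) (extChartAt (𝓡∂ k) q) q ν) < 0

/-- Let `W` be a `(2n+2)`-dimensional manifold with boundary, carrying a `2`-form `Ω`, and let
`ι : V → W` map a `(2n+1)`-dimensional manifold `V` to `W`. This says that `(W, Ω)` is a symplectic
manifold oriented by `Ω^(n+1)`, that `ι` identifies `V` with `∂W`, and that `lam` is a global
primitive of `Ω` whose restriction `ι^* lam` to `V` is a contact form that is positive for the
boundary orientation of `V = ∂W` (outward normal first). So `(W, Ω)` is an exact filling of `V` with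
the contact structure `ker (ι^* lam)`, co-oriented by `ι^* lam`. -/
structure IsExactFilling {n : ℕ} {W : Type*} [TopologicalSpace W]
    [ChartedSpace (EuclideanHalfSpace (2 * (n + 1))) W]
    {V : Type*} [TopologicalSpace V] [ChartedSpace (EuclideanSpace ℝ (Fin (2 * n + 1))) V]
    (Ω : DiffForm (𝓡∂ (2 * (n + 1))) W 2) (ι : V → W)
    (lam : DiffForm (𝓡∂ (2 * (n + 1))) W 1) : Prop where
  symplectic : Ω.IsSymplectic
  embedding : Manifold.IsSmoothEmbedding (𝓡 (2 * n + 1)) (𝓡∂ (2 * (n + 1))) ∞ ι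
  range_eq : range ι = (𝓡∂ (2 * (n + 1))).boundary W
  smooth : lam.IsSmooth
  primitive : lam.d = Ω
  contact : (lam.pullback (J := 𝓡 (2 * n + 1)) ι).IsContact n
  positive : ∀ (p : V) (ν : TangentSpace (𝓡∂ (2 * (n + 1))) (ι p)), IsOutward ν →
    ∀ v : Fin (2 * n + 1) → TangentSpace (𝓡 (2 * n + 1)) p,
      0 < Ω.wedgePowAt (n + 1) (ι p)
        (Matrix.vecCons ν
          (fun i => mfderiv (𝓡 (2 * n + 1)) (𝓡∂ (2 * (n + 1))) ι p (v i))) →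
      0 < (lam.pullback (J := 𝓡 (2 * n + 1)) ι).contactVolumeAt n p
        (v ∘ Fin.cast (Nat.add_comm 1 (2 * n)))

/-- `(W, Ω)` is a Liouville domain of dimension `2n+2`: `W` is a compact (Hausdorff) smooth manifold
with boundary, and `(W, Ω)` is an exact filling of a closed contact manifold `V`. -/
def IsLiouvilleDomain {n : ℕ} (W : Type) [TopologicalSpace W]
    [ChartedSpace (EuclideanHalfSpace (2 * (n + 1))) W]
    (Ω : DiffForm (𝓡∂ (2 * (n + 1))) W 2) : Prop :=
  CompactSpace W ∧ T2Space W ∧ IsManifold (𝓡∂ (2 * (n + 1))) ∞ W ∧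
    ∃ (V : Type) (_ : TopologicalSpace V)
      (_ : ChartedSpace (EuclideanSpace ℝ (Fin (2 * n + 1))) V),
      CompactSpace V ∧ T2Space V ∧ IsManifold (𝓡 (2 * n + 1)) ∞ V ∧
        ∃ (ι : V → W) (lam : DiffForm (𝓡∂ (2 * (n + 1))) W 1), IsExactFilling Ω ι lam

end

noncomputable section

open Topology Filter

/-! ### Wedge products as sums over permutations -/

section Wedge

variable {E : Type*} [AddCommGroup E] [Module ℝ E]

/-! Let `N = n + 1` and consider the form `λ = ∑ P_j dQ_j` on a part of `T^*ℝ^N`. Let `R ⊂ ℝ^N` be a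
subring that is a lattice. It acts by translation of `Q`. Its totally positive units `u` of norm one
act by `Q_j ↦ u_j Q_j`, `P_j ↦ u_j⁻¹ P_j`. Both actions preserve `λ` and `∏ P_j`. Take the region
`P_j > 0` for `j ≥ 1`, `|∏ P_j| ≤ 1`. If the units have full rank `N - 1`, they move `log P_1, …,
log P_(N-1)` into a bounded set, which bounds `P_0` as well, and the lattice bounds `Q`; so the
quotient is compact. The radial field `Z = ∑ P_j ∂/∂P_j` satisfies `dλ(Z, ·) = λ` and multiplies `∏
P_j` by `N`, so it points outward along both `∏ P_j = 1` and `∏ P_j = -1`. These two parts of the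
boundary are told apart by the sign of `P_0`, while the region is connected through `P_0 = 0`. For
`N = 1` the annulus `|P| ≤ 1` in `T^*S^1` is used instead.

The coordinates `y` are chosen so that the group acts by affine maps and the region is cut out by `0
≤ y 0`: for `s = y 0 + y 1 ^ 2` one has `∏ P_j = y 1 / √s`, hence `y 0 = s (1 - (∏ P_j)^2)`. The
charts of the quotient are the local inverses of the projection, coordinate changes are locally
affine, and an invariant form is its own local expression. `exists_liouvilleDomain` reduces the
theorem in this way to `LiouvilleData`, supplied by `liouvilleData_surface` and
`liouvilleData_cusp`.

At the boundary, positivity of the contact form is linear algebra (`contact_of_liouville`):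
contracting `ω^(n+1)` with `Z` gives `(n+1) α ∧ ω^n` for `α = ω(Z, ·)`.

The ring comes from `exists_subring_lattice`. It is generated by the vector `θ` of roots of `∏ (X -
3 i) - 1`, so each `θ - 3 i` is visibly a unit, and diagonal dominance of the logarithms shows that
these units have full rank. -/

lemma altWedge_apply {k l : ℕ} (a : E [⋀^Fin k]→ₗ[ℝ] ℝ) (b : E [⋀^Fin l]→ₗ[ℝ] ℝ)
    (v : Fin (k + l) → E) :
    altWedge a b v = ((k.factorial * l.factorial : ℝ)⁻¹) *
      ∑ σ : Equiv.Perm (Fin (k + l)), ((Equiv.Perm.sign σ : ℤ) : ℝ) *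
        (a (fun i => v (σ (Fin.castAdd l i))) * b (fun i => v (σ (Fin.natAdd k i)))) := by
  rw [altWedge, AlternatingMap.smul_apply, MultilinearMap.alternatization_apply, smul_eq_mul]
  congr 1
  refine Finset.sum_congr rfl fun σ _ => ?_
  rw [Units.smul_def, zsmul_eq_mul]
  simp [MultilinearMap.domDomCongr_apply, MultilinearMap.domCoprod_apply]

/-- A permutation of the first block of `Fin (k + l)`. -/
def permLeft {k : ℕ} (l : ℕ) (τ : Equiv.Perm (Fin k)) : Equiv.Perm (Fin (k + l)) :=
  finSumFinEquiv.permCongr (Equiv.Perm.sumCongr τ 1)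

/-- A permutation of the second block of `Fin (k + l)`. -/
def permRight (k : ℕ) {l : ℕ} (τ : Equiv.Perm (Fin l)) : Equiv.Perm (Fin (k + l)) :=
  finSumFinEquiv.permCongr (Equiv.Perm.sumCongr 1 τ)

lemma sign_permLeft {k l : ℕ} (τ : Equiv.Perm (Fin k)) :
    Equiv.Perm.sign (permLeft l τ) = Equiv.Perm.sign τ := by
  simp [permLeft]

lemma sign_permRight {k l : ℕ} (τ : Equiv.Perm (Fin l)) :
    Equiv.Perm.sign (permRight k τ) = Equiv.Perm.sign τ := by
  simp [permRight]

/-- When `a` is itself an antisymmetrization of `A`, antisymmetrizing twice is redundant: for each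
`τ` the substitution `σ ↦ σ * permLeft l τ` gives the same sum, and the `k!` equal terms cancel the
factor `1 / k!`. -/
lemma altWedge_apply_of_left {k l : ℕ} (a : E [⋀^Fin k]→ₗ[ℝ] ℝ) (b : E [⋀^Fin l]→ₗ[ℝ] ℝ)
    (c : ℝ) (A : (Fin k → E) → ℝ)
    (ha : ∀ v, a v = c * ∑ τ : Equiv.Perm (Fin k), ((Equiv.Perm.sign τ : ℤ) : ℝ) * A (v ∘ τ))
    (v : Fin (k + l) → E) :
    altWedge a b v = (c * (l.factorial : ℝ)⁻¹) *
      ∑ σ : Equiv.Perm (Fin (k + l)), ((Equiv.Perm.sign σ : ℤ) : ℝ) *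
        (A (fun i => v (σ (Fin.castAdd l i))) * b (fun i => v (σ (Fin.natAdd k i)))) := by
  rw [altWedge_apply]
  set S := ∑ σ : Equiv.Perm (Fin (k + l)), ((Equiv.Perm.sign σ : ℤ) : ℝ) *
        (A (fun i => v (σ (Fin.castAdd l i))) * b (fun i => v (σ (Fin.natAdd k i)))) with hS
  have key : ∀ τ : Equiv.Perm (Fin k), ∑ σ : Equiv.Perm (Fin (k + l)),
      ((Equiv.Perm.sign σ : ℤ) : ℝ) * (((Equiv.Perm.sign τ : ℤ) : ℝ) *
        A ((fun i => v (σ (Fin.castAdd l i))) ∘ τ)) * b (fun i => v (σ (Fin.natAdd k i))) = S := by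
    intro τ
    rw [hS]
    refine Fintype.sum_equiv (Equiv.mulRight (permLeft l τ)) _ _ fun σ => ?_
    have h1 : ∀ i, permLeft l τ (Fin.castAdd l i) = Fin.castAdd l (τ i) := by
      intro i; simp [permLeft]
    have h2 : ∀ i, permLeft l τ (Fin.natAdd k i) = Fin.natAdd k i := by
      intro i; simp [permLeft]
    simp only [Equiv.coe_mulRight, Equiv.Perm.mul_apply, h1, h2, Equiv.Perm.sign_mul,
      sign_permLeft, Units.val_mul, Int.cast_mul, Function.comp_def]
    ring
  have : ∑ σ : Equiv.Perm (Fin (k + l)), ((Equiv.Perm.sign σ : ℤ) : ℝ) *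
        (a (fun i => v (σ (Fin.castAdd l i))) * b (fun i => v (σ (Fin.natAdd k i)))) =
      c * (k.factorial * S) := by
    calc _ = c * ∑ τ : Equiv.Perm (Fin k), ∑ σ : Equiv.Perm (Fin (k + l)),
      ((Equiv.Perm.sign σ : ℤ) : ℝ) * (((Equiv.Perm.sign τ : ℤ) : ℝ) *
        A ((fun i => v (σ (Fin.castAdd l i))) ∘ τ)) * b (fun i => v (σ (Fin.natAdd k i))) := by
          rw [Finset.sum_comm, Finset.mul_sum]
          refine Finset.sum_congr rfl fun σ _ => ?_
          rw [ha, ← Finset.sum_mul, ← Finset.mul_sum]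
          ring
      _ = _ := by
          simp only [key, Finset.sum_const, Finset.card_univ, Fintype.card_perm, Fintype.card_fin,
            nsmul_eq_mul]
  rw [this]
  have : (k.factorial : ℝ) ≠ 0 := by positivity
  field_simp

lemma altWedge_apply_of_right {k l : ℕ} (a : E [⋀^Fin k]→ₗ[ℝ] ℝ) (b : E [⋀^Fin l]→ₗ[ℝ] ℝ)
    (c : ℝ) (B : (Fin l → E) → ℝ)
    (hb : ∀ v, b v = c * ∑ τ : Equiv.Perm (Fin l), ((Equiv.Perm.sign τ : ℤ) : ℝ) * B (v ∘ τ))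
    (v : Fin (k + l) → E) :
    altWedge a b v = (c * (k.factorial : ℝ)⁻¹) *
      ∑ σ : Equiv.Perm (Fin (k + l)), ((Equiv.Perm.sign σ : ℤ) : ℝ) *
        (a (fun i => v (σ (Fin.castAdd l i))) * B (fun i => v (σ (Fin.natAdd k i)))) := by
  rw [altWedge_apply]
  set S := ∑ σ : Equiv.Perm (Fin (k + l)), ((Equiv.Perm.sign σ : ℤ) : ℝ) *
        (a (fun i => v (σ (Fin.castAdd l i))) * B (fun i => v (σ (Fin.natAdd k i)))) with hS
  have key : ∀ τ : Equiv.Perm (Fin l), ∑ σ : Equiv.Perm (Fin (k + l)),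
      ((Equiv.Perm.sign σ : ℤ) : ℝ) * a (fun i => v (σ (Fin.castAdd l i))) *
        (((Equiv.Perm.sign τ : ℤ) : ℝ) * B ((fun i => v (σ (Fin.natAdd k i))) ∘ τ)) = S := by
    intro τ
    rw [hS]
    refine Fintype.sum_equiv (Equiv.mulRight (permRight k τ)) _ _ fun σ => ?_
    have h1 : ∀ i, permRight k τ (Fin.castAdd l i) = Fin.castAdd l i := by
      intro i; simp [permRight]
    have h2 : ∀ i, permRight k τ (Fin.natAdd k i) = Fin.natAdd k (τ i) := by
      intro i; simp [permRight]
    simp only [Equiv.coe_mulRight, Equiv.Perm.mul_apply, h1, h2, Equiv.Perm.sign_mul,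
      sign_permRight, Units.val_mul, Int.cast_mul, Function.comp_def]
    ring
  have : ∑ σ : Equiv.Perm (Fin (k + l)), ((Equiv.Perm.sign σ : ℤ) : ℝ) *
        (a (fun i => v (σ (Fin.castAdd l i))) * b (fun i => v (σ (Fin.natAdd k i)))) =
      c * (l.factorial * S) := by
    calc _ = c * ∑ τ : Equiv.Perm (Fin l), ∑ σ : Equiv.Perm (Fin (k + l)),
      ((Equiv.Perm.sign σ : ℤ) : ℝ) * a (fun i => v (σ (Fin.castAdd l i))) *
        (((Equiv.Perm.sign τ : ℤ) : ℝ) * B ((fun i => v (σ (Fin.natAdd k i))) ∘ τ)) := by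
          rw [Finset.sum_comm, Finset.mul_sum]
          refine Finset.sum_congr rfl fun σ _ => ?_
          rw [hb, ← Finset.mul_sum]
          ring
      _ = _ := by
          simp only [key, Finset.sum_const, Finset.card_univ, Fintype.card_perm, Fintype.card_fin,
            nsmul_eq_mul]
  rw [this]
  have : (l.factorial : ℝ) ≠ 0 := by positivity
  field_simp

/-- The product of the values of a `2`-form on consecutive pairs of vectors. -/
def pairProd (w : E [⋀^Fin 2]→ₗ[ℝ] ℝ) {m : ℕ} (v : Fin (2 * m) → E) : ℝ :=
  ∏ i : Fin m, w ![v ⟨2 * i, by omega⟩, v ⟨2 * i + 1, by omega⟩]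

/-- Each new factor is absorbed by `altWedge_apply_of_left`, so that only the `2!` of every copy of
`w` survives in the constant. -/
lemma altWedgePow_apply (w : E [⋀^Fin 2]→ₗ[ℝ] ℝ) (m : ℕ) (v : Fin (2 * m) → E) :
    altWedgePow w m v = ((2 : ℝ) ^ m)⁻¹ *
      ∑ σ : Equiv.Perm (Fin (2 * m)), ((Equiv.Perm.sign σ : ℤ) : ℝ) * pairProd w (v ∘ σ) := by
  induction m with
  | zero =>
    have : Subsingleton (Equiv.Perm (Fin (2 * 0))) := by
      change Subsingleton (Equiv.Perm (Fin 0)); infer_instance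
    rw [Fintype.sum_subsingleton _ (1 : Equiv.Perm (Fin (2 * 0)))]
    simp [altWedgePow, pairProd]
  | succ m ih =>
    change altWedge (altWedgePow w m) w v = _
    rw [altWedge_apply_of_left (altWedgePow w m) w _ _ ih v]
    congr 1
    · rw [pow_succ, mul_inv]; norm_num
    · refine Finset.sum_congr rfl fun σ _ => ?_
      congr 1
      rw [pairProd, pairProd, Fin.prod_univ_castSucc]
      congr 1
      congr 1
      ext i; fin_cases i <;> rfl

lemma altWedge_altWedgePow_apply (a : E [⋀^Fin 1]→ₗ[ℝ] ℝ) (w : E [⋀^Fin 2]→ₗ[ℝ] ℝ) (m : ℕ)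
    (v : Fin (1 + 2 * m) → E) :
    altWedge a (altWedgePow w m) v = ((2 : ℝ) ^ m)⁻¹ *
      ∑ σ : Equiv.Perm (Fin (1 + 2 * m)), ((Equiv.Perm.sign σ : ℤ) : ℝ) *
        (a (fun _ => v (σ 0)) * pairProd w (fun i => v (σ (Fin.natAdd 1 i)))) := by
  rw [altWedge_apply_of_right a (altWedgePow w m) _ _ (altWedgePow_apply w m) v]
  simp only [Nat.factorial_one, Nat.cast_one, inv_one, mul_one]
  congr 1
  refine Finset.sum_congr rfl fun σ _ => ?_
  congr 3
  ext i
  rw [Subsingleton.elim i 0]; rfl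

lemma altWedgePow_compLinearMap {F : Type*} [AddCommGroup F] [Module ℝ F]
    (w : E [⋀^Fin 2]→ₗ[ℝ] ℝ) (f : F →ₗ[ℝ] E) (m : ℕ) :
    altWedgePow (w.compLinearMap f) m = (altWedgePow w m).compLinearMap f := by
  ext v
  rw [AlternatingMap.compLinearMap_apply, altWedgePow_apply, altWedgePow_apply]
  congr 1
  refine Finset.sum_congr rfl fun σ _ => ?_
  congr 1
  refine Finset.prod_congr rfl fun i _ => ?_
  rw [AlternatingMap.compLinearMap_apply]
  congr 1
  ext i; fin_cases i <;> rfl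

/-- Exchanging two whole pairs only permutes the factors of the product. -/
lemma pairProd_comp_blockSwap (w : E [⋀^Fin 2]→ₗ[ℝ] ℝ) {m : ℕ} (u : Fin (2 * (m + 1)) → E)
    (i : Fin (m + 1)) :
    pairProd w (u ∘ (Equiv.swap (⟨0, by omega⟩ : Fin (2 * (m + 1))) ⟨2 * i, by omega⟩ *
      Equiv.swap (⟨1, by omega⟩ : Fin (2 * (m + 1))) ⟨2 * i + 1, by omega⟩ : Equiv.Perm _)) =
      pairProd w u := by
  rw [pairProd, pairProd]
  refine Eq.trans (Finset.prod_congr rfl fun k _ => ?_) (Equiv.prod_comp (Equiv.swap 0 i) _)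
  have h : ∀ b : ℕ, ∀ hb : b < 2, (Equiv.swap (⟨0, by omega⟩ : Fin (2 * (m + 1))) ⟨2 * i, by omega⟩ *
      Equiv.swap (⟨1, by omega⟩ : Fin (2 * (m + 1))) ⟨2 * i + 1, by omega⟩ : Equiv.Perm _)
      ⟨2 * (k : ℕ) + b, by omega⟩ = ⟨2 * (Equiv.swap 0 i k : Fin (m + 1)) + b, by omega⟩ := by
    intro b hb
    simp only [Equiv.Perm.mul_apply, Equiv.swap_apply_def, Fin.ext_iff, apply_ite Fin.val,
      Fin.val_zero]
    split_ifs <;> first | omega | contradiction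
  have h0 := h 0 (by omega)
  have h1 := h 1 (by omega)
  simp only [add_zero] at h0
  simp only [Function.comp, h0, h1]

lemma pairProd_comp_swap (w : E [⋀^Fin 2]→ₗ[ℝ] ℝ) {m : ℕ} (u : Fin (2 * (m + 1)) → E) :
    pairProd w (u ∘ Equiv.swap (⟨0, by omega⟩ : Fin (2 * (m + 1))) ⟨1, by omega⟩) = - pairProd w u := by
  rw [pairProd, pairProd, Fin.prod_univ_succ, Fin.prod_univ_succ, neg_mul_eq_neg_mul]
  congr 1
  · have := w.map_swap ![u ⟨2 * ((0 : Fin (m + 1)) : ℕ), by simp⟩,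
      u ⟨2 * ((0 : Fin (m + 1)) : ℕ) + 1, by simp only [Fin.val_zero]; omega⟩] (show (0 : Fin 2) ≠ 1 by decide)
    rw [← this]
    congr 1
    ext i
    fin_cases i
    · simp only [Function.comp, Fin.val_zero, mul_zero]
      rw [Equiv.swap_apply_left]
      rfl
    · simp only [Function.comp, Fin.val_zero, mul_zero, zero_add, Fin.mk_one, Matrix.cons_val_one,
        Matrix.cons_val_fin_one, Equiv.swap_apply_right]
      rfl

/-- All positions play the same role in the signed product: exchanging two pairs is an even
permutation, and exchanging the entries of one pair changes both the sign and one factor. -/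
lemma exists_perm_pairProd (w : E [⋀^Fin 2]→ₗ[ℝ] ℝ) {m : ℕ} (j : Fin (2 * (m + 1))) :
    ∃ π : Equiv.Perm (Fin (2 * (m + 1))), π ⟨0, by omega⟩ = j ∧ ∀ u : Fin (2 * (m + 1)) → E,
      ((Equiv.Perm.sign π : ℤ) : ℝ) * pairProd w (u ∘ π) = pairProd w u := by
  have even : ∀ i : Fin (m + 1), ∃ π : Equiv.Perm (Fin (2 * (m + 1))),
      π ⟨0, by omega⟩ = ⟨2 * i, by omega⟩ ∧ π ⟨1, by omega⟩ = ⟨2 * i + 1, by omega⟩ ∧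
      ∀ u : Fin (2 * (m + 1)) → E,
      ((Equiv.Perm.sign π : ℤ) : ℝ) * pairProd w (u ∘ π) = pairProd w u := by
    intro i
    by_cases hi : i = 0
    · subst hi
      exact ⟨1, rfl, rfl, fun u => by simp⟩
    · have hi' : (i : ℕ) ≠ 0 := fun h => hi (Fin.ext h)
      refine ⟨Equiv.swap (⟨0, by omega⟩ : Fin (2 * (m + 1))) ⟨2 * i, by omega⟩ *
        Equiv.swap (⟨1, by omega⟩ : Fin (2 * (m + 1))) ⟨2 * i + 1, by omega⟩, ?_, ?_, fun u => ?_⟩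
      · simp only [Equiv.Perm.mul_apply, Equiv.swap_apply_def, Fin.ext_iff, apply_ite Fin.val]
        split_ifs <;> omega
      · simp only [Equiv.Perm.mul_apply, Equiv.swap_apply_def, Fin.ext_iff, apply_ite Fin.val]
        split_ifs <;> first | omega | contradiction
      · rw [pairProd_comp_blockSwap, Equiv.Perm.sign_mul, Equiv.Perm.sign_swap,
          Equiv.Perm.sign_swap]
        · simp
        · rw [ne_eq, Fin.ext_iff]; simp only; omega
        · rw [ne_eq, Fin.ext_iff]; simp only; omega
  rcases Nat.even_or_odd' (j : ℕ) with ⟨c, hc | hc⟩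
  · obtain ⟨π, h0, -, h⟩ := even ⟨c, by omega⟩
    exact ⟨π, by rw [h0, Fin.ext_iff]; exact hc.symm, h⟩
  · obtain ⟨π, -, h1, h⟩ := even ⟨c, by omega⟩
    refine ⟨π * Equiv.swap ⟨0, by omega⟩ ⟨1, by omega⟩, ?_, fun u => ?_⟩
    · rw [Equiv.Perm.mul_apply, Equiv.swap_apply_left, h1, Fin.ext_iff]; exact hc.symm
    · rw [Equiv.Perm.sign_mul, Equiv.Perm.sign_swap (by simp), Equiv.Perm.coe_mul,
        ← Function.comp_assoc, pairProd_comp_swap, ← h u]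
      simp

/-- Contraction of a power of a `2`-form with a vector. -/
lemma altWedgePow_succ_cons (w : E [⋀^Fin 2]→ₗ[ℝ] ℝ) (m : ℕ) (Z : E) (a : E [⋀^Fin 1]→ₗ[ℝ] ℝ)
    (ha : ∀ u, a (fun _ => u) = w ![Z, u]) (v : Fin (2 * m + 1) → E) :
    altWedgePow w (m + 1) (Matrix.vecCons Z v) = (m + 1) *
      altWedge a (altWedgePow w m) (v ∘ Fin.cast (Nat.add_comm 1 (2 * m))) := by
  rw [altWedgePow_apply, altWedge_altWedgePow_apply]
  set V : Fin (2 * (m + 1)) → E := Matrix.vecCons Z v with hV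
  set term : Equiv.Perm (Fin (2 * (m + 1))) → ℝ :=
    fun σ => ((Equiv.Perm.sign σ : ℤ) : ℝ) * pairProd w (V ∘ σ) with hterm
  -- The permutations are sorted by the position `j` at which `Z` is inserted. The `2 (m + 1)`
  -- classes have equal sums by `exists_perm_pairProd`, and the class of position `0` is the sum for
  -- `a ∧ w ^ m`. The constant is `2 (m + 1) / 2 ^ (m + 1) = (m + 1) / 2 ^ m`.
  let T : Fin (2 * (m + 1)) → ℝ := fun j => ∑ σ, if σ j = ⟨0, by omega⟩ then term σ else 0
  have hT : ∀ j, T j = T ⟨0, by omega⟩ := by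
    intro j
    obtain ⟨π, h0, h⟩ := exists_perm_pairProd w j
    refine Fintype.sum_equiv (Equiv.mulRight π) _ _ fun σ => ?_
    simp only [Equiv.coe_mulRight, Equiv.Perm.mul_apply, h0]
    congr 1
    simp only [hterm, Equiv.Perm.sign_mul, Equiv.Perm.coe_mul, ← Function.comp_assoc,
      Units.val_mul, Int.cast_mul]
    rw [mul_assoc, h]
  have hsum : ∑ σ, term σ = (2 * (m + 1) : ℕ) * T ⟨0, by omega⟩ := by
    have hTsum : ∑ σ, term σ = ∑ j, T j := by
      rw [Finset.sum_comm]
      refine Finset.sum_congr rfl fun σ _ => ?_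
      rw [Finset.sum_eq_single (σ⁻¹ ⟨0, by omega⟩)]
      · simp
      · intro b _ hb
        rw [if_neg]
        intro h
        exact hb (by rw [← h]; simp)
      · simp
    rw [hTsum, Finset.sum_congr rfl fun j _ => hT j]
    simp
  have hT0 : T ⟨0, by omega⟩ = ∑ σ : Equiv.Perm (Fin (1 + 2 * m)), ((Equiv.Perm.sign σ : ℤ) : ℝ) *
        (a (fun _ => (v ∘ Fin.cast (Nat.add_comm 1 (2 * m))) (σ 0)) *
        pairProd w (fun i => (v ∘ Fin.cast (Nat.add_comm 1 (2 * m))) (σ (Fin.natAdd 1 i)))) := by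
    -- `decomposeFin` splits a permutation into the image of `0` and a permutation of the remaining
    -- indices; only the image `0` contributes.
    change (∑ σ : Equiv.Perm (Fin ((2 * m + 1) + 1)), if σ 0 = 0 then term σ else 0) = _
    rw [← Equiv.sum_comp (Equiv.Perm.decomposeFin (n := 2 * m + 1)).symm, Fintype.sum_prod_type,
      Fin.sum_univ_succ, Finset.sum_eq_zero (s := Finset.univ (α := Fin (2 * m + 1))), add_zero]
    · refine Fintype.sum_equiv (finCongr (Nat.add_comm (2 * m) 1)).permCongr _ _ fun e => ?_
      rw [if_pos (by simp), Equiv.Perm.sign_permCongr]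
      simp only [hterm]
      rw [Equiv.Perm.decomposeFin.symm_sign, if_pos rfl, one_mul]
      congr 1
      rw [pairProd, Fin.prod_univ_succ, ha, pairProd]
      refine congrArg₂ _ ?_ ?_
      · congr 1
      · refine Finset.prod_congr rfl fun k _ => ?_
        congr 1
        have key : ∀ x : Fin (2 * m + 1), V (Equiv.Perm.decomposeFin.symm (0, e) x.succ) =
          v (e x) := by intro x; simp [hV]
        ext i
        fin_cases i
        · refine (key ⟨2 * k + 1, by omega⟩).trans ?_
          simp [Equiv.permCongr_apply]
          congr 2
          ext; simp; omega
        · refine (key ⟨2 * k + 2, by omega⟩).trans ?_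
          simp [Equiv.permCongr_apply]
          congr 2
          ext; simp; omega
    · intro j _
      refine Finset.sum_eq_zero fun e _ => ?_
      rw [if_neg]
      simp
  change _ * ∑ σ, term σ = _
  rw [hsum, hT0, pow_succ]
  push_cast
  field_simp

end Wedge

/-! ### Nondegenerate two-forms have nonzero top power -/

section Symplectic

variable {E : Type*} [AddCommGroup E] [Module ℝ E]

lemma altWedge_compLinearMap {F : Type*} [AddCommGroup F] [Module ℝ F] {k l : ℕ}
    (a : E [⋀^Fin k]→ₗ[ℝ] ℝ) (b : E [⋀^Fin l]→ₗ[ℝ] ℝ) (f : F →ₗ[ℝ] E) :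
    altWedge (a.compLinearMap f) (b.compLinearMap f) = (altWedge a b).compLinearMap f := by
  ext v
  rw [AlternatingMap.compLinearMap_apply, altWedge_apply, altWedge_apply]
  rfl

/-- Since `a` kills every `v i`, only the permutations that feed `f` to `a` survive. -/
lemma altWedge_altWedgePow_cons (a : E [⋀^Fin 1]→ₗ[ℝ] ℝ) (w : E [⋀^Fin 2]→ₗ[ℝ] ℝ) (m : ℕ)
    (f : E) (v : Fin (2 * m) → E) (hv : ∀ i, a (fun _ => v i) = 0) :
    altWedge a (altWedgePow w m)
      ((Matrix.vecCons f v : Fin (2 * m + 1) → E) ∘ Fin.cast (Nat.add_comm 1 (2 * m))) =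
      a (fun _ => f) * altWedgePow w m v := by
  rw [altWedge_altWedgePow_apply, altWedgePow_apply]
  set V : Fin (2 * m + 1) → E := Matrix.vecCons f v with hV
  have h1 : ∀ σ : Equiv.Perm (Fin (2 * m + 1)),
      (finCongr (Nat.add_comm (2 * m) 1)).permCongr σ 0 = Fin.cast (Nat.add_comm (2 * m) 1) (σ 0) :=
    fun σ => rfl
  have h2 : ∀ (σ : Equiv.Perm (Fin (2 * m + 1))) (i : Fin (2 * m)),
      (finCongr (Nat.add_comm (2 * m) 1)).permCongr σ (Fin.natAdd 1 i) =
        Fin.cast (Nat.add_comm (2 * m) 1) (σ i.succ) := by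
    intro σ i
    rw [Equiv.permCongr_apply]
    simp only [finCongr_apply, finCongr_symm]
    congr 2
    ext; simp
  rw [← Equiv.sum_comp (finCongr (Nat.add_comm (2 * m) 1)).permCongr]
  simp only [Equiv.Perm.sign_permCongr, h1, h2, Function.comp_apply, Fin.cast_cast, Fin.cast_eq_self]
  rw [← Equiv.sum_comp (Equiv.Perm.decomposeFin (n := 2 * m)).symm, Fintype.sum_prod_type,
      Fin.sum_univ_succ, Finset.sum_eq_zero (s := Finset.univ (α := Fin (2 * m))), add_zero]
  · simp only [Equiv.Perm.decomposeFin.symm_sign, Equiv.Perm.decomposeFin_symm_apply_zero,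
      Equiv.Perm.decomposeFin_symm_apply_succ, hV, Matrix.cons_val_zero, Equiv.swap_self,
      Equiv.refl_apply, Matrix.cons_val_succ, if_true, one_mul]
    rw [mul_left_comm]
    congr 1
    rw [Finset.mul_sum]
    refine Finset.sum_congr rfl fun σ _ => ?_
    rw [mul_left_comm]
    rfl
  · intro j _
    refine Finset.sum_eq_zero fun e _ => ?_
    simp [hV, hv]

/-- Contraction of a `2`-form with a vector, as a linear map. -/
def contractLin (w : E [⋀^Fin 2]→ₗ[ℝ] ℝ) (e : E) : E →ₗ[ℝ] ℝ :=
  (AlternatingMap.ofSubsingleton ℝ E ℝ (0 : Fin 1)).symm (w.curryLeft e)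

lemma contractLin_apply (w : E [⋀^Fin 2]→ₗ[ℝ] ℝ) (e u : E) : contractLin w e u = w ![e, u] := by
  simp only [contractLin, AlternatingMap.ofSubsingleton_symm_apply_apply,
    AlternatingMap.curryLeft_apply_apply]
  congr 1
  ext i; fin_cases i <;> rfl

lemma two_form_swap (w : E [⋀^Fin 2]→ₗ[ℝ] ℝ) (e u : E) : w ![e, u] = - w ![u, e] := by
  have := w.map_swap ![u, e] (show (0 : Fin 2) ≠ 1 by decide)
  rw [← this]
  congr 1
  ext i; fin_cases i <;> simp

lemma two_form_self (w : E [⋀^Fin 2]→ₗ[ℝ] ℝ) (e : E) : w ![e, e] = 0 := by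
  have := two_form_swap w e e
  linarith

end Symplectic

/-- The top power of a nondegenerate `2`-form does not vanish. -/
lemma altWedgePow_ne_zero (m : ℕ) : ∀ {E : Type*} [AddCommGroup E] [Module ℝ E]
    [FiniteDimensional ℝ E] (_ : Module.finrank ℝ E = 2 * m) (w : E [⋀^Fin 2]→ₗ[ℝ] ℝ)
    (_ : ∀ v, v ≠ 0 → ∃ u, w ![v, u] ≠ 0), altWedgePow w m ≠ 0 := by
  induction m with
  | zero =>
    intro E _ _ _ _ w _ h
    have := congrArg (fun a => a (fun _ => 0)) h
    simp [altWedgePow] at this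
  | succ m ih =>
    intro E _ _ _ hE w hw h
    have : Nontrivial E := Module.nontrivial_of_finrank_pos (R := ℝ) (by omega)
    obtain ⟨e, he⟩ := exists_ne (0 : E)
    obtain ⟨f, hf⟩ := hw e he
    set c := w ![e, f] with hc
    have hfe : w ![f, e] = -c := two_form_swap w f e
    -- `ker φ` is the symplectic complement of the plane of `e` and `f`. It has dimension `2 m`, and
    -- `w` stays nondegenerate on it. Up to the factor `(m + 1) * c`, the value of `w ^ (m + 1)` on
    -- `e, f, v` is that of `w ^ m` on `v`, so induction applies.
    let φ : E →ₗ[ℝ] ℝ × ℝ := (contractLin w e).prod (contractLin w f)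
    have hφ : ∀ x, φ x = (w ![e, x], w ![f, x]) := fun x => by
      simp [φ, contractLin_apply]
    have hφab : ∀ a b : ℝ, φ (a • e + b • f) = (b * c, -(a * c)) := by
      intro a b
      rw [map_add, map_smul, map_smul, hφ, hφ]
      simp [two_form_self, hfe, ← hc]
    have hsurj : Function.Surjective φ := by
      rintro ⟨x, y⟩
      exact ⟨(-y / c) • e + (x / c) • f, by rw [hφab]; ext <;> simp <;> field_simp⟩
    have hker : Module.finrank ℝ (LinearMap.ker φ) = 2 * m := by
      have := φ.finrank_range_add_finrank_ker
      rw [LinearMap.range_eq_top.2 hsurj, finrank_top, Module.finrank_prod, hE] at this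
      simp at this; omega
    have hW : ∀ v : E, v ∈ LinearMap.ker φ ↔ w ![e, v] = 0 ∧ w ![f, v] = 0 := by
      intro v
      rw [LinearMap.mem_ker, hφ, Prod.mk_eq_zero]
    refine ih hker (w.compLinearMap (LinearMap.ker φ).subtype) ?_ ?_
    · rintro ⟨v, hv⟩ hv0
      obtain ⟨u, hu⟩ := hw v (by simpa using hv0)
      -- Subtracting from `u` its component in the plane puts it into the complement and does not
      -- change its pairing with `v`, which is orthogonal to the plane.
      obtain ⟨a, b, hab⟩ : ∃ a b : ℝ, φ (a • e + b • f) = φ u := by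
        refine ⟨-w ![f, u] / c, w ![e, u] / c, ?_⟩
        rw [hφab, hφ]; ext <;> simp <;> field_simp
      refine ⟨⟨u - (a • e + b • f), by rw [LinearMap.mem_ker, map_sub, hab, sub_self]⟩, ?_⟩
      rw [AlternatingMap.compLinearMap_apply]
      have : (fun i => (LinearMap.ker φ).subtype (![(⟨v, hv⟩ : LinearMap.ker φ),
          ⟨u - (a • e + b • f), by rw [LinearMap.mem_ker, map_sub, hab, sub_self]⟩] i)) =
          ![v, u - (a • e + b • f)] := by
        ext i; fin_cases i <;> rfl
      erw [this]
      rw [← contractLin_apply, map_sub, map_add, map_smul, map_smul, contractLin_apply,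
        contractLin_apply, contractLin_apply, two_form_swap w v e, two_form_swap w v f,
        ((hW v).1 hv).1, ((hW v).1 hv).2]
      simpa using hu
    · ext v
      have h1 := altWedgePow_succ_cons w m e (w.curryLeft e) (fun u => by
        rw [AlternatingMap.curryLeft_apply_apply]
        congr 1
        ext i; fin_cases i <;> rfl)
        (Matrix.vecCons f (fun i => (v i : E)))
      have hval : ∀ u, w.curryLeft e (fun _ => u) = w ![e, u] := fun u => by
        rw [AlternatingMap.curryLeft_apply_apply]
        congr 1
        ext i; fin_cases i <;> rfl
      rw [altWedge_altWedgePow_cons _ _ _ _ _ (fun i => by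
        rw [hval]; exact ((hW _).1 (v i).2).1), h, hval] at h1
      rw [altWedgePow_compLinearMap, AlternatingMap.compLinearMap_apply]
      have hm : (m : ℝ) + 1 ≠ 0 := by positivity
      simpa [hm, ← hc, hf] using h1.symm

/-! ### Linear algebra of the contact condition along a hyperplane -/

section Boundary

variable {E F : Type*} [AddCommGroup E] [Module ℝ E] [FiniteDimensional ℝ E]
  [AddCommGroup F] [Module ℝ F] [FiniteDimensional ℝ F]

/-- The image of `D` is the hyperplane `ker f`, modulo which `Z` is `f Z / f ν` times `ν`. The
remaining part of `Z` contributes nothing, because `2 n + 2` vectors of a space of dimension `2 n +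
1` are dependent. -/
lemma altWedgePow_cons_hyperplane {n : ℕ} (hF : Module.finrank ℝ F = 2 * n + 1)
    (hE : Module.finrank ℝ E = 2 * (n + 1))
    (w : E [⋀^Fin 2]→ₗ[ℝ] ℝ) (Z ν : E) (D : F →ₗ[ℝ] E) (hD : Function.Injective D)
    (f : E →ₗ[ℝ] ℝ) (hf : ∀ x, f (D x) = 0) (hν : f ν ≠ 0) (v : Fin (2 * n + 1) → F) :
    altWedgePow w (n + 1) (Matrix.vecCons Z (fun i => D (v i))) =
      f Z / f ν * altWedgePow w (n + 1) (Matrix.vecCons ν (fun i => D (v i))) := by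
  have hker : LinearMap.range D = LinearMap.ker f := by
    refine Submodule.eq_of_le_of_finrank_eq ?_ ?_
    · rintro _ ⟨x, rfl⟩
      exact hf x
    · have h1 := f.finrank_range_add_finrank_ker
      have h2 : LinearMap.range f = ⊤ := by
        refine LinearMap.range_eq_top.2 fun r => ⟨(r / f ν) • ν, ?_⟩
        rw [map_smul, smul_eq_mul]; field_simp
      rw [h2, finrank_top, Module.finrank_self, hE] at h1
      rw [LinearMap.finrank_range_of_inj hD, hF]
      omega
  obtain ⟨t, ht⟩ : Z - (f Z / f ν) • ν ∈ LinearMap.range D := by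
    rw [hker, LinearMap.mem_ker, map_sub, map_smul, smul_eq_mul]
    field_simp
    simp
  have hZ : Z = D t + (f Z / f ν) • ν := by rw [ht]; abel
  have h0 : altWedgePow w (n + 1) (Matrix.vecCons (D t) (fun i => D (v i))) = 0 := by
    refine AlternatingMap.map_linearDependent _ _ fun hli => ?_
    have h3 : (Matrix.vecCons (D t) (fun i => D (v i)) : Fin (2 * n + 1 + 1) → E) =
        D ∘ (Matrix.vecCons t v : Fin (2 * n + 1 + 1) → F) := by
      ext i; refine Fin.cases ?_ (fun j => ?_) i <;> simp
    erw [h3] at hli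
    have := (LinearIndependent.of_comp D hli).fintype_card_le_finrank
    rw [hF, Fintype.card_fin] at this
    omega
  have hadd := (altWedgePow w (n + 1)).curryLeft.map_add (D t) ((f Z / f ν) • ν)
  rw [map_smul, ← hZ] at hadd
  have := congrArg (fun b => b (fun i => D (v i))) hadd
  simp only [AlternatingMap.add_apply, AlternatingMap.smul_apply,
    AlternatingMap.curryLeft_apply_apply, smul_eq_mul] at this
  refine this.trans ?_
  erw [h0]
  rw [zero_add]

/-- The contact condition at the boundary, in terms of a transverse Liouville vector. -/
lemma contact_of_liouville {n : ℕ} (hF : Module.finrank ℝ F = 2 * n + 1)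
    (hE : Module.finrank ℝ E = 2 * (n + 1))
    (w : E [⋀^Fin 2]→ₗ[ℝ] ℝ) (hw : ∀ v, v ≠ 0 → ∃ u, w ![v, u] ≠ 0)
    (Z : E) (D : F →ₗ[ℝ] E) (hD : Function.Injective D)
    (f : E →ₗ[ℝ] ℝ) (hf : ∀ x, f (D x) = 0) (hZ : f Z < 0)
    (a : F [⋀^Fin 1]→ₗ[ℝ] ℝ) (ha : ∀ x, a (fun _ => x) = w ![Z, D x]) :
    altWedge a (altWedgePow (w.compLinearMap D) n) ≠ 0 ∧
    ∀ ν, f ν < 0 → ∀ v : Fin (2 * n + 1) → F,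
      0 < altWedgePow w (n + 1) (Matrix.vecCons ν (fun i => D (v i))) →
      0 < altWedge a (altWedgePow (w.compLinearMap D) n)
        (v ∘ Fin.cast (Nat.add_comm 1 (2 * n))) := by
  have hval : ∀ u, w.curryLeft Z (fun _ => u) = w ![Z, u] := fun u => by
    rw [AlternatingMap.curryLeft_apply_apply]
    congr 1
    ext i; fin_cases i <;> rfl
  have haD : a = (w.curryLeft Z).compLinearMap D := by
    ext x
    rw [AlternatingMap.compLinearMap_apply, show x = fun _ => x 0 by
      ext i; rw [Subsingleton.elim i 0], ha, hval]
  have key : ∀ v : Fin (2 * n + 1) → F,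
      altWedgePow w (n + 1) (Matrix.vecCons Z (fun i => D (v i))) = (n + 1) *
      altWedge a (altWedgePow (w.compLinearMap D) n)
        (v ∘ Fin.cast (Nat.add_comm 1 (2 * n))) := by
    intro v
    rw [altWedgePow_succ_cons w n Z (w.curryLeft Z) hval, haD, altWedgePow_compLinearMap,
      altWedge_compLinearMap]
    rfl
  have hn : (0 : ℝ) < n + 1 := by positivity
  refine ⟨fun h0 => ?_, fun ν hν v hv => ?_⟩
  -- `Z` is transverse to the hyperplane, so it completes the image of a basis of `F` to a basis of
  -- `E`. If `a ∧ w ^ n` vanished, the top power of `w` would vanish on that basis.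
  · let b : Module.Basis (Fin (2 * n + 1)) ℝ F := Module.finBasisOfFinrankEq ℝ F hF
    have hli : LinearIndependent ℝ (Fin.cons Z (fun i => D (b i)) : Fin (2 * n + 1 + 1) → E) := by
      rw [linearIndependent_finCons]
      refine ⟨b.linearIndependent.map' D (LinearMap.ker_eq_bot.2 hD), fun hmem => ?_⟩
      have : Submodule.span ℝ (Set.range fun i => D (b i)) ≤ LinearMap.ker f := by
        rw [Submodule.span_le]
        rintro _ ⟨i, rfl⟩
        exact hf _
      exact hZ.ne (this hmem)
    let B : Module.Basis (Fin (2 * n + 1 + 1)) ℝ E :=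
      basisOfLinearIndependentOfCardEqFinrank hli (by rw [hE, Fintype.card_fin]; ring)
    have hB : ⇑B = (Fin.cons Z (fun i => D (b i)) : Fin (2 * n + 1 + 1) → E) :=
      coe_basisOfLinearIndependentOfCardEqFinrank _ _
    have hz : (altWedgePow w (n + 1) : E [⋀^Fin (2 * n + 1 + 1)]→ₗ[ℝ] ℝ) B = 0 := by
      rw [hB]
      refine (key b).trans ?_
      rw [h0]
      simp
    exact altWedgePow_ne_zero (n + 1) hE w hw
      (((altWedgePow w (n + 1) : E [⋀^Fin (2 * n + 1 + 1)]→ₗ[ℝ] ℝ).map_basis_eq_zero_iff B).1 hz)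
  -- `f Z` and `f ν` are both negative: `Z` may replace any outward vector without changing the
  -- orientation.
  · have h1 := altWedgePow_cons_hyperplane hF hE w Z ν D hD f hf hν.ne v
    rw [key] at h1
    have h2 : 0 < f Z / f ν * altWedgePow w (n + 1) (Matrix.vecCons ν (fun i => D (v i))) :=
      mul_pos (div_pos_of_neg_of_neg hZ hν) hv
    rw [← h1] at h2
    exact pos_of_mul_pos_right h2 hn.le

end Boundary

/-! ### Quotients by actions that are affine in coordinates -/

section Covering

variable {E : Type*} [NormedAddCommGroup E] [NormedSpace ℝ E] {H : Type*} [TopologicalSpace H]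
  {I : ModelWithCorners ℝ E H} {X : Type*} [TopologicalSpace X] {Γ : Type*} [Group Γ]
  [MulAction Γ X] {Q : Type*} [TopologicalSpace Q]

/-- `e` is a local inverse of the projection `π`, where `X` is regarded as a part of `H` by `j`. -/
def IsLocalSection (j : X → H) (π : X → Q) (e : OpenPartialHomeomorph Q H) : Prop :=
  ∀ h ∈ e.target, ∃ x, j x = h ∧ e.symm h = π x

lemma exists_isLocalSection {j : X → H} {π : X → Q} (hj : IsOpenEmbedding j)
    (hπ : IsLocalHomeomorph π) (x : X) :
    ∃ e : OpenPartialHomeomorph Q H, IsLocalSection j π e ∧ π x ∈ e.source ∧ e (π x) = j x := by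
  obtain ⟨f, hx, rfl⟩ := hπ x
  have : Nonempty X := ⟨x⟩
  refine ⟨f.symm.trans (hj.toOpenPartialHomeomorph j), ?_, ?_, ?_⟩
  · intro h hh
    rw [OpenPartialHomeomorph.trans_target] at hh
    obtain ⟨y, rfl⟩ : h ∈ range j := by simpa using hh.1
    refine ⟨y, rfl, ?_⟩
    have : (hj.toOpenPartialHomeomorph j).symm (j y) = y :=
      (hj.toOpenPartialHomeomorph j).left_inv (by simp)
    simp [this]
  · simp [hx]
  · simp [f.left_inv hx]

/-- The charted space structure of a quotient whose charts are all the local inverses of the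
projection. -/
@[reducible] def quotientChartedSpace {j : X → H} {π : X → Q} (hj : IsOpenEmbedding j)
    (hπ : IsLocalHomeomorph π) (hs : Function.Surjective π) : ChartedSpace H Q where
  atlas := {e | IsLocalSection j π e}
  chartAt q := (exists_isLocalSection hj hπ (Function.surjInv hs q)).choose
  mem_chart_source q := by
    have := (exists_isLocalSection hj hπ (Function.surjInv hs q)).choose_spec.2.1
    convert! this
    exact (Function.surjInv_eq hs q).symm
  chart_mem_atlas q := (exists_isLocalSection hj hπ (Function.surjInv hs q)).choose_spec.1

variable (I)

/-- `π : X → Q` is the quotient by an action of `Γ` which is affine in the coordinates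
`I ∘ j : X → E`, and the charts of `Q` are the local inverses of `π`. -/
structure IsAffineQuotient [ChartedSpace H Q] (j : X → H) (a : Γ → (E →ᴬ[ℝ] E)) (π : X → Q) :
    Prop where
  isOpenEmbedding : IsOpenEmbedding j
  isLocalHomeomorph : IsLocalHomeomorph π
  surjective : Function.Surjective π
  continuous_smul : ∀ γ : Γ, Continuous (fun x : X => γ • x)
  eq_iff : ∀ x y, π x = π y ↔ ∃ γ : Γ, γ • x = y
  affine : ∀ (γ : Γ) x, I (j (γ • x)) = a γ (I (j x))
  mem_atlas : ∀ e : OpenPartialHomeomorph Q H, e ∈ atlas H Q ↔ IsLocalSection j π e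

variable {I}

namespace IsAffineQuotient

variable [ChartedSpace H Q] {j : X → H} {a : Γ → (E →ᴬ[ℝ] E)} {π : X → Q}

lemma smul_eq (hq : IsAffineQuotient I j a π) (γ : Γ) (x : X) : π (γ • x) = π x :=
  ((hq.eq_iff _ _).2 ⟨γ, rfl⟩).symm

lemma symm_apply (hq : IsAffineQuotient I j a π) {e : OpenPartialHomeomorph Q H}
    (he : e ∈ atlas H Q) {x : X} (hx : j x ∈ e.target) : e.symm (j x) = π x := by
  obtain ⟨y, hy, h⟩ := (hq.mem_atlas e).1 he _ hx
  rw [h, hq.isOpenEmbedding.injective hy]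

lemma exists_lift (hq : IsAffineQuotient I j a π) {e : OpenPartialHomeomorph Q H}
    (he : e ∈ atlas H Q) {q : Q} (h : q ∈ e.source) : ∃ x, j x = e q ∧ π x = q := by
  obtain ⟨y, hy, h'⟩ := (hq.mem_atlas e).1 he _ (e.map_source h)
  exact ⟨y, hy, by rw [← h', e.left_inv h]⟩

/-- The coordinate change between two charts is locally the action of an element of `Γ`. -/
lemma exists_transition (hq : IsAffineQuotient I j a π) {e : OpenPartialHomeomorph Q H}
    (he : e ∈ atlas H Q) {x : X} (hx : π x ∈ e.source) :
    ∃ γ : Γ, ∀ᶠ x' in 𝓝 x, e (π x') = j (γ • x') := by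
  obtain ⟨y, hy, hy'⟩ := hq.exists_lift he hx
  obtain ⟨γ, rfl⟩ := (hq.eq_iff _ _).1 hy'.symm
  refine ⟨γ, ?_⟩
  have hc : ContinuousAt (fun x' => j (γ • x')) x :=
    (hq.isOpenEmbedding.continuous.comp (hq.continuous_smul γ)).continuousAt
  have : ∀ᶠ x' in 𝓝 x, j (γ • x') ∈ e.target :=
    hc.eventually_mem (e.open_target.mem_nhds (by
      rw [hy]; exact e.map_source hx))
  filter_upwards [this] with x' hx'
  rw [← hq.smul_eq γ x', ← hq.symm_apply he hx', e.right_inv hx']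

/-- `j` is open and `I` carries neighbourhoods to neighbourhoods within its range, so this covers
boundary points as well. -/
lemma eventually_of_nhds (hq : IsAffineQuotient I j a π) {x : X} {p : E → Prop}
    (h : ∀ᶠ x' in 𝓝 x, p (I (j x'))) : ∀ᶠ y in 𝓝[range I] (I (j x)), p y := by
  rw [← I.map_nhds_eq, eventually_map, ← hq.isOpenEmbedding.map_nhds_eq, eventually_map]
  exact h

lemma exists_coord_transition (hq : IsAffineQuotient I j a π) {e e' : OpenPartialHomeomorph Q H}
    (he : e ∈ atlas H Q) (he' : e' ∈ atlas H Q) {x : X} (hx : π x ∈ e.source)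
    (hx' : j x ∈ e'.target) :
    ∃ γ : Γ, e.extend I (π x) = a γ (I (j x)) ∧
      ∀ᶠ y in 𝓝[range I] (I (j x)), e.extend I ((e'.extend I).symm y) = a γ y := by
  obtain ⟨γ, hγ⟩ := hq.exists_transition he hx
  refine ⟨γ, ?_, hq.eventually_of_nhds ?_⟩
  · rw [OpenPartialHomeomorph.extend_coe, Function.comp, hγ.self_of_nhds, hq.affine]
  · have : ∀ᶠ x' in 𝓝 x, j x' ∈ e'.target :=
      hq.isOpenEmbedding.continuous.continuousAt.eventually_mem (e'.open_target.mem_nhds hx')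
    filter_upwards [hγ, this] with x' h1 h2
    rw [OpenPartialHomeomorph.extend_coe, OpenPartialHomeomorph.extend_coe_symm,
      Function.comp, Function.comp, I.left_inv, hq.symm_apply he' h2, h1, hq.affine]

lemma isManifold (hq : IsAffineQuotient I j a π) : IsManifold I ∞ Q := by
  refine isManifold_of_contDiffOn I ∞ Q fun e e' he he' => ?_
  rintro y ⟨hy, h, rfl⟩
  simp only [mem_preimage, I.left_inv, OpenPartialHomeomorph.trans_source,
    OpenPartialHomeomorph.symm_source, mem_inter_iff] at hy
  obtain ⟨x, rfl, hx⟩ := (hq.mem_atlas e).1 he _ hy.1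
  rw [hx] at hy
  obtain ⟨γ, h1, h2⟩ := hq.exists_coord_transition he' he hy.2 hy.1
  have : ContDiffWithinAt ℝ ∞ (a γ) (range I) (I (j x)) := (a γ).contDiff.contDiffWithinAt
  refine (this.congr_of_eventuallyEq (f₁ := I ∘ (e.symm.trans e') ∘ I.symm) h2 ?_).mono
    inter_subset_right
  simp only [Function.comp, I.left_inv, OpenPartialHomeomorph.coe_trans, hx]
  exact h1

lemma continuous_proj (hq : IsAffineQuotient I j a π) : Continuous π :=
  hq.isLocalHomeomorph.continuous

lemma exists_of_mem_target (hq : IsAffineQuotient I j a π) {e : OpenPartialHomeomorph Q H}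
    (he : e ∈ atlas H Q) {y : E} (hy : y ∈ (e.extend I).target) :
    ∃ x, I (j x) = y ∧ j x ∈ e.target ∧ (e.extend I).symm y = π x := by
  rw [OpenPartialHomeomorph.extend_target] at hy
  obtain ⟨hy, h, rfl⟩ := hy
  rw [mem_preimage, I.left_inv] at hy
  obtain ⟨x, rfl, hx⟩ := (hq.mem_atlas e).1 he _ hy
  refine ⟨x, rfl, hy, ?_⟩
  rw [OpenPartialHomeomorph.extend_coe_symm, Function.comp, I.left_inv, hx]

/-- The derivative of the inverse of a chart is the linear part of an element of `Γ`. -/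
lemma exists_mfderivWithin_symm (hq : IsAffineQuotient I j a π) (q₀ : Q) {y : E}
    (hy : y ∈ (extChartAt I q₀).target) :
    ∃ (γ : Γ) (x : X), I (j x) = y ∧ (extChartAt I q₀).symm y = π x ∧
      extChartAt I (π x) (π x) = a γ y ∧
      mfderivWithin 𝓘(ℝ, E) I (extChartAt I q₀).symm (range I) y = (a γ).contLinear := by
  obtain ⟨x, rfl, hx1, hx2⟩ := hq.exists_of_mem_target (chart_mem_atlas H q₀) hy
  obtain ⟨γ, h1, h2⟩ := hq.exists_coord_transition (chart_mem_atlas H (π x)) (chart_mem_atlas H q₀)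
    (mem_chart_source H (π x)) hx1
  have hx2' : (extChartAt I q₀).symm (I (j x)) = π x := hx2
  refine ⟨γ, x, rfl, hx2', h1, ?_⟩
  apply HasMFDerivWithinAt.mfderivWithin
  · refine ⟨(continuousOn_extChartAt_symm q₀ _ hy).mono_of_mem_nhdsWithin
      (extChartAt_target_mem_nhdsWithin_of_mem hy), ?_⟩
    simp only [writtenInExtChartAt, extChartAt_model_space_eq_id, PartialEquiv.refl_coe,
      PartialEquiv.refl_symm, Function.comp_id, modelWithCornersSelf_coe, range_id, inter_univ,
      id_eq, preimage_id_eq]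
    have h3 : HasFDerivWithinAt (a γ) (a γ).contLinear (range I) (I (j x)) :=
      (a γ).hasFDerivWithinAt
    rw [hx2']
    refine h3.congr_of_eventuallyEq h2 ?_
    rw [Function.comp, hx2']
    exact h1
  · exact I.uniqueMDiffOn _ ⟨j x, rfl⟩

variable (I) in
/-- The form on a quotient whose local expression in the charts is `F`. -/
def form {k : ℕ} (F : E → E [⋀^Fin k]→L[ℝ] ℝ) : DiffForm I Q k := fun q => F (extChartAt I q q)

/-- Invariance of a form under the action of `Γ`. -/
def Invariant (I : ModelWithCorners ℝ E H) (j : X → H) (a : Γ → (E →ᴬ[ℝ] E)) {k : ℕ}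
    (F : E → E [⋀^Fin k]→L[ℝ] ℝ) : Prop :=
  ∀ γ x, (F (a γ (I (j x)))).compContinuousLinearMap (a γ).contLinear = F (I (j x))

/-- The value of the form at a point is read in the preferred chart there. That chart differs from
the chart at `q₀` by an element of `Γ`, which invariance absorbs. -/
lemma form_inChart (hq : IsAffineQuotient I j a π) {k : ℕ} {F : E → E [⋀^Fin k]→L[ℝ] ℝ}
    (hF : Invariant I j a F) (q₀ : Q) {y : E} (hy : y ∈ (extChartAt I q₀).target) :
    (form I F : DiffForm I Q k).inChart q₀ y = F y := by
  obtain ⟨γ, x, rfl, h1, h2, h3⟩ := hq.exists_mfderivWithin_symm q₀ hy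
  have : ∀ q, q = π x → (F (extChartAt I q q)).compContinuousLinearMap (a γ).contLinear =
      F (I (j x)) := by
    rintro _ rfl
    rw [h2, hF]
  rw [DiffForm.inChart, h3]
  exact this _ h1

lemma form_isSmooth (hq : IsAffineQuotient I j a π) {k : ℕ} {F : E → E [⋀^Fin k]→L[ℝ] ℝ}
    (hF : Invariant I j a F) (hs : ∀ x, ContDiffAt ℝ ∞ F (I (j x))) :
    (form I F : DiffForm I Q k).IsSmooth := by
  intro q₀ y hy
  obtain ⟨x, rfl, -, -⟩ := hq.exists_of_mem_target (chart_mem_atlas H q₀) hy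
  exact (hs x).contDiffWithinAt.congr (fun y hy => hq.form_inChart hF q₀ hy)
    (hq.form_inChart hF q₀ hy)

lemma exists_lift_extChartAt (hq : IsAffineQuotient I j a π) (q : Q) :
    ∃ x, I (j x) = extChartAt I q q ∧ π x = q := by
  obtain ⟨x, hx, h⟩ := hq.exists_lift (chart_mem_atlas H q) (mem_chart_source H q)
  exact ⟨x, by rw [hx]; rfl, h⟩

/-- The tangent space at `q` is `E`, identified through the preferred chart at `q`, so this chart is
the identity to first order. -/
lemma mfderiv_extChartAt_self (hq : IsAffineQuotient I j a π) (q : Q) :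
    mfderiv I 𝓘(ℝ, E) (extChartAt I q) q = ContinuousLinearMap.id ℝ E := by
  have := hq.isManifold
  apply HasMFDerivAt.mfderiv
  refine ⟨continuousAt_extChartAt q, ?_⟩
  simp only [writtenInExtChartAt, extChartAt_model_space_eq_id, PartialEquiv.refl_coe,
    Function.id_comp]
  refine (hasFDerivWithinAt_id _ _).congr_of_eventuallyEq ?_ ?_
  · filter_upwards [extChartAt_target_mem_nhdsWithin q] with y hy
    exact (extChartAt I q).right_inv hy
  · exact (extChartAt I q).right_inv (mem_extChartAt_target q)

/-- `F` is differentiable in the full sense even at boundary points, and the range of `I` has unique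
derivatives; hence the derivative within the range is the ordinary one. -/
lemma form_d (hq : IsAffineQuotient I j a π) {k : ℕ} {F : E → E [⋀^Fin k]→L[ℝ] ℝ}
    (hF : Invariant I j a F) (hs : ∀ x, DifferentiableAt ℝ F (I (j x))) :
    (form I F : DiffForm I Q k).d = form I (extDeriv F) := by
  funext q
  have h1 : extDerivWithin ((form I F : DiffForm I Q k).inChart q) (range I) (extChartAt I q q) =
      extDeriv F (extChartAt I q q) := by
    have h2 : (form I F : DiffForm I Q k).inChart q =ᶠ[𝓝[range I] (extChartAt I q q)] F := by
      filter_upwards [extChartAt_target_mem_nhdsWithin q] with y hy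
      exact hq.form_inChart hF q hy
    obtain ⟨x, hx, -⟩ := hq.exists_lift_extChartAt q
    have hx' : extChartAt I q q ∈ range I := ⟨j x, hx⟩
    rw [h2.extDerivWithin_eq_of_mem hx', extDerivWithin, extDeriv,
      fderivWithin_eq_fderiv (I.uniqueDiffOn _ hx')]
    rw [← hx]
    exact hs x
  rw [DiffForm.d, h1, hq.mfderiv_extChartAt_self q]
  ext v
  rfl

end IsAffineQuotient

lemma isAffineQuotient_orbitRel [T2Space X] [LocallyCompactSpace X] [ProperlyDiscontinuousSMul Γ X]
    [ContinuousConstSMul Γ X] [IsCancelSMul Γ X] {j : X → H} (hj : IsOpenEmbedding j)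
    (a : Γ → (E →ᴬ[ℝ] E)) (ha : ∀ (γ : Γ) x, I (j (γ • x)) = a γ (I (j x))) :
    let _ : ChartedSpace H (MulAction.orbitRel.Quotient Γ X) := quotientChartedSpace hj
      (isQuotientCoveringMap_quotientMk_of_properlyDiscontinuousSMul
        (G := Γ)).isCoveringMap.isLocalHomeomorph Quotient.mk_surjective
    IsAffineQuotient I j a (Quotient.mk (MulAction.orbitRel Γ X)) := by
  let _ : ChartedSpace H (MulAction.orbitRel.Quotient Γ X) := quotientChartedSpace hj
      (isQuotientCoveringMap_quotientMk_of_properlyDiscontinuousSMul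
        (G := Γ)).isCoveringMap.isLocalHomeomorph Quotient.mk_surjective
  exact
    { isOpenEmbedding := hj
      isLocalHomeomorph := (isQuotientCoveringMap_quotientMk_of_properlyDiscontinuousSMul
        (G := Γ)).isCoveringMap.isLocalHomeomorph
      surjective := Quotient.mk_surjective
      continuous_smul := continuous_const_smul
      eq_iff := fun x y => by
        rw [eq_comm, Quotient.eq, MulAction.orbitRel_apply]
        rfl
      affine := ha
      mem_atlas := fun e => Iff.rfl }

end Covering

/-! ### Liouville domains as quotients of regions in the half-space -/

/-- The inclusion of the hyperplane `y 0 = 0`. -/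
def hyperplaneIncl (n : ℕ) :
    EuclideanSpace ℝ (Fin (2 * n + 1)) →L[ℝ] EuclideanSpace ℝ (Fin (2 * (n + 1))) :=
  LinearMap.toContinuousLinearMap
    { toFun := fun z => WithLp.toLp 2 (Fin.cons 0 z : Fin (2 * n + 1 + 1) → ℝ)
      map_add' := fun x y => by
        ext i; refine Fin.cases ?_ (fun k => ?_) i <;> simp
      map_smul' := fun c x => by
        ext i; refine Fin.cases ?_ (fun k => ?_) i <;> simp }

/-- The projection to the hyperplane `y 0 = 0`. -/
def hyperplaneProj (n : ℕ) :
    EuclideanSpace ℝ (Fin (2 * (n + 1))) →L[ℝ] EuclideanSpace ℝ (Fin (2 * n + 1)) :=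
  LinearMap.toContinuousLinearMap
    { toFun := fun y => WithLp.toLp 2 (fun i : Fin (2 * n + 1) =>
        y (Fin.succ i : Fin (2 * n + 1 + 1)))
      map_add' := fun x y => by ext i; simp
      map_smul' := fun c x => by ext i; simp }

lemma hyperplaneIncl_zero (n : ℕ) (z : EuclideanSpace ℝ (Fin (2 * n + 1))) :
    hyperplaneIncl n z 0 = 0 := rfl

lemma hyperplaneProj_incl {n : ℕ} (z : EuclideanSpace ℝ (Fin (2 * n + 1))) :
    hyperplaneProj n (hyperplaneIncl n z) = z := rfl

lemma hyperplaneIncl_proj {n : ℕ} {y : EuclideanSpace ℝ (Fin (2 * (n + 1)))} (hy : y 0 = 0) :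
    hyperplaneIncl n (hyperplaneProj n y) = y := by
  ext i
  refine Fin.cases ?_ (fun k => rfl) (i : Fin (2 * n + 1 + 1))
  exact hy.symm

lemma hyperplaneIncl_injective (n : ℕ) : Function.Injective (hyperplaneIncl n) :=
  Function.LeftInverse.injective hyperplaneProj_incl

lemma hyperplaneIncl_isClosedEmbedding (n : ℕ) : IsClosedEmbedding (hyperplaneIncl n) :=
  LinearMap.isClosedEmbedding_of_injective (f := (hyperplaneIncl n).toLinearMap)
    (LinearMap.ker_eq_bot.2 (hyperplaneIncl_injective n))

/-- The splitting of space into the hyperplane `y 0 = 0` and a line. -/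
def hyperplaneSplit (n : ℕ) :
    (EuclideanSpace ℝ (Fin (2 * n + 1)) × ℝ) ≃L[ℝ] EuclideanSpace ℝ (Fin (2 * (n + 1))) :=
  LinearEquiv.toContinuousLinearEquiv
    { toFun := fun z => WithLp.toLp 2 (Fin.cons z.2 z.1 : Fin (2 * n + 1 + 1) → ℝ)
      map_add' := fun x y => by
        ext i; refine Fin.cases ?_ (fun k => ?_) i <;> simp
      map_smul' := fun c x => by
        ext i; refine Fin.cases ?_ (fun k => ?_) i <;> simp
      invFun := fun y => (hyperplaneProj n y, y 0)
      left_inv := fun z => rfl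
      right_inv := fun y => by
        ext i
        exact Fin.cases (motive := fun i : Fin (2 * n + 1 + 1) =>
          (Fin.cons (y 0) (hyperplaneProj n y) : Fin (2 * n + 1 + 1) → ℝ) i = y i)
          rfl (fun k => rfl) i }

lemma hyperplaneSplit_apply (n : ℕ) (z : EuclideanSpace ℝ (Fin (2 * n + 1))) :
    hyperplaneSplit n (z, 0) = hyperplaneIncl n z := rfl

/-- A group `Γ` of affine transformations, a region `O` and a `1`-form `F` on `O` such that
the quotient of the part of `O` in the half-space `0 ≤ y 0` by `Γ` is a Liouville domain with
disconnected boundary. -/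
structure LiouvilleData (n : ℕ) (Γ : Subgroup (Equiv.Perm (EuclideanSpace ℝ (Fin (2 * (n + 1))))))
    (O : Set (EuclideanSpace ℝ (Fin (2 * (n + 1)))))
    (F : EuclideanSpace ℝ (Fin (2 * (n + 1))) →
      EuclideanSpace ℝ (Fin (2 * (n + 1))) [⋀^Fin 1]→L[ℝ] ℝ) : Prop where
  isOpen : IsOpen O
  affine : ∀ γ ∈ Γ, ∃ a : EuclideanSpace ℝ (Fin (2 * (n + 1))) →ᴬ[ℝ]
    EuclideanSpace ℝ (Fin (2 * (n + 1))), ∀ y, γ y = a y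
  -- The sign of the coordinate `0` is preserved, so the half-space and its boundary descend to the
  -- quotient. The sign of the coordinate `1` is preserved too and will separate the boundary.
  scale_zero : ∀ γ ∈ Γ, ∃ c : ℝ, 0 < c ∧ ∀ y, γ y 0 = c * y 0
  scale_one : ∀ γ ∈ Γ, ∃ c : ℝ, 0 < c ∧ ∀ y, γ y ⟨1, by omega⟩ = c * y ⟨1, by omega⟩
  mapsTo : ∀ γ ∈ Γ, ∀ y ∈ O, γ y ∈ O
  free : ∀ γ ∈ Γ, ∀ y ∈ O, γ y = y → γ = 1
  finite : ∀ K ⊆ O, IsCompact K → {γ | γ ∈ Γ ∧ ∃ y ∈ K, γ y ∈ K}.Finite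
  cocompact : ∃ K ⊆ O, IsCompact K ∧ ∀ y ∈ O, 0 ≤ y 0 → ∃ γ ∈ Γ, γ y ∈ K
  connected : IsConnected {y | y ∈ O ∧ 0 ≤ y 0}
  one_ne_zero : ∀ y ∈ O, y 0 = 0 → y ⟨1, by omega⟩ ≠ 0
  exists_pos : ∃ y ∈ O, y 0 = 0 ∧ 0 < y ⟨1, by omega⟩
  exists_neg : ∃ y ∈ O, y 0 = 0 ∧ y ⟨1, by omega⟩ < 0
  smooth : ∀ y ∈ O, ContDiffAt ℝ ∞ F y
  invariant : ∀ γ ∈ Γ, ∀ a : EuclideanSpace ℝ (Fin (2 * (n + 1))) →ᴬ[ℝ]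
    EuclideanSpace ℝ (Fin (2 * (n + 1))), (∀ y, γ y = a y) → ∀ y ∈ O,
      (F (a y)).compContinuousLinearMap a.contLinear = F y
  nondegenerate : ∀ y ∈ O, ∀ v, v ≠ 0 → ∃ w, extDeriv F y ![v, w] ≠ 0
  -- `Z` is the Liouville vector, dual to `F` under `extDeriv F`; `Z 0 < 0` says that it points
  -- outward.
  liouville : ∀ y ∈ O, y 0 = 0 → ∃ Z : EuclideanSpace ℝ (Fin (2 * (n + 1))), Z 0 < 0 ∧
    ∀ w, extDeriv F y ![Z, w] = F y (fun _ => w)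

/-! ### The quotient manifold and its boundary manifold -/

namespace LiouvilleData

variable {n : ℕ} {Γ : Subgroup (Equiv.Perm (EuclideanSpace ℝ (Fin (2 * (n + 1)))))}
    {O : Set (EuclideanSpace ℝ (Fin (2 * (n + 1))))}
    {F : EuclideanSpace ℝ (Fin (2 * (n + 1))) →
      EuclideanSpace ℝ (Fin (2 * (n + 1))) [⋀^Fin 1]→L[ℝ] ℝ}

/-- The affine map underlying an element of `Γ`. -/
def aff (D : LiouvilleData n Γ O F) (γ : Γ) : EuclideanSpace ℝ (Fin (2 * (n + 1))) →ᴬ[ℝ]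
    EuclideanSpace ℝ (Fin (2 * (n + 1))) := (D.affine γ γ.2).choose

lemma aff_apply (D : LiouvilleData n Γ O F) (γ : Γ) (y) : D.aff γ y = γ.1 y :=
  ((D.affine γ γ.2).choose_spec y).symm

/-- The part of the region `O` in the half-space. -/
def Cover (_ : LiouvilleData n Γ O F) : Type := {h : EuclideanHalfSpace (2 * (n + 1)) // h.1 ∈ O}

/-- The part of the region `O` in the hyperplane `y 0 = 0`. -/
def BdryCover (_ : LiouvilleData n Γ O F) : Type :=
  {z : EuclideanSpace ℝ (Fin (2 * n + 1)) // hyperplaneIncl n z ∈ O}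

variable (D : LiouvilleData n Γ O F)

instance : TopologicalSpace D.Cover := instTopologicalSpaceSubtype
instance : TopologicalSpace D.BdryCover := instTopologicalSpaceSubtype
instance : T2Space D.Cover :=
  T2Space.of_injective_continuous (f := fun x : D.Cover => x.1.1)
    (Subtype.val_injective.comp Subtype.val_injective)
    (continuous_subtype_val.comp continuous_subtype_val)
instance : T2Space D.BdryCover :=
  inferInstanceAs (T2Space {z : EuclideanSpace ℝ (Fin (2 * n + 1)) // hyperplaneIncl n z ∈ O})

lemma isOpenEmbedding_cover (D : LiouvilleData n Γ O F) :
    IsOpenEmbedding (fun x : D.Cover => (x.1 : EuclideanHalfSpace (2 * (n + 1)))) :=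
  (D.isOpen.preimage continuous_subtype_val).isOpenEmbedding_subtypeVal

lemma isOpenEmbedding_bdryCover (D : LiouvilleData n Γ O F) :
    IsOpenEmbedding (fun x : D.BdryCover => (x.1 : EuclideanSpace ℝ (Fin (2 * n + 1)))) :=
  (D.isOpen.preimage (hyperplaneIncl n).continuous).isOpenEmbedding_subtypeVal

instance : LocallyCompactSpace D.Cover := by
  have := (𝓡∂ (2 * (n + 1))).locallyCompactSpace
  exact D.isOpenEmbedding_cover.locallyCompactSpace

instance : LocallyCompactSpace D.BdryCover :=
  D.isOpenEmbedding_bdryCover.locallyCompactSpace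

instance : MulAction Γ D.Cover where
  smul γ x := ⟨⟨γ.1 x.1.1, by
    obtain ⟨c, hc, h⟩ := D.scale_zero γ γ.2
    rw [h]
    exact mul_nonneg hc.le x.1.2⟩, D.mapsTo γ γ.2 _ x.2⟩
  one_smul x := rfl
  mul_smul γ γ' x := rfl

lemma apply_zero (D : LiouvilleData n Γ O F) (γ : Γ) (z : EuclideanSpace ℝ (Fin (2 * n + 1))) :
    γ.1 (hyperplaneIncl n z) 0 = 0 := by
  obtain ⟨c, -, h⟩ := D.scale_zero γ γ.2
  rw [h, hyperplaneIncl_zero, mul_zero]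

instance : SMul Γ D.BdryCover where
  smul γ x := ⟨hyperplaneProj n (γ.1 (hyperplaneIncl n x.1)), by
    rw [hyperplaneIncl_proj (D.apply_zero γ _)]
    exact D.mapsTo γ γ.2 _ x.2⟩

lemma incl_smul (γ : Γ) (x : D.BdryCover) :
    hyperplaneIncl n (γ • x).1 = γ.1 (hyperplaneIncl n x.1) :=
  hyperplaneIncl_proj (D.apply_zero γ _)

instance : MulAction Γ D.BdryCover where
  one_smul x := rfl
  mul_smul γ γ' x := by
    refine Subtype.ext (hyperplaneIncl_injective n ?_)
    rw [D.incl_smul, D.incl_smul, D.incl_smul]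
    rfl

/-- The inclusion of the boundary, upstairs. -/
def incl (x : D.BdryCover) : D.Cover :=
  ⟨⟨hyperplaneIncl n x.1, (hyperplaneIncl_zero n x.1).ge⟩, x.2⟩

lemma smul_incl (γ : Γ) (x : D.BdryCover) : D.incl (γ • x) = γ • D.incl x :=
  Subtype.ext (Subtype.ext (D.incl_smul γ x))

lemma continuous_incl : Continuous D.incl :=
  (((hyperplaneIncl n).continuous.comp continuous_subtype_val).subtype_mk _).subtype_mk _

lemma incl_injective : Function.Injective D.incl := fun _ _ h =>
  Subtype.ext (hyperplaneIncl_injective n (congrArg (fun z : D.Cover => z.1.1) h))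

instance : ContinuousConstSMul Γ D.Cover where
  continuous_const_smul γ := by
    have : Continuous γ.1 := by
      have h : (γ.1 : EuclideanSpace ℝ (Fin (2 * (n + 1))) → _) = D.aff γ :=
        funext fun y => (D.aff_apply γ y).symm
      rw [h]
      exact (D.aff γ).continuous
    have h2 : Continuous fun x : D.Cover => x.1.1 :=
      continuous_subtype_val.comp continuous_subtype_val
    exact ((this.comp h2).subtype_mk _).subtype_mk _

instance : ContinuousConstSMul Γ D.BdryCover where
  continuous_const_smul γ := by
    have hv : Continuous fun x : D.Cover => x.1.1 :=
      continuous_subtype_val.comp continuous_subtype_val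
    have hs : Continuous fun x : D.Cover => γ • x := continuous_const_smul γ
    have h : Continuous fun x : D.BdryCover => (γ • D.incl x).1.1 :=
      hv.comp (hs.comp D.continuous_incl)
    exact ((hyperplaneProj n).continuous.comp h).subtype_mk _

instance : IsCancelSMul Γ D.Cover := by
  rw [isCancelSMul_iff_eq_one_of_smul_eq]
  intro γ x h
  exact Subtype.ext (D.free γ γ.2 x.1.1 x.2 (congrArg (fun z : D.Cover => z.1.1) h))

instance : IsCancelSMul Γ D.BdryCover := by
  rw [isCancelSMul_iff_eq_one_of_smul_eq]
  intro γ x h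
  rw [isCancelSMul_iff_eq_one_of_smul_eq.1 (inferInstanceAs (IsCancelSMul Γ D.Cover)) γ (D.incl x)]
  rw [← D.smul_incl, h]

instance : ProperlyDiscontinuousSMul Γ D.Cover where
  finite_disjoint_inter_image := by
    intro K L hK hL
    have hc : Continuous fun x : D.Cover => x.1.1 :=
      continuous_subtype_val.comp continuous_subtype_val
    -- The finiteness condition speaks of a single compact set, so it is applied to `K ∪ L`.
    have hfin := D.finite ((fun x : D.Cover => x.1.1) '' (K ∪ L))
      (by rintro _ ⟨x, -, rfl⟩; exact x.2) ((hK.union hL).image hc)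
    refine (hfin.preimage Subtype.val_injective.injOn).subset ?_
    rintro γ ⟨_, ⟨x, hx, rfl⟩, hy⟩
    exact ⟨γ.2, x.1.1, ⟨x, Or.inl hx, rfl⟩, ⟨γ • x, Or.inr hy, rfl⟩⟩

instance : ProperlyDiscontinuousSMul Γ D.BdryCover where
  finite_disjoint_inter_image := by
    intro K L hK hL
    refine (ProperlyDiscontinuousSMul.finite_disjoint_inter_image (Γ := Γ)
      (hK.image D.continuous_incl) (hL.image D.continuous_incl)).subset ?_
    rintro γ ⟨_, ⟨x, hx, rfl⟩, hy⟩
    exact ⟨_, ⟨D.incl x, ⟨x, hx, rfl⟩, rfl⟩, ⟨γ • x, hy, D.smul_incl γ x⟩⟩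

/-- The quotient of the region by `Γ`. -/
def Quot : Type := MulAction.orbitRel.Quotient Γ D.Cover

/-- The quotient of the boundary by `Γ`. -/
def BdryQuot : Type := MulAction.orbitRel.Quotient Γ D.BdryCover

instance : TopologicalSpace D.Quot :=
  inferInstanceAs (TopologicalSpace (MulAction.orbitRel.Quotient Γ D.Cover))
instance : TopologicalSpace D.BdryQuot :=
  inferInstanceAs (TopologicalSpace (MulAction.orbitRel.Quotient Γ D.BdryCover))
instance : T2Space D.Quot := t2Space_of_properlyDiscontinuousSMul_of_t2Space
instance : T2Space D.BdryQuot := t2Space_of_properlyDiscontinuousSMul_of_t2Space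

/-- The projection to the quotient. -/
def proj : D.Cover → D.Quot := Quotient.mk (MulAction.orbitRel Γ D.Cover)

/-- The projection to the quotient, on the boundary. -/
def bdryProj : D.BdryCover → D.BdryQuot := Quotient.mk (MulAction.orbitRel Γ D.BdryCover)

instance : ChartedSpace (EuclideanHalfSpace (2 * (n + 1))) D.Quot :=
  quotientChartedSpace D.isOpenEmbedding_cover
    (isQuotientCoveringMap_quotientMk_of_properlyDiscontinuousSMul
      (G := Γ)).isCoveringMap.isLocalHomeomorph Quotient.mk_surjective

instance : ChartedSpace (EuclideanSpace ℝ (Fin (2 * n + 1))) D.BdryQuot :=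
  quotientChartedSpace D.isOpenEmbedding_bdryCover
    (isQuotientCoveringMap_quotientMk_of_properlyDiscontinuousSMul
      (G := Γ)).isCoveringMap.isLocalHomeomorph Quotient.mk_surjective

/-- The affine map of the hyperplane underlying an element of `Γ`. -/
def bdryAff (γ : Γ) : EuclideanSpace ℝ (Fin (2 * n + 1)) →ᴬ[ℝ] EuclideanSpace ℝ (Fin (2 * n + 1)) :=
  (hyperplaneProj n).toContinuousAffineMap.comp
    ((D.aff γ).comp (hyperplaneIncl n).toContinuousAffineMap)

lemma isAffineQuotient :
    IsAffineQuotient (𝓡∂ (2 * (n + 1))) (fun x : D.Cover => x.1) D.aff D.proj :=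
  isAffineQuotient_orbitRel D.isOpenEmbedding_cover D.aff fun γ _ => (D.aff_apply γ _).symm

lemma bdry_isAffineQuotient :
    IsAffineQuotient (𝓡 (2 * n + 1)) (fun x : D.BdryCover => x.1) D.bdryAff D.bdryProj :=
  isAffineQuotient_orbitRel D.isOpenEmbedding_bdryCover D.bdryAff fun γ x => by
    change hyperplaneProj n (γ.1 (hyperplaneIncl n x.1)) =
      hyperplaneProj n (D.aff γ (hyperplaneIncl n x.1))
    rw [D.aff_apply]

end LiouvilleData

/-! ### Compactness, connectedness and the disconnected boundary -/

namespace LiouvilleData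

variable {n : ℕ} {Γ : Subgroup (Equiv.Perm (EuclideanSpace ℝ (Fin (2 * (n + 1)))))}
    {O : Set (EuclideanSpace ℝ (Fin (2 * (n + 1))))}
    {F : EuclideanSpace ℝ (Fin (2 * (n + 1))) →
      EuclideanSpace ℝ (Fin (2 * (n + 1))) [⋀^Fin 1]→L[ℝ] ℝ}
    (D : LiouvilleData n Γ O F)

lemma continuous_coe : Continuous fun x : D.Cover => x.1.1 :=
  continuous_subtype_val.comp continuous_subtype_val

lemma continuous_proj : Continuous D.proj := D.isAffineQuotient.continuous_proj

lemma isEmbedding_coe : IsEmbedding fun x : D.Cover => x.1.1 :=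
  IsEmbedding.subtypeVal.comp IsEmbedding.subtypeVal

instance : CompactSpace D.Quot := by
  obtain ⟨K, hKO, hK, h⟩ := D.cocompact
  have hK' : IsCompact {x : D.Cover | x.1.1 ∈ K} := by
    rw [D.isEmbedding_coe.isCompact_iff]
    have : (fun x : D.Cover => x.1.1) '' {x | x.1.1 ∈ K} = K ∩ {y | 0 ≤ y 0} := by
      ext y
      constructor
      · rintro ⟨x, hx, rfl⟩
        exact ⟨hx, x.1.2⟩
      · rintro ⟨hy, hy0⟩
        exact ⟨⟨⟨y, hy0⟩, hKO hy⟩, hy, rfl⟩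
    rw [this]
    exact hK.inter_right (isClosed_le continuous_const
      (EuclideanSpace.proj (0 : Fin (2 * (n + 1)))).continuous)
  refine ⟨?_⟩
  convert! hK'.image D.continuous_proj
  refine (eq_univ_of_forall fun q => ?_).symm
  obtain ⟨x, rfl⟩ := D.isAffineQuotient.surjective q
  obtain ⟨γ, hγ, hy⟩ := h x.1.1 x.2 x.1.2
  exact ⟨(⟨γ, hγ⟩ : Γ) • x, hy, D.isAffineQuotient.smul_eq _ _⟩

instance : CompactSpace D.BdryQuot := by
  obtain ⟨K, hKO, hK, h⟩ := D.cocompact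
  have hK' : IsCompact {x : D.BdryCover | hyperplaneIncl n x.1 ∈ K} := by
    have hemb : IsEmbedding fun x : D.BdryCover => hyperplaneIncl n x.1 :=
      (hyperplaneIncl_isClosedEmbedding n).isEmbedding.comp IsEmbedding.subtypeVal
    rw [hemb.isCompact_iff]
    have : (fun x : D.BdryCover => hyperplaneIncl n x.1) '' {x | hyperplaneIncl n x.1 ∈ K} =
        K ∩ {y | y 0 = 0} := by
      ext y
      constructor
      · rintro ⟨x, hx, rfl⟩
        exact ⟨hx, hyperplaneIncl_zero n x.1⟩
      · rintro ⟨hy, hy0⟩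
        have := hyperplaneIncl_proj hy0
        exact ⟨⟨hyperplaneProj n y, by rw [this]; exact hKO hy⟩, by
          change hyperplaneIncl n (hyperplaneProj n y) ∈ K
          rwa [this], this⟩
    rw [this]
    exact hK.inter_right (isClosed_eq (EuclideanSpace.proj (0 : Fin (2 * (n + 1)))).continuous
      continuous_const)
  refine ⟨?_⟩
  convert! hK'.image D.bdry_isAffineQuotient.continuous_proj
  refine (eq_univ_of_forall fun q => ?_).symm
  obtain ⟨x, rfl⟩ := D.bdry_isAffineQuotient.surjective q
  obtain ⟨γ, hγ, hy⟩ := h (hyperplaneIncl n x.1) x.2 (hyperplaneIncl_zero n x.1).ge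
  refine ⟨(⟨γ, hγ⟩ : Γ) • x, ?_, D.bdry_isAffineQuotient.smul_eq _ _⟩
  change hyperplaneIncl n ((⟨γ, hγ⟩ : Γ) • x).1 ∈ K
  rw [D.incl_smul]
  exact hy

instance : ConnectedSpace D.Quot := by
  have := isConnected_iff_connectedSpace.1 D.connected
  let f : {y : EuclideanSpace ℝ (Fin (2 * (n + 1))) | y ∈ O ∧ 0 ≤ y 0} → D.Cover :=
    fun y => ⟨⟨y.1, y.2.2⟩, y.2.1⟩
  have hf : Continuous f := (continuous_subtype_val.subtype_mk _).subtype_mk _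
  have hs : Function.Surjective f := fun x => ⟨⟨x.1.1, x.2, x.1.2⟩, rfl⟩
  exact (D.isAffineQuotient.surjective.comp hs).connectedSpace (D.continuous_proj.comp hf)

/-- The inclusion of the boundary. -/
def bdryIncl : D.BdryQuot → D.Quot :=
  Quotient.map' D.incl (by
    rintro _ y ⟨γ, rfl⟩
    exact ⟨γ, (D.smul_incl γ y).symm⟩)

lemma bdryIncl_proj (x : D.BdryCover) : D.bdryIncl (D.bdryProj x) = D.proj (D.incl x) := rfl

lemma continuous_bdryIncl : Continuous D.bdryIncl :=
  continuous_quot_lift _ (D.continuous_proj.comp D.continuous_incl)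

lemma bdryIncl_injective : Function.Injective D.bdryIncl := by
  intro p p' h
  obtain ⟨x, rfl⟩ := D.bdry_isAffineQuotient.surjective p
  obtain ⟨x', rfl⟩ := D.bdry_isAffineQuotient.surjective p'
  rw [bdryIncl_proj, bdryIncl_proj] at h
  obtain ⟨γ, hγ⟩ := (D.isAffineQuotient.eq_iff _ _).1 h
  rw [← D.smul_incl] at hγ
  exact (D.bdry_isAffineQuotient.eq_iff _ _).2 ⟨γ, D.incl_injective hγ⟩

lemma exists_bdryCover {y : EuclideanSpace ℝ (Fin (2 * (n + 1)))} (hy : y ∈ O) (hy0 : y 0 = 0) :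
    ∃ z : D.BdryCover, hyperplaneIncl n z.1 = y := by
  have := hyperplaneIncl_proj hy0
  exact ⟨⟨hyperplaneProj n y, by rw [this]; exact hy⟩, this⟩

lemma range_bdryIncl : range D.bdryIncl = (𝓡∂ (2 * (n + 1))).boundary D.Quot := by
  have key : ∀ q : D.Quot, q ∈ (𝓡∂ (2 * (n + 1))).boundary D.Quot ↔
      (extChartAt (𝓡∂ (2 * (n + 1))) q q) 0 = 0 := by
    intro q
    change extChartAt (𝓡∂ (2 * (n + 1))) q q ∈ frontier (range (𝓡∂ (2 * (n + 1)))) ↔ _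
    rw [frontier_range_modelWithCornersEuclideanHalfSpace, mem_ofPred_eq, eq_comm]
  ext q
  rw [key]
  obtain ⟨x, hx, rfl⟩ := D.isAffineQuotient.exists_lift_extChartAt q
  rw [← hx]
  constructor
  · rintro ⟨p, hp⟩
    obtain ⟨z, rfl⟩ := D.bdry_isAffineQuotient.surjective p
    obtain ⟨γ, rfl⟩ := (D.isAffineQuotient.eq_iff _ _).1 hp
    exact D.apply_zero γ z.1
  · intro h0
    obtain ⟨z, hz⟩ := D.exists_bdryCover x.2 h0
    exact ⟨D.bdryProj z, congrArg D.proj (Subtype.ext (Subtype.ext hz))⟩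

/-- The sign of the coordinate `1` is constant on orbits and never zero where the coordinate `0`
vanishes. The images of the two signs are therefore disjoint open sets that cover the boundary, and
both meet it. -/
lemma not_isPreconnected_boundary :
    ¬ IsPreconnected ((𝓡∂ (2 * (n + 1))).boundary D.Quot) := by
  rw [← D.range_bdryIncl]
  intro h
  let π := D.proj
  have hπ : IsOpenMap π := D.isAffineQuotient.isLocalHomeomorph.isOpenMap
  have hc : Continuous fun x : D.Cover => x.1.1 ⟨1, by omega⟩ :=
    (EuclideanSpace.proj (⟨1, by omega⟩ : Fin (2 * (n + 1)))).continuous.comp D.continuous_coe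
  obtain ⟨y, hy, hy0, hy1⟩ := D.exists_pos
  obtain ⟨y', hy', hy'0, hy'1⟩ := D.exists_neg
  have mem : ∀ (y) (hy : y ∈ O) (hy0 : y 0 = 0), D.proj ⟨⟨y, hy0.ge⟩, hy⟩ ∈ range D.bdryIncl := by
    intro y hy hy0
    obtain ⟨z, hz⟩ := D.exists_bdryCover hy hy0
    exact ⟨D.bdryProj z, congrArg D.proj (Subtype.ext (Subtype.ext hz))⟩
  obtain ⟨q, -, ⟨x, hx, hxq⟩, ⟨x', hx', hxq'⟩⟩ := h (π '' {x | 0 < x.1.1 ⟨1, by omega⟩})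
    (π '' {x | x.1.1 ⟨1, by omega⟩ < 0}) (hπ _ (isOpen_lt continuous_const hc))
    (hπ _ (isOpen_lt hc continuous_const)) (by
      rintro _ ⟨p, rfl⟩
      obtain ⟨z, rfl⟩ := D.bdry_isAffineQuotient.surjective p
      rw [bdryIncl_proj]
      rcases lt_or_gt_of_ne (D.one_ne_zero _ z.2 (hyperplaneIncl_zero n z.1)) with h | h
      · exact Or.inr ⟨_, h, rfl⟩
      · exact Or.inl ⟨_, h, rfl⟩)
    ⟨_, mem y hy hy0, ⟨_, hy1, rfl⟩⟩ ⟨_, mem y' hy' hy'0, ⟨_, hy'1, rfl⟩⟩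
  obtain ⟨γ, rfl⟩ := (D.isAffineQuotient.eq_iff _ _).1 (hxq.trans hxq'.symm)
  obtain ⟨c, hc, hcγ⟩ := D.scale_one γ γ.2
  have h1 : γ.1 x.1.1 ⟨1, by omega⟩ < 0 := hx'
  rw [hcγ] at h1
  exact lt_irrefl _ (h1.trans (mul_pos hc hx))

/-- In charts given by local sections at a lift and at its inclusion, the map is the linear
inclusion of the hyperplane. The topological part is an injective continuous map from a compact
space to a Hausdorff one. -/
lemma isSmoothEmbedding_bdryIncl :
    Manifold.IsSmoothEmbedding (𝓡 (2 * n + 1)) (𝓡∂ (2 * (n + 1))) ∞ D.bdryIncl := by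
  have := D.isAffineQuotient.isManifold
  have := D.bdry_isAffineQuotient.isManifold
  refine ⟨?_, (D.continuous_bdryIncl.isClosedEmbedding D.bdryIncl_injective).isEmbedding⟩
  apply Manifold.IsImmersionOfComplement.isImmersion (F := ℝ)
  intro p
  obtain ⟨x, rfl⟩ := D.bdry_isAffineQuotient.surjective p
  obtain ⟨e, he, hex, hex'⟩ := exists_isLocalSection D.bdry_isAffineQuotient.isOpenEmbedding
    D.bdry_isAffineQuotient.isLocalHomeomorph x
  obtain ⟨f, hf, hfx, hfx'⟩ := exists_isLocalSection D.isAffineQuotient.isOpenEmbedding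
    D.isAffineQuotient.isLocalHomeomorph (D.incl x)
  let inc : EuclideanSpace ℝ (Fin (2 * n + 1)) → EuclideanHalfSpace (2 * (n + 1)) :=
    fun z => ⟨hyperplaneIncl n z, (hyperplaneIncl_zero n z).ge⟩
  have hinc : Continuous inc := (hyperplaneIncl n).continuous.subtype_mk _
  -- The source chart is shrunk so that its points are carried into the target of `f`.
  have hopen : IsOpen (e.source ∩ e ⁻¹' (inc ⁻¹' f.target)) :=
    e.isOpen_inter_preimage (f.open_target.preimage hinc)
  let e' := e.restrOpen _ hopen
  have he' : IsLocalSection (fun x : D.BdryCover => x.1) D.bdryProj e' := by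
    intro h hh
    exact he h hh.1
  have hfa := (D.isAffineQuotient.mem_atlas f).2 hf
  have hea := (D.bdry_isAffineQuotient.mem_atlas e').2 he'
  refine Manifold.IsImmersionAtOfComplement.mk_of_continuousAt D.continuous_bdryIncl.continuousAt
    (hyperplaneSplit n) e' f ?_ hfx (IsManifold.subset_maximalAtlas hea)
    (IsManifold.subset_maximalAtlas hfa) ?_
  · refine ⟨hex, hex, ?_⟩
    rw [mem_preimage, hex']
    have := f.map_source hfx
    rwa [hfx'] at this
  · intro z hz
    obtain ⟨x', rfl, hx1, hx2⟩ := D.bdry_isAffineQuotient.exists_of_mem_target hea hz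
    have hx3 : D.proj (D.incl x') ∈ f.source ∧ f (D.proj (D.incl x')) = (D.incl x').1 := by
      have h1 : (D.incl x').1 ∈ f.target := by
        have := e'.map_target hx1
        have h2 : e (e'.symm x'.1) = x'.1 := e'.right_inv hx1
        have h3 := this.2.2
        rw [mem_preimage, h2] at h3
        exact h3
      rw [← D.isAffineQuotient.symm_apply hfa h1]
      exact ⟨f.map_target h1, f.right_inv h1⟩
    rw [Function.comp, Function.comp, hx2, bdryIncl_proj, Function.comp, hyperplaneSplit_apply,
      OpenPartialHomeomorph.extend_coe, Function.comp, hx3.2]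
    rfl

end LiouvilleData

/-! ### The symplectic form, the contact form and the exact filling -/

namespace LiouvilleData

variable {n : ℕ} {Γ : Subgroup (Equiv.Perm (EuclideanSpace ℝ (Fin (2 * (n + 1)))))}
    {O : Set (EuclideanSpace ℝ (Fin (2 * (n + 1))))}
    {F : EuclideanSpace ℝ (Fin (2 * (n + 1))) →
      EuclideanSpace ℝ (Fin (2 * (n + 1))) [⋀^Fin 1]→L[ℝ] ℝ}
    (D : LiouvilleData n Γ O F)

lemma aff_mem (D : LiouvilleData n Γ O F) (γ : Γ) {y} (hy : y ∈ O) : D.aff γ y ∈ O := by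
  rw [D.aff_apply]; exact D.mapsTo γ γ.2 y hy

lemma pullback_aff (D : LiouvilleData n Γ O F) (γ : Γ) {y} (hy : y ∈ O) :
    (F (D.aff γ y)).compContinuousLinearMap (D.aff γ).contLinear = F y :=
  D.invariant γ γ.2 (D.aff γ) (fun y => (D.aff_apply γ y).symm) y hy

lemma invariant_form :
    IsAffineQuotient.Invariant (𝓡∂ (2 * (n + 1))) (fun x : D.Cover => x.1) D.aff F :=
  fun γ x => D.pullback_aff γ x.2

/-- The exterior derivative commutes with pullback, and the invariance of `F` holds on a whole
neighbourhood because `O` is open. -/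
lemma extDeriv_pullback_aff (D : LiouvilleData n Γ O F) (γ : Γ) {y} (hy : y ∈ O) :
    (extDeriv F (D.aff γ y)).compContinuousLinearMap (D.aff γ).contLinear = extDeriv F y := by
  have hd : ∀ y, fderiv ℝ (D.aff γ) y = (D.aff γ).contLinear :=
    fun y => (D.aff γ).hasFDerivAt.fderiv
  have h := extDeriv_pullback (x := y) (f := D.aff γ) (r := minSmoothness ℝ 2)
    ((D.smooth _ (D.aff_mem γ hy)).differentiableAt (by simp)) (D.aff γ).contDiff.contDiffAt le_rfl
  simp only [hd] at h
  rw [← h]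
  refine Filter.EventuallyEq.extDeriv_eq ?_
  filter_upwards [D.isOpen.mem_nhds hy] with y hy
  exact D.pullback_aff γ hy

lemma invariant_extDeriv :
    IsAffineQuotient.Invariant (𝓡∂ (2 * (n + 1))) (fun x : D.Cover => x.1) D.aff (extDeriv F) :=
  fun γ x => D.extDeriv_pullback_aff γ x.2

lemma smooth_extDeriv (D : LiouvilleData n Γ O F) {y} (hy : y ∈ O) :
    ContDiffAt ℝ ∞ (extDeriv F) y := by
  let L := ContinuousAlternatingMap.alternatizeUncurryFinCLM (n := 1) ℝ
    (EuclideanSpace ℝ (Fin (2 * (n + 1)))) ℝ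
  have h : ContDiffAt ℝ ∞ (L ∘ fderiv ℝ F) y :=
    L.contDiff.contDiffAt.comp y ((D.smooth y hy).fderiv_right (m := ∞) (by simp))
  exact h

/-- The Liouville form of the quotient. -/
def lam : DiffForm (𝓡∂ (2 * (n + 1))) D.Quot 1 := IsAffineQuotient.form _ F

/-- The symplectic form of the quotient. -/
def omega : DiffForm (𝓡∂ (2 * (n + 1))) D.Quot 2 := IsAffineQuotient.form _ (extDeriv F)

lemma lam_d : D.lam.d = D.omega :=
  D.isAffineQuotient.form_d D.invariant_form
    fun x => (D.smooth _ x.2).differentiableAt (by simp)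

lemma extChartAt_mem (q : D.Quot) : extChartAt (𝓡∂ (2 * (n + 1))) q q ∈ O := by
  obtain ⟨x, hx, -⟩ := D.isAffineQuotient.exists_lift_extChartAt q
  rw [← hx]
  exact x.2

lemma isSymplectic_omega : D.omega.IsSymplectic where
  smooth := D.isAffineQuotient.form_isSmooth D.invariant_extDeriv fun x => D.smooth_extDeriv x.2
  closed := by
    refine (D.isAffineQuotient.form_d D.invariant_extDeriv
      fun x => (D.smooth_extDeriv x.2).differentiableAt (by simp)).trans ?_
    funext q
    exact extDeriv_extDeriv_apply (r := ∞) (D.smooth _ (D.extChartAt_mem q))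
      (by rw [minSmoothness_of_isRCLikeNormedField]; exact WithTop.coe_le_coe.2 le_top)
  nondegenerate q v hv := D.nondegenerate _ (D.extChartAt_mem q) v hv

/-- The restriction of `F` to the hyperplane. -/
def bdryForm (_ : LiouvilleData n Γ O F) (z : EuclideanSpace ℝ (Fin (2 * n + 1))) :
    EuclideanSpace ℝ (Fin (2 * n + 1)) [⋀^Fin 1]→L[ℝ] ℝ :=
  (F (hyperplaneIncl n z)).compContinuousLinearMap (hyperplaneIncl n)

/-- `γ` preserves the hyperplane, hence so does its linear part, a difference of two values of the
affine map; projecting back loses nothing. -/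
lemma bdryAff_contLinear (γ : Γ) (v) : hyperplaneIncl n ((D.bdryAff γ).contLinear v) =
    (D.aff γ).contLinear (hyperplaneIncl n v) := by
  change hyperplaneIncl n (hyperplaneProj n ((D.aff γ).contLinear (hyperplaneIncl n v))) = _
  apply hyperplaneIncl_proj
  have h1 := D.apply_zero γ v
  have h2 := D.apply_zero γ 0
  rw [← D.aff_apply] at h1 h2
  rw [map_zero] at h2
  have : (D.aff γ).contLinear (hyperplaneIncl n v) = D.aff γ (hyperplaneIncl n v) - D.aff γ 0 := by
    rw [← vsub_eq_sub, ← ContinuousAffineMap.contLinear_map_vsub]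
    simp
  rw [this, PiLp.sub_apply, h1, h2, sub_zero]

lemma invariant_bdryForm :
    IsAffineQuotient.Invariant (𝓡 (2 * n + 1)) (fun x : D.BdryCover => x.1) D.bdryAff
      D.bdryForm := by
  intro γ x
  have h := D.pullback_aff γ x.2
  have hz : hyperplaneIncl n (D.bdryAff γ x.1) = D.aff γ (hyperplaneIncl n x.1) := by
    exact hyperplaneIncl_proj (D.aff_apply γ (hyperplaneIncl n x.1) ▸ D.apply_zero γ x.1)
  change (D.bdryForm (D.bdryAff γ x.1)).compContinuousLinearMap _ = D.bdryForm x.1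
  rw [bdryForm, bdryForm, hz, ← h]
  ext v
  simp only [ContinuousAlternatingMap.compContinuousLinearMap_apply]
  congr 1
  funext i
  exact D.bdryAff_contLinear γ (v i)

lemma smooth_bdryForm (z : EuclideanSpace ℝ (Fin (2 * n + 1))) (hz : hyperplaneIncl n z ∈ O) :
    ContDiffAt ℝ ∞ D.bdryForm z := by
  let L : (EuclideanSpace ℝ (Fin (2 * (n + 1))) [⋀^Fin 1]→L[ℝ] ℝ) →L[ℝ]
      (EuclideanSpace ℝ (Fin (2 * n + 1)) [⋀^Fin 1]→L[ℝ] ℝ) :=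
    ContinuousAlternatingMap.compContinuousLinearMapCLM (hyperplaneIncl n)
  have h : ContDiffAt ℝ ∞ (L ∘ (F ∘ hyperplaneIncl n)) z :=
    L.contDiff.contDiffAt.comp z ((D.smooth _ hz).comp z (hyperplaneIncl n).contDiff.contDiffAt)
  exact h

lemma extDeriv_bdryForm (z : EuclideanSpace ℝ (Fin (2 * n + 1))) (hz : hyperplaneIncl n z ∈ O) :
    extDeriv D.bdryForm z =
      (extDeriv F (hyperplaneIncl n z)).compContinuousLinearMap (hyperplaneIncl n) := by
  have hd : ∀ z, fderiv ℝ (hyperplaneIncl n) z = hyperplaneIncl n := fun z =>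
    (hyperplaneIncl n).fderiv
  have h := extDeriv_pullback (x := z) (f := hyperplaneIncl n) (r := minSmoothness ℝ 2)
    ((D.smooth _ hz).differentiableAt (by simp)) (hyperplaneIncl n).contDiff.contDiffAt le_rfl
  simp only [hd] at h
  exact h

/-- The preferred charts at `p` and at its image may come from different lifts of the same point;
`γ` measures the discrepancy. -/
lemma exists_mfderiv_bdryIncl (p : D.BdryQuot) :
    ∃ (γ : Γ) (z : D.BdryCover), extChartAt (𝓡 (2 * n + 1)) p p = z.1 ∧
      extChartAt (𝓡∂ (2 * (n + 1))) (D.bdryIncl p) (D.bdryIncl p) =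
        D.aff γ (hyperplaneIncl n z.1) ∧
      mfderiv (𝓡 (2 * n + 1)) (𝓡∂ (2 * (n + 1))) D.bdryIncl p =
        (D.aff γ).contLinear.comp (hyperplaneIncl n) := by
  obtain ⟨z, hz, rfl⟩ := D.bdry_isAffineQuotient.exists_lift_extChartAt p
  obtain ⟨γ, hγ⟩ := D.isAffineQuotient.exists_transition (x := D.incl z)
    (chart_mem_atlas _ (D.proj (D.incl z))) (mem_chart_source _ _)
  have h1 : ∀ᶠ z' in 𝓝 z, extChartAt (𝓡∂ (2 * (n + 1))) (D.proj (D.incl z)) (D.proj (D.incl z')) =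
      D.aff γ (hyperplaneIncl n z'.1) := by
    filter_upwards [D.continuous_incl.continuousAt.eventually hγ] with z' hz'
    rw [extChartAt_coe, Function.comp, hz', D.aff_apply]
    rfl
  refine ⟨γ, z, hz.symm, h1.self_of_nhds, ?_⟩
  apply HasMFDerivAt.mfderiv
  refine ⟨D.continuous_bdryIncl.continuousAt, ?_⟩
  have hc : chartAt (EuclideanSpace ℝ (Fin (2 * n + 1))) (D.bdryProj z) ∈
    atlas (EuclideanSpace ℝ (Fin (2 * n + 1))) D.BdryQuot := chart_mem_atlas _ _
  have hz' : z.1 ∈ (chartAt (EuclideanSpace ℝ (Fin (2 * n + 1))) (D.bdryProj z)).target := by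
    have := (chartAt (EuclideanSpace ℝ (Fin (2 * n + 1))) (D.bdryProj z)).map_source
      (mem_chart_source _ (D.bdryProj z))
    rwa [show chartAt (EuclideanSpace ℝ (Fin (2 * n + 1))) (D.bdryProj z) (D.bdryProj z) = z.1
      from hz.symm] at this
  have hd : HasFDerivAt (fun x => D.aff γ (hyperplaneIncl n x))
      ((D.aff γ).contLinear.comp (hyperplaneIncl n)) z.1 :=
    (D.aff γ).hasFDerivAt.comp z.1 (hyperplaneIncl n).hasFDerivAt
  rw [← hz]
  have h2 : ∀ᶠ z' in 𝓝 z, writtenInExtChartAt (𝓡 (2 * n + 1)) (𝓡∂ (2 * (n + 1))) (D.bdryProj z)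
      D.bdryIncl z'.1 = D.aff γ (hyperplaneIncl n z'.1) := by
    have h3 : ∀ᶠ z' : D.BdryCover in 𝓝 z,
        z'.1 ∈ (chartAt (EuclideanSpace ℝ (Fin (2 * n + 1))) (D.bdryProj z)).target :=
      D.isOpenEmbedding_bdryCover.continuous.continuousAt.eventually_mem
        ((chartAt (EuclideanSpace ℝ (Fin (2 * n + 1))) (D.bdryProj z)).open_target.mem_nhds hz')
    filter_upwards [h1, h3] with z' h4 h5
    have h6 : (extChartAt (𝓡 (2 * n + 1)) (D.bdryProj z)).symm z'.1 = D.bdryProj z' :=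
      D.bdry_isAffineQuotient.symm_apply hc h5
    rw [writtenInExtChartAt, Function.comp, Function.comp, h6]
    exact h4
  have h7 := D.bdry_isAffineQuotient.eventually_of_nhds (x := z)
    (p := fun y => writtenInExtChartAt (𝓡 (2 * n + 1)) (𝓡∂ (2 * (n + 1))) (D.bdryProj z)
      D.bdryIncl y = D.aff γ (hyperplaneIncl n y)) h2
  exact hd.hasFDerivWithinAt.congr_of_eventuallyEq h7 h2.self_of_nhds

/-- The discrepancy `γ` between the charts disappears by the invariance of `F`. -/
lemma pullback_lam : D.lam.pullback (J := 𝓡 (2 * n + 1)) D.bdryIncl =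
    IsAffineQuotient.form (𝓡 (2 * n + 1)) D.bdryForm := by
  funext p
  obtain ⟨γ, z, h1, h2, h3⟩ := D.exists_mfderiv_bdryIncl p
  rw [DiffForm.pullback, h3]
  have : (F (extChartAt (𝓡∂ (2 * (n + 1))) (D.bdryIncl p) (D.bdryIncl p))).compContinuousLinearMap
      ((D.aff γ).contLinear.comp (hyperplaneIncl n)) =
      D.bdryForm (extChartAt (𝓡 (2 * n + 1)) p p) := by
    rw [h1, h2, bdryForm, ← D.pullback_aff γ z.2]
    rfl
  exact this

lemma pullback_lam_d : (D.lam.pullback (J := 𝓡 (2 * n + 1)) D.bdryIncl).d =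
    IsAffineQuotient.form (𝓡 (2 * n + 1)) (extDeriv D.bdryForm) := by
  rw [pullback_lam]
  exact D.bdry_isAffineQuotient.form_d D.invariant_bdryForm
    fun z => (D.smooth_bdryForm _ z.2).differentiableAt (by simp)

/-- This is `contact_of_liouville` at the point `y` representing the image of `p`, with `A` the
derivative of the inclusion and `f` the coordinate `0`. -/
lemma contactVolume_pullback (p : D.BdryQuot) :
    (D.lam.pullback (J := 𝓡 (2 * n + 1)) D.bdryIncl).contactVolumeAt n p ≠ 0 ∧
    ∀ (ν : TangentSpace (𝓡∂ (2 * (n + 1))) (D.bdryIncl p)), IsOutward ν →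
    ∀ v : Fin (2 * n + 1) → TangentSpace (𝓡 (2 * n + 1)) p,
      0 < D.omega.wedgePowAt (n + 1) (D.bdryIncl p)
        (Matrix.vecCons ν
          (fun i => mfderiv (𝓡 (2 * n + 1)) (𝓡∂ (2 * (n + 1))) D.bdryIncl p (v i))) →
      0 < (D.lam.pullback (J := 𝓡 (2 * n + 1)) D.bdryIncl).contactVolumeAt n p
        (v ∘ Fin.cast (Nat.add_comm 1 (2 * n))) := by
  obtain ⟨γ, z, h1, h2, h3⟩ := D.exists_mfderiv_bdryIncl p
  set y := D.aff γ (hyperplaneIncl n z.1) with hy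
  have hyO : y ∈ O := D.aff_mem γ z.2
  have hy0 : y 0 = 0 := by rw [hy, D.aff_apply]; exact D.apply_zero γ z.1
  obtain ⟨Z, hZ, hZF⟩ := D.liouville y hyO hy0
  set A : EuclideanSpace ℝ (Fin (2 * n + 1)) →L[ℝ] EuclideanSpace ℝ (Fin (2 * (n + 1))) :=
    (D.aff γ).contLinear.comp (hyperplaneIncl n) with hA
  have hA' : ∀ v, A v = hyperplaneIncl n ((D.bdryAff γ).contLinear v) := fun v =>
    (D.bdryAff_contLinear γ v).symm
  have hAinj : Function.Injective A := by
    have : Function.Injective (D.aff γ) := by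
      intro x x' h
      rw [D.aff_apply, D.aff_apply] at h
      exact γ.1.injective h
    exact ((AffineMap.linear_injective_iff (D.aff γ).toAffineMap).2 this).comp
      (hyperplaneIncl_injective n)
  have hlam : (D.lam.pullback (J := 𝓡 (2 * n + 1)) D.bdryIncl) p =
      (F y).compContinuousLinearMap A := by
    have : (F (extChartAt (𝓡∂ (2 * (n + 1))) (D.bdryIncl p)
      (D.bdryIncl p))).compContinuousLinearMap A = (F y).compContinuousLinearMap A := by rw [h2]
    rw [DiffForm.pullback, h3]
    exact this
  have hd : (D.lam.pullback (J := 𝓡 (2 * n + 1)) D.bdryIncl).d p =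
      (extDeriv F y).compContinuousLinearMap A := by
    rw [pullback_lam_d]
    change extDeriv D.bdryForm (extChartAt (𝓡 (2 * n + 1)) p p) = _
    rw [h1, D.extDeriv_bdryForm _ z.2, ← D.extDeriv_pullback_aff γ z.2]
    rfl
  have hom : D.omega (D.bdryIncl p) = extDeriv F y := by
    change extDeriv F (extChartAt (𝓡∂ (2 * (n + 1))) (D.bdryIncl p) (D.bdryIncl p)) = _
    rw [h2]
  have key := contact_of_liouville (n := n) (E := EuclideanSpace ℝ (Fin (2 * (n + 1))))
    (F := EuclideanSpace ℝ (Fin (2 * n + 1))) (by simp) (by simp)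
    (extDeriv F y).toAlternatingMap (D.nondegenerate y hyO) Z A.toLinearMap hAinj
    (EuclideanSpace.proj (0 : Fin (2 * (n + 1))) :
      EuclideanSpace ℝ (Fin (2 * (n + 1))) →L[ℝ] ℝ).toLinearMap
    (fun x => by
      change A x 0 = 0
      rw [hA', hyperplaneIncl_zero]) hZ
    ((F y).compContinuousLinearMap A).toAlternatingMap (fun x => (hZF (A x)).symm)
  have hvol : (D.lam.pullback (J := 𝓡 (2 * n + 1)) D.bdryIncl).contactVolumeAt n p =
      altWedge ((F y).compContinuousLinearMap A).toAlternatingMap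
        (altWedgePow ((extDeriv F y).toAlternatingMap.compLinearMap A.toLinearMap) n) := by
    rw [DiffForm.contactVolumeAt, DiffForm.wedgePowAt, hlam, hd]
    rfl
  refine ⟨fun h => key.1 (hvol.symm.trans h), fun ν hν v hv => ?_⟩
  rw [hvol]
  refine key.2 ν ?_ v ?_
  · rw [IsOutward, D.isAffineQuotient.mfderiv_extChartAt_self] at hν
    exact hν
  · rw [DiffForm.wedgePowAt, hom, h3] at hv
    exact hv

lemma isExactFilling : IsExactFilling D.omega D.bdryIncl D.lam where
  symplectic := D.isSymplectic_omega
  embedding := D.isSmoothEmbedding_bdryIncl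
  range_eq := D.range_bdryIncl
  smooth := D.isAffineQuotient.form_isSmooth D.invariant_form fun x => D.smooth _ x.2
  primitive := D.lam_d
  contact :=
    { smooth := by
        rw [pullback_lam]
        exact D.bdry_isAffineQuotient.form_isSmooth D.invariant_bdryForm
          fun z => D.smooth_bdryForm _ z.2
      nonvanishing := fun p => (D.contactVolume_pullback p).1 }
  positive := fun p => (D.contactVolume_pullback p).2

theorem exists_liouvilleDomain (D : LiouvilleData n Γ O F) :
    ∃ (W : Type) (_ : TopologicalSpace W)
      (_ : ChartedSpace (EuclideanHalfSpace (2 * (n + 1))) W)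
      (Ω : DiffForm (𝓡∂ (2 * (n + 1))) W 2),
      IsLiouvilleDomain W Ω ∧ ConnectedSpace W ∧
        ¬ IsPreconnected ((𝓡∂ (2 * (n + 1))).boundary W) :=
  ⟨D.Quot, inferInstance, inferInstance, D.omega,
    ⟨inferInstance, inferInstance, D.isAffineQuotient.isManifold, D.BdryQuot, inferInstance,
      inferInstance, inferInstance, inferInstance, D.bdry_isAffineQuotient.isManifold,
      D.bdryIncl, D.lam, D.isExactFilling⟩,
    inferInstance, D.not_isPreconnected_boundary⟩

end LiouvilleData

/-! ### The one-form `∑ P dQ` -/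

section PQForm

variable {E : Type*} [NormedAddCommGroup E] [NormedSpace ℝ E] {N : ℕ}

/-- The `1`-form `∑ j, P j dQ j`. -/
def pqForm (P Q : Fin N → E → ℝ) (y : E) : E [⋀^Fin 1]→L[ℝ] ℝ :=
  ContinuousAlternatingMap.ofSubsingleton ℝ E ℝ (0 : Fin 1) (∑ j, P j y • fderiv ℝ (Q j) y)

lemma pqForm_apply (P Q : Fin N → E → ℝ) (y : E) (v : Fin 1 → E) :
    pqForm P Q y v = ∑ j, P j y * fderiv ℝ (Q j) y (v 0) := by
  simp [pqForm]

lemma contDiffAt_pqForm {P Q : Fin N → E → ℝ} {y : E} (hP : ∀ j, ContDiffAt ℝ ∞ (P j) y)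
    (hQ : ∀ j, ContDiffAt ℝ ∞ (Q j) y) : ContDiffAt ℝ ∞ (pqForm P Q) y := by
  let L : (E →L[ℝ] ℝ) →L[ℝ] (E [⋀^Fin 1]→L[ℝ] ℝ) :=
    (ContinuousAlternatingMap.ofSubsingletonLIE (𝕜 := ℝ) (E := E) (F := ℝ) (0 : Fin 1)).toContinuousLinearEquiv
  have h : ContDiffAt ℝ ∞ (L ∘ fun y => ∑ j, P j y • fderiv ℝ (Q j) y) y :=
    L.contDiff.contDiffAt.comp y (ContDiffAt.sum fun j _ => (hP j).smul
      ((hQ j).fderiv_right (m := ∞) (by simp)))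
  exact h

/-- In `d (∑ P dQ) = ∑ dP ∧ dQ` the second derivatives of `Q j` cancel by symmetry. -/
lemma extDeriv_pqForm {P Q : Fin N → E → ℝ} {y : E} (hP : ∀ j, ContDiffAt ℝ ∞ (P j) y)
    (hQ : ∀ j, ContDiffAt ℝ ∞ (Q j) y) (v w : E) :
    extDeriv (pqForm P Q) y ![v, w] =
      ∑ j, (fderiv ℝ (P j) y v * fderiv ℝ (Q j) y w - fderiv ℝ (P j) y w * fderiv ℝ (Q j) y v) := by
  have key : ∀ v w : E, fderiv ℝ (fun x => pqForm P Q x (fun _ => w)) y v =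
      ∑ j, (P j y * fderiv ℝ (fderiv ℝ (Q j)) y v w + fderiv ℝ (Q j) y w * fderiv ℝ (P j) y v) := by
    intro v w
    have h : HasFDerivAt (fun x => ∑ j, P j x * fderiv ℝ (Q j) x w)
        (∑ j, (P j y • ((fderiv ℝ (fderiv ℝ (Q j)) y).flip w) +
          fderiv ℝ (Q j) y w • fderiv ℝ (P j) y)) y := by
      refine HasFDerivAt.fun_sum fun j _ => ?_
      have h1 : HasFDerivAt (P j) (fderiv ℝ (P j) y) y :=
        ((hP j).differentiableAt (by simp)).hasFDerivAt
      have h2 : HasFDerivAt (fderiv ℝ (Q j)) (fderiv ℝ (fderiv ℝ (Q j)) y) y :=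
        (((hQ j).fderiv_right (m := ∞) (by simp)).differentiableAt (by simp)).hasFDerivAt
      exact h1.mul ((ContinuousLinearMap.apply ℝ ℝ w).hasFDerivAt.comp y h2)
    simp only [pqForm_apply]
    rw [h.fderiv]
    simp
  rw [extDeriv_apply ((contDiffAt_pqForm hP hQ).differentiableAt (by simp)), Fin.sum_univ_two]
  have e0 : (0 : Fin 2).removeNth ![v, w] = fun _ => w := by
    ext i; rw [Subsingleton.elim i 0]; rfl
  have e1 : (1 : Fin 2).removeNth ![v, w] = fun _ => v := by
    ext i; rw [Subsingleton.elim i 0]; rfl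
  rw [e0, e1, key, key]
  simp only [Fin.val_zero, pow_zero, one_smul, Fin.val_one, pow_one, Matrix.cons_val_zero,
    Matrix.cons_val_one, Matrix.cons_val_fin_one, neg_smul]
  rw [← sub_eq_add_neg, ← Finset.sum_sub_distrib]
  refine Finset.sum_congr rfl fun j _ => ?_
  have hsymm : fderiv ℝ (fderiv ℝ (Q j)) y v w = fderiv ℝ (fderiv ℝ (Q j)) y w v :=
    ((hQ j).isSymmSndFDerivAt (by
      rw [minSmoothness_of_isRCLikeNormedField]; exact WithTop.coe_le_coe.2 le_top)).eq v w
  rw [hsymm]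
  ring

/-- The factor `u j` on `dQ j` cancels its inverse on `P j`, and differentiation kills the
translation `b`. -/
lemma pqForm_pullback {P Q : Fin N → E → ℝ} {O : Set E} (hO : IsOpen O)
    (hQ : ∀ j, ∀ y ∈ O, DifferentiableAt ℝ (Q j) y) (a : E →ᴬ[ℝ] E) (ha : ∀ y ∈ O, a y ∈ O)
    (u b : Fin N → ℝ) (hu : ∀ j, u j ≠ 0) (haP : ∀ j, ∀ y ∈ O, P j (a y) = (u j)⁻¹ * P j y)
    (haQ : ∀ j, ∀ y ∈ O, Q j (a y) = u j * Q j y + b j) {y : E} (hy : y ∈ O) :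
    (pqForm P Q (a y)).compContinuousLinearMap a.contLinear = pqForm P Q y := by
  ext v
  rw [ContinuousAlternatingMap.compContinuousLinearMap_apply, pqForm_apply, pqForm_apply]
  refine Finset.sum_congr rfl fun j _ => ?_
  have h1 : HasFDerivAt (fun y => Q j (a y)) ((fderiv ℝ (Q j) (a y)).comp a.contLinear) y :=
    (hQ j _ (ha y hy)).hasFDerivAt.comp y a.hasFDerivAt
  have h2 : HasFDerivAt (fun y => Q j (a y)) (u j • fderiv ℝ (Q j) y) y := by
    refine (((hQ j y hy).hasFDerivAt.const_mul (u j)).add_const (b j)).congr_of_eventuallyEq ?_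
    filter_upwards [hO.mem_nhds hy] with y hy
    exact haQ j y hy
  have h3 := congrArg (fun L => L (v 0)) (h1.unique h2)
  simp only [ContinuousLinearMap.comp_apply, smul_apply, smul_eq_mul] at h3
  simp only [Function.comp_apply]
  rw [h3, haP j y hy]
  have := hu j
  field_simp

/-- By the dimension count the differentials of the `P j` and `Q j` form a linear coordinate system,
in which the form is the standard `∑ dP ∧ dQ`. The vector `w` is the basis vector conjugate to a
nonzero component of `v`. -/
lemma extDeriv_pqForm_nondegenerate [FiniteDimensional ℝ E] (hE : Module.finrank ℝ E = 2 * N)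
    {P Q : Fin N → E → ℝ} {y : E} (hP : ∀ j, ContDiffAt ℝ ∞ (P j) y)
    (hQ : ∀ j, ContDiffAt ℝ ∞ (Q j) y)
    (hinj : ∀ v, (∀ j, fderiv ℝ (P j) y v = 0) → (∀ j, fderiv ℝ (Q j) y v = 0) → v = 0)
    (v : E) (hv : v ≠ 0) : ∃ w, extDeriv (pqForm P Q) y ![v, w] ≠ 0 := by
  let Φ : E →ₗ[ℝ] (Fin N → ℝ) × (Fin N → ℝ) :=
    (LinearMap.pi fun j => (fderiv ℝ (P j) y).toLinearMap).prod
      (LinearMap.pi fun j => (fderiv ℝ (Q j) y).toLinearMap)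
  have hΦ : Function.Injective Φ := by
    rw [injective_iff_map_eq_zero]
    intro v hv
    have h1 := congrArg Prod.fst hv
    have h2 := congrArg Prod.snd hv
    exact hinj v (fun j => congrFun h1 j) (fun j => congrFun h2 j)
  have hΦs : Function.Surjective Φ := (LinearMap.injective_iff_surjective_of_finrank_eq_finrank
    (by rw [hE, Module.finrank_prod, Module.finrank_fin_fun]; ring)).1 hΦ
  have hex : ∃ j, fderiv ℝ (P j) y v ≠ 0 ∨ fderiv ℝ (Q j) y v ≠ 0 := by
    by_contra! h
    exact hv (hinj v (fun j => (h j).1) (fun j => (h j).2))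
  obtain ⟨j, hj | hj⟩ := hex
  · obtain ⟨w, hw⟩ := hΦs (0, Pi.single j 1)
    refine ⟨w, ?_⟩
    have h1 : ∀ k, fderiv ℝ (P k) y w = 0 := fun k => congrFun (congrArg Prod.fst hw) k
    have h2 : ∀ k, fderiv ℝ (Q k) y w = (Pi.single j 1 : Fin N → ℝ) k :=
      fun k => congrFun (congrArg Prod.snd hw) k
    rw [extDeriv_pqForm hP hQ]
    simpa [h1, h2, Pi.single_apply] using hj
  · obtain ⟨w, hw⟩ := hΦs (Pi.single j 1, 0)
    refine ⟨w, ?_⟩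
    have h1 : ∀ k, fderiv ℝ (P k) y w = (Pi.single j 1 : Fin N → ℝ) k :=
      fun k => congrFun (congrArg Prod.fst hw) k
    have h2 : ∀ k, fderiv ℝ (Q k) y w = 0 := fun k => congrFun (congrArg Prod.snd hw) k
    rw [extDeriv_pqForm hP hQ]
    simpa [h1, h2, Pi.single_apply] using hj

/-- `Z` is the radial field in the momenta, so `dP j` on `Z` returns `P j` and the terms with `dQ j`
on `Z` drop out. -/
lemma extDeriv_pqForm_liouville {P Q : Fin N → E → ℝ} {y : E} (hP : ∀ j, ContDiffAt ℝ ∞ (P j) y)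
    (hQ : ∀ j, ContDiffAt ℝ ∞ (Q j) y) {Z : E} (hZP : ∀ j, fderiv ℝ (P j) y Z = P j y)
    (hZQ : ∀ j, fderiv ℝ (Q j) y Z = 0) (w : E) :
    extDeriv (pqForm P Q) y ![Z, w] = pqForm P Q y (fun _ => w) := by
  rw [extDeriv_pqForm hP hQ, pqForm_apply]
  simp [hZP, hZQ]

end PQForm

/-! ### A totally real order with explicit units -/

/-- The numbers `θ j` near `3 j` with `∏ i, (θ j - 3 i) = 1`. -/
lemma exists_prod_sub_eq_one {n : ℕ} (j : Fin (n + 1)) :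
    ∃ θ : ℝ, |θ - 3 * (j : ℕ)| ≤ 1 ∧ ∏ i : Fin (n + 1), (θ - 3 * ((i : ℕ) : ℝ)) = 1 := by
  set g : ℝ → ℝ := fun x => ∏ i : Fin (n + 1), (x - 3 * ((i : ℕ) : ℝ)) with hg
  set k : ℝ → ℝ := fun x => ∏ i ∈ Finset.univ.erase j, (x - 3 * ((i : ℕ) : ℝ)) with hk
  have hgk : ∀ x, g x = (x - 3 * (j : ℕ)) * k x := fun x =>
    (Finset.mul_prod_erase Finset.univ (fun i : Fin (n + 1) => x - 3 * ((i : ℕ) : ℝ))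
      (Finset.mem_univ j)).symm
  -- At the ends `3 j ± 1` the factor of index `j` is `±1`. The product `k` of the other factors has
  -- the same sign at both ends and absolute value at least `1`, so `g` takes the value `1` in
  -- between.
  set l : ℝ := 3 * (j : ℕ) - 1 with hl
  set r : ℝ := 3 * (j : ℕ) + 1 with hr
  have hfar : ∀ i ∈ Finset.univ.erase j, ((3 : ℝ) ≤ 3 * (j : ℕ) - 3 * (i : ℕ)) ∨
      (3 * ((j : ℕ) : ℝ) - 3 * (i : ℕ) ≤ -3) := by
    intro i hi
    have hne : (i : ℕ) ≠ j := fun h => (Finset.ne_of_mem_erase hi) (Fin.ext h)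
    rcases lt_or_gt_of_ne hne with h | h
    · left
      have : ((i : ℕ) : ℝ) + 1 ≤ (j : ℕ) := by exact_mod_cast h
      linarith
    · right
      have : ((j : ℕ) : ℝ) + 1 ≤ (i : ℕ) := by exact_mod_cast h
      linarith
  have habs : ∀ x : ℝ, |x - 3 * (j : ℕ)| ≤ 1 → 1 ≤ |k x| := by
    intro x hx
    rw [hk, Finset.abs_prod]
    refine Finset.one_le_prod fun i hi => ?_
    rw [abs_le] at hx
    rcases hfar i hi with h | h
    · exact le_trans (by linarith) (le_abs_self _)
    · exact le_trans (by linarith) (neg_le_abs _)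
  have hkl : 1 ≤ |k l| := habs l (by rw [hl]; simp)
  have hkr : 1 ≤ |k r| := habs r (by rw [hr]; simp)
  have hpos : 0 < k l * k r := by
    rw [hk, ← Finset.prod_mul_distrib]
    refine Finset.prod_pos fun i hi => ?_
    rcases hfar i hi with h | h <;> rw [hl, hr] <;> nlinarith
  have hgl : g l = - k l := by rw [hgk, hl]; ring
  have hgr : g r = k r := by rw [hgk, hr]; ring
  have hcont : Continuous g := by rw [hg]; fun_prop
  have hmem : (1 : ℝ) ∈ uIcc (g l) (g r) := by
    rw [hgl, hgr, mem_uIcc]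
    rcases pos_and_pos_or_neg_and_neg_of_mul_pos hpos with ⟨h1, h2⟩ | ⟨h1, h2⟩
    · rw [abs_of_pos h1] at hkl
      rw [abs_of_pos h2] at hkr
      left; constructor <;> linarith
    · rw [abs_of_neg h1] at hkl
      rw [abs_of_neg h2] at hkr
      right; constructor <;> linarith
  obtain ⟨θ, hθ, h1⟩ := intermediate_value_uIcc hcont.continuousOn hmem
  rw [uIcc_of_le (by rw [hl, hr]; linarith)] at hθ
  refine ⟨θ, ?_, h1⟩
  rw [abs_le]
  constructor <;> [have := hθ.1; have := hθ.2] <;> rw [hl] at * <;> rw [hr] at * <;> linarith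

/-- The group of totally positive units of norm one of a ring of real vectors. -/
def positiveUnits {ι : Type*} [Fintype ι] (R : Subring (ι → ℝ)) : Subgroup (ι → ℝ)ˣ where
  carrier := {u | (u : ι → ℝ) ∈ R ∧ ((u⁻¹ : (ι → ℝ)ˣ) : ι → ℝ) ∈ R ∧
    (∀ j, 0 < (u : ι → ℝ) j) ∧ ∏ j, (u : ι → ℝ) j = 1}
  one_mem' := by simp [R.one_mem]
  mul_mem' := by
    rintro u v ⟨hu1, hu2, hu3, hu4⟩ ⟨hv1, hv2, hv3, hv4⟩
    refine ⟨R.mul_mem hu1 hv1, ?_, fun j => mul_pos (hu3 j) (hv3 j), ?_⟩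
    · rw [mul_inv]
      exact R.mul_mem hu2 hv2
    · simp only [Units.val_mul, Pi.mul_apply, Finset.prod_mul_distrib, hu4, hv4, mul_one]
  inv_mem' := by
    rintro u ⟨hu1, hu2, hu3, hu4⟩
    have h : ∀ j, ((u⁻¹ : (ι → ℝ)ˣ) : ι → ℝ) j = ((u : ι → ℝ) j)⁻¹ := fun j => by
      refine eq_inv_of_mul_eq_one_left ?_
      rw [← Pi.mul_apply, Units.inv_mul]; rfl
    refine ⟨hu2, by rwa [inv_inv], fun j => ?_, ?_⟩
    · rw [h]; exact inv_pos.2 (hu3 j)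
    · simp only [h, Finset.prod_inv_distrib, hu4, inv_one]

lemma units_pi_inv_apply {ι : Type*} (u : (ι → ℝ)ˣ) (j : ι) :
    ((u⁻¹ : (ι → ℝ)ˣ) : ι → ℝ) j = ((u : ι → ℝ) j)⁻¹ := by
  refine eq_inv_of_mul_eq_one_left ?_
  rw [← Pi.mul_apply, Units.inv_mul]; rfl

lemma units_pi_zpow_apply {ι : Type*} (u : (ι → ℝ)ˣ) (k : ℤ) (j : ι) :
    ((u ^ k : (ι → ℝ)ˣ) : ι → ℝ) j = ((u : ι → ℝ) j) ^ k := by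
  simp

open Polynomial in
/-- A lattice in `ℝ ^ (n + 1)` which is a ring whose totally positive units form a lattice
of rank `n`. -/
theorem exists_subring_lattice (n : ℕ) : ∃ R : Subring (Fin (n + 1) → ℝ),
    (∀ C : ℝ, {x | x ∈ R ∧ ∀ j, |x j| ≤ C}.Finite) ∧
    (∃ C : ℝ, ∀ q : Fin (n + 1) → ℝ, ∃ b ∈ R, ∀ j, |q j + b j| ≤ C) ∧
    (∃ C : ℝ, ∀ t : Fin n → ℝ, ∃ u ∈ positiveUnits R, ∀ i, |t i + Real.log (u.1 i.succ)| ≤ C) := by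
  choose θ hθ1 hθ2 using exists_prod_sub_eq_one (n := n)
  -- The centres are at distance at least `3` and `θ j` is within `1` of its own. What matters later
  -- is that `2 > 1`: the logarithms of these factors are positive.
  have hsep : ∀ i j : Fin (n + 1), i ≠ j → 2 ≤ |θ j - 3 * ((i : ℕ) : ℝ)| := by
    intro i j hij
    have h := hθ1 j
    rw [abs_le] at h
    rcases lt_or_gt_of_ne (fun h => hij (Fin.ext h) : (i : ℕ) ≠ j) with h' | h'
    · have : ((i : ℕ) : ℝ) + 1 ≤ (j : ℕ) := by exact_mod_cast h'
      exact le_trans (by linarith) (le_abs_self _)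
    · have : ((j : ℕ) : ℝ) + 1 ≤ (i : ℕ) := by exact_mod_cast h'
      exact le_trans (by linarith) (neg_le_abs _)
  have hinj : Function.Injective θ := by
    intro i j hij
    by_contra hne
    have h1 := hsep i j hne
    rw [← hij] at h1
    linarith [hθ1 i]
  let A : ℤ[X] →+* (Fin (n + 1) → ℝ) := (aeval θ : ℤ[X] →ₐ[ℤ] (Fin (n + 1) → ℝ)).toRingHom
  have hA : ∀ p j, A p j = aeval (θ j) p := fun p j => by
    change (aeval θ p) j = _
    exact (Polynomial.aeval_pi_apply₂ θ p j)
  -- The `θ j` are the `n + 1` distinct roots of the monic polynomial `f`, so `A.range` is a copy of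
  -- `ℤ[X] / (f)`.
  let f : ℤ[X] := ∏ i : Fin (n + 1), (X - C (3 * ((i : ℕ) : ℤ))) - 1
  have hprod_monic : (∏ i : Fin (n + 1), (X - C (3 * ((i : ℕ) : ℤ)))).Monic :=
    monic_prod_of_monic _ _ fun i _ => monic_X_sub_C _
  have hprod_deg : (∏ i : Fin (n + 1), (X - C (3 * ((i : ℕ) : ℤ)))).natDegree = n + 1 := by
    rw [natDegree_prod_of_monic _ _ fun i _ => monic_X_sub_C _]
    simp only [natDegree_X_sub_C, Finset.sum_const, Finset.card_univ, Fintype.card_fin,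
      smul_eq_mul, mul_one]
  have hlin : ∀ i j : Fin (n + 1), aeval (θ j) (X - C (3 * ((i : ℕ) : ℤ))) =
      θ j - 3 * ((i : ℕ) : ℝ) := fun i j => by
    rw [map_sub, aeval_X, aeval_C, algebraMap_int_eq, eq_intCast]
    push_cast
    rfl
  have hdeg1 : (1 : ℤ[X]).degree < (∏ i : Fin (n + 1), (X - C (3 * ((i : ℕ) : ℤ)))).degree := by
    rw [degree_one, degree_eq_natDegree hprod_monic.ne_zero, hprod_deg]
    exact_mod_cast Nat.succ_pos n
  have hf_monic : f.Monic := hprod_monic.sub_of_left hdeg1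
  have hf_deg : f.natDegree = n + 1 := by
    rw [natDegree_sub_eq_left_of_natDegree_lt (by rw [hprod_deg]; simp), hprod_deg]
  have hfroot : ∀ j, aeval (θ j) f = 0 := by
    intro j
    rw [map_sub, map_prod, map_one]
    simp only [hlin, hθ2, sub_self]
  -- the norm of the units
  have hnorm : ∀ i : Fin (n + 1), ∏ j, (θ j - 3 * ((i : ℕ) : ℝ)) ^ 2 = 1 := by
    intro i
    let g : ℝ[X] := f.map (Int.castRingHom ℝ)
    have hg_monic : g.Monic := hf_monic.map _
    have hg_deg : g.natDegree = n + 1 := by rw [hf_monic.natDegree_map, hf_deg]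
    let h : ℝ[X] := ∏ j, (X - C (θ j))
    have hh_monic : h.Monic := monic_prod_of_monic _ _ fun i _ => monic_X_sub_C _
    have hh_deg : h.natDegree = n + 1 := by
      rw [natDegree_prod_of_monic _ _ fun i _ => monic_X_sub_C _]
      simp
    -- `f` and `∏ (X - θ j)` are monic of the same degree and agree at the `n + 1` distinct `θ j`,
    -- so they are equal. Since `f (3 i) = -1`, the norm of `θ - 3 i` is `±1`, and its square has
    -- norm one.
    have hgh : g - h = 0 := by
      refine eq_zero_of_degree_lt_of_eval_index_eq_zero Finset.univ (v := θ) hinj.injOn ?_ ?_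
      · have h1 : g.degree = h.degree := by
          rw [degree_eq_natDegree hg_monic.ne_zero, degree_eq_natDegree hh_monic.ne_zero, hg_deg,
            hh_deg]
        have := degree_sub_lt_left h1 hg_monic.ne_zero (by rw [hg_monic, hh_monic])
        rw [degree_eq_natDegree hg_monic.ne_zero, hg_deg] at this
        simpa using this
      · intro j _
        have h2 : g.eval (θ j) = 0 := by
          rw [eval_map, ← hfroot j]; rfl
        rw [eval_sub, h2, eval_prod, Finset.prod_eq_zero (Finset.mem_univ j) (by simp), sub_zero]
    have h3 : h.eval (3 * ((i : ℕ) : ℝ)) = -1 := by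
      rw [← sub_eq_zero.1 hgh]
      simp only [g, f, eval_map, eval₂_sub, eval₂_finsetProd, eval₂_X, eval₂_C, eval₂_one]
      rw [Finset.prod_eq_zero (Finset.mem_univ i) (by simp)]
      simp
    have h4 : ∏ j, (θ j - 3 * ((i : ℕ) : ℝ)) ^ 2 = (h.eval (3 * ((i : ℕ) : ℝ))) ^ 2 := by
      rw [eval_prod, ← Finset.prod_pow]
      refine Finset.prod_congr rfl fun j _ => ?_
      simp
      ring
    rw [h4, h3]; norm_num
  -- the lattice
  have hV : (Matrix.vandermonde θ).transpose.det ≠ 0 := by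
    rw [Matrix.det_transpose]
    exact Matrix.det_vandermonde_ne_zero_iff.2 hinj
  let b : Module.Basis (Fin (n + 1)) ℝ (Fin (n + 1) → ℝ) :=
    basisOfLinearIndependentOfCardEqFinrank
      (Matrix.linearIndependent_rows_of_det_ne_zero hV) (by simp)
  have hb : ∀ k, b k = fun j => θ j ^ (k : ℕ) := fun k => by
    rw [show ⇑b = _ from coe_basisOfLinearIndependentOfCardEqFinrank _ _]
    rfl
  -- Division by the monic `f` shows that the powers of `θ` up to `n` generate the ring over `ℤ`; by
  -- the Vandermonde determinant they are a real basis.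
  have hRb : ∀ x, x ∈ A.range ↔ x ∈ Submodule.span ℤ (Set.range b) := by
    intro x
    constructor
    · rintro ⟨p, rfl⟩
      have h1 : A p = ∑ k : Fin (n + 1), (p %ₘ f).coeff k • b k := by
        funext j
        rw [hA, ← aeval_modByMonic_eq_self_of_root (hfroot j),
          aeval_eq_sum_range' (n := n + 1) (by
            rw [← hf_deg]
            exact natDegree_modByMonic_lt _ hf_monic (by
              intro h1; rw [h1] at hf_deg; simp at hf_deg)), Finset.sum_range]
        simp [hb]
      rw [h1]
      exact Submodule.sum_mem _ fun k _ => Submodule.smul_mem _ _ (Submodule.subset_span ⟨k, rfl⟩)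
    · intro hx
      refine Submodule.span_induction (p := fun x _ => x ∈ A.range) ?_ (Subring.zero_mem _)
        (fun x y _ _ hx hy => Subring.add_mem _ hx hy) (fun c x _ hx => Subring.zsmul_mem _ hx c) hx
      rintro _ ⟨k, rfl⟩
      refine ⟨X ^ (k : ℕ), ?_⟩
      funext j
      rw [hA, hb]
      simp
  refine ⟨A.range, fun c => ?_, ⟨∑ i, ‖b i‖, fun q => ?_⟩, ?_⟩
  · refine (ZSpan.setFinite_inter b (Metric.isBounded_closedBall (x := 0) (r := max c 0))).subset ?_
    rintro x ⟨hx, hxc⟩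
    refine ⟨?_, (hRb x).1 hx⟩
    rw [mem_closedBall_zero_iff, pi_norm_le_iff_of_nonneg (le_max_right _ _)]
    exact fun j => (hxc j).trans (le_max_left _ _)
  · refine ⟨-(ZSpan.floor b q : Fin (n + 1) → ℝ),
      Subring.neg_mem _ ((hRb _).2 (ZSpan.floor b q).2), fun j => ?_⟩
    have h1 := norm_le_pi_norm (ZSpan.fract b q) j
    rw [ZSpan.fract_apply] at h1
    have h2 := ZSpan.norm_fract_le (K := ℝ) b q
    rw [ZSpan.fract_apply] at h2
    exact h1.trans h2
  -- the units
  have hne : ∀ i j : Fin (n + 1), θ j - 3 * ((i : ℕ) : ℝ) ≠ 0 := by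
    intro i j h
    have := hθ2 j
    rw [Finset.prod_eq_zero (Finset.mem_univ i) h] at this
    exact zero_ne_one this
  -- The product of all `θ - 3 i` is `1`, so each is a unit whose inverse is the product of the
  -- others. Squaring makes it totally positive.
  have hunit : ∀ i : Fin (n + 1), ∃ u ∈ positiveUnits A.range,
      ∀ j, (u : Fin (n + 1) → ℝ) j = (θ j - 3 * ((i : ℕ) : ℝ)) ^ 2 := by
    intro i
    let v : Fin (n + 1) → ℝ := A ((X - C (3 * ((i : ℕ) : ℤ))) ^ 2)
    let w : Fin (n + 1) → ℝ := A ((∏ k ∈ Finset.univ.erase i, (X - C (3 * ((k : ℕ) : ℤ)))) ^ 2)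
    have hv : ∀ j, v j = (θ j - 3 * ((i : ℕ) : ℝ)) ^ 2 := fun j => by
      refine (hA _ j).trans ?_
      rw [map_pow, hlin]
    have hvw : v * w = 1 := by
      funext j
      change A _ j * A _ j = 1
      rw [hA, hA, ← map_mul, ← mul_pow, Finset.mul_prod_erase Finset.univ
        (fun k : Fin (n + 1) => (X - C (3 * ((k : ℕ) : ℤ)))) (Finset.mem_univ i),
        map_pow, map_prod]
      simp only [hlin, hθ2, one_pow]
    refine ⟨⟨v, w, hvw, by rw [mul_comm, hvw]⟩, ⟨⟨_, rfl⟩, ⟨_, rfl⟩, fun j => ?_, ?_⟩, hv⟩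
    · rw [show ((⟨v, w, hvw, by rw [mul_comm, hvw]⟩ : (Fin (n + 1) → ℝ)ˣ) : Fin (n + 1) → ℝ) j =
        v j from rfl, hv]
      exact (sq_nonneg _).lt_of_ne' (pow_ne_zero 2 (hne i j))
    · change ∏ j, v j = 1
      simp only [hv]
      exact hnorm i
  choose u hu huv using hunit
  let M : Matrix (Fin n) (Fin n) ℝ := fun i k => Real.log ((u i.succ : Fin (n + 1) → ℝ) k.succ)
  have hMpos : ∀ (i k : Fin (n + 1)), i ≠ k → 0 < Real.log ((u i : Fin (n + 1) → ℝ) k) := by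
    intro i k hik
    rw [huv, ← sq_abs]
    refine Real.log_pos ?_
    nlinarith [hsep i k hik]
  have hMsum : ∀ k : Fin (n + 1), ∑ i, Real.log ((u i : Fin (n + 1) → ℝ) k) = 0 := by
    intro k
    simp only [huv]
    rw [← Real.log_prod (fun i _ => pow_ne_zero 2 (hne i k)), Finset.prod_pow, hθ2]
    simp
  -- Off the diagonal the entries of column `k` are positive. Together with the entry of the omitted
  -- row `0`, also positive, the column sums to zero; hence the diagonal entry strictly dominates.
  have hM : M.det ≠ 0 := by
    refine det_ne_zero_of_sum_col_lt_diag fun k => ?_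
    have h1 : ∑ i ∈ Finset.univ.erase k, ‖M i k‖ = ∑ i ∈ Finset.univ.erase k, M i k := by
      refine Finset.sum_congr rfl fun i hi => ?_
      rw [Real.norm_of_nonneg]
      exact (hMpos _ _ fun h => (Finset.ne_of_mem_erase hi) (Fin.succ_injective _ h)).le
    have h2 := hMsum k.succ
    rw [Fin.sum_univ_succ] at h2
    have h3 : M k k + ∑ i ∈ Finset.univ.erase k, M i k = ∑ i, M i k :=
      Finset.add_sum_erase _ (fun i => M i k) (Finset.mem_univ k)
    have h4 : ∑ i, M i k = ∑ i : Fin n, Real.log ((u i.succ : Fin (n + 1) → ℝ) k.succ) := rfl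
    have h5 := hMpos 0 k.succ (Fin.succ_ne_zero k).symm
    rw [h1, Real.norm_eq_abs]
    have := neg_le_abs (M k k)
    linarith
  rcases isEmpty_or_nonempty (Fin n) with hn | hn
  · exact ⟨0, fun _ => ⟨1, Subgroup.one_mem _, fun i => hn.elim i⟩⟩
  let c : Module.Basis (Fin n) ℝ (Fin n → ℝ) :=
    basisOfLinearIndependentOfCardEqFinrank
      (Matrix.linearIndependent_rows_of_det_ne_zero hM) (by simp)
  have hc : ∀ i, c i = M i := fun i => by
    rw [show ⇑c = _ from coe_basisOfLinearIndependentOfCardEqFinrank _ _]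
  refine ⟨∑ i, ‖c i‖, fun t => ?_⟩
  -- Rounding the coordinates of `t` in the logarithmic lattice leaves a remainder in the
  -- fundamental parallelepiped.
  let z : Fin n → ℤ := fun i => ⌊c.repr t i⌋
  refine ⟨∏ i, (u i.succ) ^ (-z i), Subgroup.prod_mem _ fun i _ => Subgroup.zpow_mem _ (hu _) _,
    fun k => ?_⟩
  have hlog : Real.log (((∏ i, (u i.succ) ^ (-z i) : (Fin (n + 1) → ℝ)ˣ) : Fin (n + 1) → ℝ)
      k.succ) = - (ZSpan.floor c t : Fin n → ℝ) k := by
    rw [Units.coe_prod, Finset.prod_apply, Real.log_prod]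
    · simp only [units_pi_zpow_apply, Real.log_zpow]
      rw [ZSpan.floor]
      simp only [AddSubmonoidClass.coe_finsetSum, Finset.sum_apply]
      rw [← Finset.sum_neg_distrib]
      refine Finset.sum_congr rfl fun i _ => ?_
      simp [hc, z, M]
    · intro i _
      rw [units_pi_zpow_apply]
      exact zpow_ne_zero _ ((hu _).2.2.1 _).ne'
  rw [hlog, ← sub_eq_add_neg]
  have h1 := norm_le_pi_norm (ZSpan.fract c t) k
  rw [ZSpan.fract_apply] at h1
  have h2 := ZSpan.norm_fract_le (K := ℝ) c t
  rw [ZSpan.fract_apply] at h2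
  exact h1.trans h2

/-! ### Diagonal affine maps -/

section Diagonal

variable {ι : Type*}

/-- The affine map `y ↦ s * y + t`, with coordinatewise operations. -/
def diagPerm (s : (ι → ℝ)ˣ) (t : ι → ℝ) : Equiv.Perm (EuclideanSpace ℝ ι) where
  toFun y := WithLp.toLp 2 (s.1 * y.ofLp + t)
  invFun y := WithLp.toLp 2 ((s⁻¹).1 * (y.ofLp - t))
  left_inv y := by simp [← mul_assoc]
  right_inv y := by simp [← mul_assoc]

@[simp]
lemma diagPerm_apply (s : (ι → ℝ)ˣ) (t : ι → ℝ) (y : EuclideanSpace ℝ ι) (i : ι) :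
    diagPerm s t y i = s.1 i * y i + t i := rfl

lemma diagPerm_one : diagPerm (1 : (ι → ℝ)ˣ) 0 = 1 := by
  ext y i
  simp

lemma diagPerm_mul (s s' : (ι → ℝ)ˣ) (t t' : ι → ℝ) :
    diagPerm s t * diagPerm s' t' = diagPerm (s * s') (s.1 * t' + t) := by
  ext y i
  simp
  ring

lemma diagPerm_affine [Fintype ι] (s : (ι → ℝ)ˣ) (t : ι → ℝ) :
    ∃ a : EuclideanSpace ℝ ι →ᴬ[ℝ] EuclideanSpace ℝ ι, ∀ y, diagPerm s t y = a y := by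
  let L : EuclideanSpace ℝ ι →ₗ[ℝ] EuclideanSpace ℝ ι :=
    { toFun := fun y => WithLp.toLp 2 (s.1 * y.ofLp)
      map_add' := fun x y => by ext i; simp [mul_add]
      map_smul' := fun c y => by ext i; simp; ring }
  refine ⟨(LinearMap.toContinuousLinearMap L).toContinuousAffineMap +
    ContinuousAffineMap.const ℝ _ (WithLp.toLp 2 t), fun y => ?_⟩
  ext i
  simp [L]

lemma EuclideanSpace.isCompact_of_abs_le [Finite ι] {K : Set (EuclideanSpace ℝ ι)} (hK : IsClosed K) {C : ℝ}
    (h : ∀ y ∈ K, ∀ i, |y i| ≤ C) : IsCompact K := by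
  have h1 : IsCompact (Set.univ.pi fun _ : ι => Icc (-C) C) := isCompact_univ_pi fun _ => isCompact_Icc
  refine (h1.image (PiLp.continuous_toLp 2 fun _ : ι => ℝ)).of_isClosed_subset hK fun y hy => ?_
  exact ⟨y.ofLp, fun i _ => abs_le.1 (h y hy i), rfl⟩

/-- Two-sided bounds on `h` control the factor by which a transformation scales it when it moves a
point of `K` into `K`. -/
lemma exists_bound_of_pos {X κ : Type*} [TopologicalSpace X] [Finite κ] {K : Set X} (hK : IsCompact K)
    {h : κ → X → ℝ} (hc : ∀ k, ContinuousOn (h k) K) (hpos : ∀ k, ∀ x ∈ K, 0 < h k x) :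
    ∃ C : ℝ, ∀ k, ∀ x ∈ K, h k x ≤ C ∧ (h k x)⁻¹ ≤ C := by
  choose B hB using fun k => (hK.bddAbove_image (hc k)).exists_ge 0
  choose B' hB' using fun k =>
    (hK.bddAbove_image ((hc k).inv₀ fun x hx => (hpos k x hx).ne')).exists_ge 0
  obtain ⟨M, hM⟩ := (Set.finite_range B).bddAbove
  obtain ⟨M', hM'⟩ := (Set.finite_range B').bddAbove
  refine ⟨max M M', fun k x hx => ⟨?_, ?_⟩⟩
  · exact ((hB k).2 _ ⟨x, hx, rfl⟩).trans ((hM ⟨k, rfl⟩).trans (le_max_left _ _))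
  · exact ((hB' k).2 _ ⟨x, hx, rfl⟩).trans ((hM' ⟨k, rfl⟩).trans (le_max_right _ _))

end Diagonal

/-! ### The region -/

/-- The region `y 0 + (y 1) ^ 2 > 0`, `y i > 0` for `2 ≤ i ≤ n`. -/
def parabolicRegion (n : ℕ) : Set (EuclideanSpace ℝ (Fin (2 * (n + 1)))) :=
  {y | 0 < y 0 + y ⟨1, by omega⟩ ^ 2 ∧
    ∀ i : Fin (2 * (n + 1)), 2 ≤ (i : ℕ) → (i : ℕ) ≤ n → 0 < y i}

lemma isOpen_parabolicRegion (n : ℕ) : IsOpen (parabolicRegion n) := by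
  have h : parabolicRegion n = {y | 0 < y 0 + y ⟨1, by omega⟩ ^ 2} ∩
      ⋂ i : Fin (2 * (n + 1)), ⋂ _ : 2 ≤ (i : ℕ), ⋂ _ : (i : ℕ) ≤ n, {y | 0 < y i} := by
    ext y
    simp [parabolicRegion]
  rw [h]
  refine (isOpen_lt continuous_const (by fun_prop)).inter (isOpen_iInter_of_finite fun i =>
    isOpen_iInter_of_finite fun _ => isOpen_iInter_of_finite fun _ =>
      isOpen_lt continuous_const (by fun_prop))

/-- The set is not convex, but it is star-shaped about a point with `y 1 = 0`: along a segment the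
coordinate `0` becomes positive at once. This is where the two signs of `y 1` are joined. -/
lemma isConnected_parabolicRegion (n : ℕ) : IsConnected {y | y ∈ parabolicRegion n ∧ 0 ≤ y 0} := by
  let o : EuclideanSpace ℝ (Fin (2 * (n + 1))) :=
    WithLp.toLp 2 fun i => if (i : ℕ) = 1 then 0 else 1
  have ho : StarConvex ℝ o {y | y ∈ parabolicRegion n ∧ 0 ≤ y 0} := by
    rintro y ⟨⟨hy1, hy2⟩, hy0⟩ a b ha hb hab
    have h0 : (a • o + b • y) 0 = a + b * y 0 := by simp [o]
    have h1 : (a • o + b • y) ⟨1, by omega⟩ = b * y ⟨1, by omega⟩ := by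
      simp only [o, PiLp.add_apply, PiLp.smul_apply, smul_eq_mul]
      simp
    have h2 : 0 ≤ (a • o + b • y) 0 := by rw [h0]; positivity
    refine ⟨⟨?_, fun i hi hin => ?_⟩, h2⟩
    · rcases ha.eq_or_lt with rfl | ha
      · rw [zero_add] at hab
        rw [h0, h1, hab]
        simpa using hy1
      · rw [h0, h1]
        positivity
    · have h3 : (a • o + b • y) i = a + b * y i := by
        have : (i : ℕ) ≠ 1 := by omega
        simp [o, this]
      have := hy2 i hi hin
      rw [h3]
      rcases ha.eq_or_lt with rfl | ha
      · rw [zero_add] at hab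
        rw [hab]; simpa using this
      · positivity
  have hmem : o ∈ {y | y ∈ parabolicRegion n ∧ 0 ≤ y 0} := by
    refine ⟨⟨by simp [o], fun i hi _ => ?_⟩, by simp [o]⟩
    have : (i : ℕ) ≠ 1 := by omega
    simp [o, this]
  exact (ho.isPathConnected hmem).isConnected

lemma one_ne_zero_of_mem_parabolicRegion {n : ℕ} {y : EuclideanSpace ℝ (Fin (2 * (n + 1)))}
    (hy : y ∈ parabolicRegion n) (h0 : y 0 = 0) : y ⟨1, by omega⟩ ≠ 0 := by
  intro h
  have := hy.1
  rw [h0, h] at this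
  simp at this

lemma exists_mem_parabolicRegion (n : ℕ) {c : ℝ} (hc : c ≠ 0) :
    ∃ y ∈ parabolicRegion n, y 0 = 0 ∧ y ⟨1, by omega⟩ = c := by
  refine ⟨WithLp.toLp 2 fun i => if (i : ℕ) = 0 then 0 else if (i : ℕ) = 1 then c else 1,
    ⟨?_, fun i hi _ => ?_⟩, ?_, ?_⟩
  · simp; positivity
  · have h0 : (i : ℕ) ≠ 0 := by omega
    have h1 : (i : ℕ) ≠ 1 := by omega
    simp only [h0, h1, if_false]
    exact one_pos
  · simp
  · simp

lemma hasFDerivAt_coord {ι : Type*} [Fintype ι] (i : ι) (y : EuclideanSpace ℝ ι) :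
    HasFDerivAt (fun y : EuclideanSpace ℝ ι => y i)
      (EuclideanSpace.proj i : EuclideanSpace ℝ ι →L[ℝ] ℝ) y :=
  (EuclideanSpace.proj i : EuclideanSpace ℝ ι →L[ℝ] ℝ).hasFDerivAt

lemma hasFDerivAt_parabola {ι : Type*} [Fintype ι] (i j : ι) (y : EuclideanSpace ℝ ι) :
    HasFDerivAt (fun y : EuclideanSpace ℝ ι => y i + y j ^ 2)
      (EuclideanSpace.proj i + (2 * y j) • EuclideanSpace.proj j : EuclideanSpace ℝ ι →L[ℝ] ℝ) y :=
  ((hasFDerivAt_coord i y).add ((hasFDerivAt_coord j y).pow 2)).congr_fderiv (by simp)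

lemma hasFDerivAt_inv_sqrt_parabola {ι : Type*} [Fintype ι] (i j : ι) {y : EuclideanSpace ℝ ι}
    (hy : 0 < y i + y j ^ 2) :
    HasFDerivAt (fun y : EuclideanSpace ℝ ι => (√(y i + y j ^ 2))⁻¹)
      ((-(1 / (2 * √(y i + y j ^ 2))) / √(y i + y j ^ 2) ^ 2) •
        (EuclideanSpace.proj i + (2 * y j) • EuclideanSpace.proj j :
          EuclideanSpace ℝ ι →L[ℝ] ℝ)) y :=
  HasDerivAt.comp_hasFDerivAt (h₂ := fun x => (√x)⁻¹) y
    ((Real.hasDerivAt_sqrt hy.ne').fun_inv (Real.sqrt_ne_zero'.2 hy)) (hasFDerivAt_parabola i j y)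

/-! ### Dimension two -/

section Surface

/-- The scaling `(y 0, y 1) ↦ (4 y 0, 2 y 1)`. -/
def surfaceScale : (Fin (2 * (0 + 1)) → ℝ)ˣ :=
  Units.mk (![4, 2]) (![4⁻¹, 2⁻¹]) (by ext i; fin_cases i <;> simp) (by ext i; fin_cases i <;> simp)

lemma surfaceScale_zpow_zero (k : ℤ) : (surfaceScale ^ k).1 0 = 4 ^ k := by
  rw [units_pi_zpow_apply]; rfl

lemma surfaceScale_zpow_one (k : ℤ) : (surfaceScale ^ k).1 ⟨1, by omega⟩ = 2 ^ k := by
  rw [units_pi_zpow_apply]; rfl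

/-- The group generated by `surfaceScale`. -/
def surfaceGroup : Subgroup (Equiv.Perm (EuclideanSpace ℝ (Fin (2 * (0 + 1))))) :=
  (Subgroup.zpowers surfaceScale).map
    { toFun := fun s => diagPerm s 0
      map_one' := diagPerm_one
      map_mul' := fun s s' => by simp [diagPerm_mul] }

lemma mem_surfaceGroup {γ : Equiv.Perm (EuclideanSpace ℝ (Fin (2 * (0 + 1))))} :
    γ ∈ surfaceGroup ↔ ∃ k : ℤ, diagPerm (surfaceScale ^ k) 0 = γ := by
  constructor
  · rintro ⟨_, ⟨k, rfl⟩, rfl⟩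
    exact ⟨k, rfl⟩
  · rintro ⟨k, rfl⟩
    exact ⟨_, ⟨k, rfl⟩, rfl⟩

lemma diagPerm_surfaceScale_zero (k : ℤ) (y : EuclideanSpace ℝ (Fin (2 * (0 + 1)))) :
    diagPerm (surfaceScale ^ k) 0 y 0 = 4 ^ k * y 0 := by
  rw [diagPerm_apply, surfaceScale_zpow_zero, Pi.zero_apply, add_zero]

lemma diagPerm_surfaceScale_one (k : ℤ) (y : EuclideanSpace ℝ (Fin (2 * (0 + 1)))) :
    diagPerm (surfaceScale ^ k) 0 y ⟨1, by omega⟩ = 2 ^ k * y ⟨1, by omega⟩ := by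
  rw [diagPerm_apply, surfaceScale_zpow_one, Pi.zero_apply, add_zero]

lemma four_zpow_eq_sq (k : ℤ) : (4 : ℝ) ^ k = (2 ^ k) ^ 2 := by
  rw [show (4 : ℝ) = 2 * 2 by norm_num, mul_zpow, sq]

lemma diagPerm_surfaceScale_parabola (k : ℤ) (y : EuclideanSpace ℝ (Fin (2 * (0 + 1)))) :
    diagPerm (surfaceScale ^ k) 0 y 0 + diagPerm (surfaceScale ^ k) 0 y ⟨1, by omega⟩ ^ 2 =
      4 ^ k * (y 0 + y ⟨1, by omega⟩ ^ 2) := by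
  rw [diagPerm_surfaceScale_zero, diagPerm_surfaceScale_one, four_zpow_eq_sq]
  ring

/-- The momentum coordinate in dimension two. -/
def surfaceP (y : EuclideanSpace ℝ (Fin (2 * (0 + 1)))) : ℝ :=
  y ⟨1, by omega⟩ * (√(y 0 + y ⟨1, by omega⟩ ^ 2))⁻¹

/-- The position coordinate in dimension two. -/
def surfaceQ (y : EuclideanSpace ℝ (Fin (2 * (0 + 1)))) : ℝ :=
  Real.log (y 0 + y ⟨1, by omega⟩ ^ 2)

lemma contDiffAt_surfaceP {y} (hy : y ∈ parabolicRegion 0) : ContDiffAt ℝ ∞ surfaceP y := by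
  have h1 := hy.1
  have h2 := Real.sqrt_ne_zero'.2 h1
  unfold surfaceP
  have h3 : ContDiffAt ℝ ∞ (fun y : EuclideanSpace ℝ (Fin (2 * (0 + 1))) =>
    y 0 + y ⟨1, by omega⟩ ^ 2) y := by fun_prop
  have h4 : ContDiffAt ℝ ∞ (fun y : EuclideanSpace ℝ (Fin (2 * (0 + 1))) =>
    y ⟨1, by omega⟩) y := by fun_prop
  exact h4.mul ((h3.sqrt h1.ne').inv h2)

lemma contDiffAt_surfaceQ {y} (hy : y ∈ parabolicRegion 0) : ContDiffAt ℝ ∞ surfaceQ y := by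
  have h3 : ContDiffAt ℝ ∞ (fun y : EuclideanSpace ℝ (Fin (2 * (0 + 1))) =>
    y 0 + y ⟨1, by omega⟩ ^ 2) y := by fun_prop
  exact h3.log hy.1.ne'

lemma fderiv_surfaceQ {y} (hy : y ∈ parabolicRegion 0) (v) : fderiv ℝ surfaceQ y v =
    (y 0 + y ⟨1, by omega⟩ ^ 2)⁻¹ * (v 0 + 2 * y ⟨1, by omega⟩ * v ⟨1, by omega⟩) := by
  have h := (hasFDerivAt_parabola 0 ⟨1, by omega⟩ y).log hy.1.ne'
  have h' : HasFDerivAt surfaceQ _ y := h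
  rw [h'.fderiv]
  rfl

lemma fderiv_surfaceP {y} (hy : y ∈ parabolicRegion 0) (v) : fderiv ℝ surfaceP y v =
    y ⟨1, by omega⟩ * ((-(1 / (2 * √(y 0 + y ⟨1, by omega⟩ ^ 2))) /
      √(y 0 + y ⟨1, by omega⟩ ^ 2) ^ 2) * (v 0 + 2 * y ⟨1, by omega⟩ * v ⟨1, by omega⟩)) +
      (√(y 0 + y ⟨1, by omega⟩ ^ 2))⁻¹ * v ⟨1, by omega⟩ := by
  have h1 := hasFDerivAt_coord (ι := Fin (2 * (0 + 1))) ⟨1, by omega⟩ y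
  have h2 := hasFDerivAt_inv_sqrt_parabola (ι := Fin (2 * (0 + 1))) 0 ⟨1, by omega⟩ hy.1
  have h' : HasFDerivAt surfaceP _ y := h1.mul h2
  rw [h'.fderiv]
  rfl

lemma surface_ext {y z : EuclideanSpace ℝ (Fin (2 * (0 + 1)))} (h0 : y 0 = z 0)
    (h1 : y ⟨1, by omega⟩ = z ⟨1, by omega⟩) : y = z := by
  ext i
  obtain ⟨i, hi⟩ := i
  rcases (by omega : i = 0 ∨ i = 1) with rfl | rfl
  · exact h0
  · exact h1

/-- With `s = y 0 + y 1 ^ 2`, the condition `0 ≤ y 0` reads `|P| ≤ 1`, while the generator fixes `P`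
and shifts `Q = log s` by `log 4`. The quotient is the annulus `[-1, 1] × ℝ / (log 4) ℤ` with the
form `P dQ`. -/
theorem liouvilleData_surface : LiouvilleData 0 surfaceGroup (parabolicRegion 0)
    (pqForm (fun _ : Fin 1 => surfaceP) (fun _ : Fin 1 => surfaceQ)) where
  isOpen := isOpen_parabolicRegion 0
  affine := by
    intro γ hγ
    obtain ⟨k, rfl⟩ := mem_surfaceGroup.1 hγ
    exact diagPerm_affine _ _
  scale_zero := by
    intro γ hγ
    obtain ⟨k, rfl⟩ := mem_surfaceGroup.1 hγ
    exact ⟨4 ^ k, by positivity, diagPerm_surfaceScale_zero k⟩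
  scale_one := by
    intro γ hγ
    obtain ⟨k, rfl⟩ := mem_surfaceGroup.1 hγ
    exact ⟨2 ^ k, by positivity, diagPerm_surfaceScale_one k⟩
  mapsTo := by
    intro γ hγ y hy
    obtain ⟨k, rfl⟩ := mem_surfaceGroup.1 hγ
    refine ⟨?_, fun i hi hi' => by omega⟩
    rw [diagPerm_surfaceScale_parabola]
    have := hy.1
    positivity
  free := by
    intro γ hγ y hy h
    obtain ⟨k, rfl⟩ := mem_surfaceGroup.1 hγ
    have h1 := diagPerm_surfaceScale_parabola k y
    rw [h] at h1
    have h2 : (4 : ℝ) ^ k = 1 := mul_right_cancel₀ hy.1.ne' (by rw [one_mul]; exact h1.symm)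
    have h3 : k = 0 := by
      rwa [zpow_eq_one_iff_right₀ (by norm_num) (by norm_num)] at h2
    rw [h3, zpow_zero, diagPerm_one]
  finite := by
    intro K hK hKc
    obtain ⟨C, hC⟩ := exists_bound_of_pos hKc (κ := Unit)
      (h := fun _ y => y 0 + y ⟨1, by omega⟩ ^ 2) (fun _ => by fun_prop)
      (fun _ y hy => (hK hy).1)
    -- `4 ^ k` and `4 ^ (-k)` are both ratios of values of `s` on `K`, hence at most `C * C`.
    obtain ⟨N, hN⟩ := pow_unbounded_of_one_lt (C * C) (by norm_num : (1 : ℝ) < 4)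
    refine ((Set.finite_Ioo (-(N : ℤ)) N).image fun k => diagPerm (surfaceScale ^ k) 0).subset ?_
    rintro γ ⟨hγ, y, hy, hy'⟩
    obtain ⟨k, rfl⟩ := mem_surfaceGroup.1 hγ
    refine ⟨k, ?_, rfl⟩
    have hs := (hK hy).1
    have hs' := (hK hy').1
    have e := diagPerm_surfaceScale_parabola k y
    have h1 : (4 : ℝ) ^ k ≤ C * C := by
      rw [eq_comm, ← eq_mul_inv_iff_mul_eq₀ hs.ne'] at e
      rw [e]
      exact mul_le_mul (hC () _ hy').1 (hC () _ hy).2 (inv_nonneg.2 hs.le)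
        (hs'.le.trans (hC () _ hy').1)
    have h2 : (4 : ℝ) ^ (-k) ≤ C * C := by
      have e' : (4 : ℝ) ^ (-k) = (y 0 + y ⟨1, by omega⟩ ^ 2) *
          (diagPerm (surfaceScale ^ k) 0 y 0 +
            diagPerm (surfaceScale ^ k) 0 y ⟨1, by omega⟩ ^ 2)⁻¹ := by
        rw [e, zpow_neg]
        field_simp
      rw [e']
      exact mul_le_mul (hC () _ hy).1 (hC () _ hy').2 (inv_nonneg.2 hs'.le)
        (hs.le.trans (hC () _ hy).1)
    have h3 := (zpow_lt_zpow_iff_right₀ (by norm_num : (1 : ℝ) < 4)).1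
      (h1.trans_lt (by exact_mod_cast hN) : (4 : ℝ) ^ k < 4 ^ (N : ℤ))
    have h4 := (zpow_lt_zpow_iff_right₀ (by norm_num : (1 : ℝ) < 4)).1
      (h2.trans_lt (by exact_mod_cast hN) : (4 : ℝ) ^ (-k) < 4 ^ (N : ℤ))
    exact ⟨by linarith, h3⟩
  cocompact := by
    -- `s` is multiplied by powers of `4`, so `1 ≤ s ≤ 4` meets every orbit. Since `0 ≤ y 0`, both
    -- `y 0` and `y 1 ^ 2` are at most `s`.
    refine ⟨{y | 0 ≤ y 0 ∧ 1 ≤ y 0 + y ⟨1, by omega⟩ ^ 2 ∧ y 0 + y ⟨1, by omega⟩ ^ 2 ≤ 4},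
      fun y hy => ⟨by linarith [hy.2.1], fun i hi hi' => by omega⟩, ?_, ?_⟩
    · refine EuclideanSpace.isCompact_of_abs_le (C := 4) ?_ ?_
      · have c0 : Continuous fun y : EuclideanSpace ℝ (Fin (2 * (0 + 1))) => y 0 := by fun_prop
        have c1 : Continuous fun y : EuclideanSpace ℝ (Fin (2 * (0 + 1))) =>
          y 0 + y ⟨1, by omega⟩ ^ 2 := by fun_prop
        exact (isClosed_le continuous_const c0).inter
          ((isClosed_le continuous_const c1).inter (isClosed_le c1 continuous_const))
      · rintro y ⟨h0, h1, h2⟩ ⟨i, hi⟩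
        rcases (by omega : i = 0 ∨ i = 1) with rfl | rfl
        · change |y 0| ≤ 4
          rw [abs_of_nonneg h0]
          nlinarith
        · refine abs_le_of_sq_le_sq ?_ (by norm_num)
          linarith
    · intro y hy h0
      obtain ⟨k, hk1, hk2⟩ := exists_mem_Ico_zpow hy.1 (by norm_num : (1 : ℝ) < 4)
      refine ⟨_, mem_surfaceGroup.2 ⟨-k, rfl⟩, ?_, ?_, ?_⟩
      · rw [diagPerm_surfaceScale_zero]
        positivity
      · rw [diagPerm_surfaceScale_parabola, zpow_neg, inv_mul_eq_div,
          one_le_div (by positivity)]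
        exact hk1
      · rw [diagPerm_surfaceScale_parabola, zpow_neg, inv_mul_eq_div,
          div_le_iff₀ (by positivity)]
        rw [zpow_add_one₀ (by norm_num)] at hk2
        linarith
  connected := isConnected_parabolicRegion 0
  one_ne_zero := fun y => one_ne_zero_of_mem_parabolicRegion
  exists_pos := by
    obtain ⟨y, hy, h0, h1⟩ := exists_mem_parabolicRegion 0 one_ne_zero
    exact ⟨y, hy, h0, by rw [h1]; exact one_pos⟩
  exists_neg := by
    obtain ⟨y, hy, h0, h1⟩ := exists_mem_parabolicRegion 0 (neg_ne_zero.2 one_ne_zero)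
    exact ⟨y, hy, h0, by rw [h1]; norm_num⟩
  smooth := fun y hy => contDiffAt_pqForm (fun _ => contDiffAt_surfaceP hy)
    fun _ => contDiffAt_surfaceQ hy
  invariant := by
    intro γ hγ a ha y hy
    obtain ⟨k, rfl⟩ := mem_surfaceGroup.1 hγ
    have e : ∀ y, a y 0 + a y ⟨1, by omega⟩ ^ 2 = 4 ^ k * (y 0 + y ⟨1, by omega⟩ ^ 2) :=
      fun y => by rw [← ha, diagPerm_surfaceScale_parabola]
    have h2 : (0 : ℝ) < 2 ^ k := by positivity
    refine pqForm_pullback (isOpen_parabolicRegion 0)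
      (fun _ y hy => (contDiffAt_surfaceQ hy).differentiableAt (by simp)) a
      (fun y hy => ⟨?_, fun i hi hi' => by omega⟩) (fun _ => 1) (fun _ => Real.log (4 ^ k))
      (fun _ => one_ne_zero) (fun _ y hy => ?_) (fun _ y hy => ?_) hy
    · have := hy.1
      rw [e]
      positivity
    · rw [surfaceP, e, ← ha, diagPerm_surfaceScale_one, four_zpow_eq_sq,
        Real.sqrt_mul (by positivity), Real.sqrt_sq h2.le, surfaceP, mul_inv]
      field_simp
    · rw [surfaceQ, e, Real.log_mul (by positivity) hy.1.ne', surfaceQ]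
      ring
  nondegenerate := by
    intro y hy v hv
    refine extDeriv_pqForm_nondegenerate (by simp) (fun _ => contDiffAt_surfaceP hy)
      (fun _ => contDiffAt_surfaceQ hy) (fun v hP hQ => ?_) v hv
    have h1 := hP 0
    have h2 := hQ 0
    rw [fderiv_surfaceQ hy] at h2
    rw [fderiv_surfaceP hy] at h1
    have h3 := (mul_eq_zero.1 h2).resolve_left (inv_ne_zero hy.1.ne')
    rw [h3, mul_zero, mul_zero, zero_add] at h1
    have h4 := (mul_eq_zero.1 h1).resolve_left (inv_ne_zero (Real.sqrt_ne_zero'.2 hy.1))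
    rw [h4, mul_zero, add_zero] at h3
    exact surface_ext h3 h4
  liouville := by
    intro y hy h0
    -- The equation `dQ(Z) = 0` keeps `s` fixed to first order, and then `dP(Z) = P` forces `Z 1 = y
    -- 1` and `Z 0 = -2 * y 1 ^ 2`.
    refine ⟨WithLp.toLp 2 ![-2 * y ⟨1, by omega⟩ ^ 2, y ⟨1, by omega⟩], ?_,
      extDeriv_pqForm_liouville (fun _ => contDiffAt_surfaceP hy)
      (fun _ => contDiffAt_surfaceQ hy) (fun _ => ?_) (fun _ => ?_)⟩
    · have h1 := hy.1
      rw [h0] at h1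
      change -2 * y ⟨1, by omega⟩ ^ 2 < 0
      linarith
    · rw [fderiv_surfaceP hy, surfaceP]
      change _ * (_ * (-2 * y ⟨1, by omega⟩ ^ 2 + 2 * _ * y ⟨1, by omega⟩)) +
        _ * y ⟨1, by omega⟩ = _
      ring
    · rw [fderiv_surfaceQ hy]
      change _ * (-2 * y ⟨1, by omega⟩ ^ 2 + 2 * _ * y ⟨1, by omega⟩) = 0
      ring

end Surface

/-! ### Dimension at least four -/

section HigherDimension

variable {m : ℕ}

/-- Splitting of the coordinates into momenta and positions. -/
def coordEquiv (m : ℕ) : Fin (m + 2) ⊕ Fin (m + 2) ≃ Fin (2 * (m + 1 + 1)) :=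
  finSumFinEquiv.trans (finCongr (by omega))

/-- The index of a momentum coordinate. -/
def pIdx (j : Fin (m + 2)) : Fin (2 * (m + 1 + 1)) := coordEquiv m (Sum.inl j)

/-- The index of a position coordinate. -/
def qIdx (j : Fin (m + 2)) : Fin (2 * (m + 1 + 1)) := coordEquiv m (Sum.inr j)

lemma pIdx_val (j : Fin (m + 2)) : (pIdx j : ℕ) = j := rfl

lemma zero_eq_pIdx : (0 : Fin (2 * (m + 1 + 1))) = pIdx 0 := rfl

lemma pIdx_or_qIdx (i : Fin (2 * (m + 1 + 1))) : (∃ j, i = pIdx j) ∨ ∃ j, i = qIdx j := by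
  obtain ⟨j | j, rfl⟩ := (coordEquiv m).surjective i
  · exact Or.inl ⟨j, rfl⟩
  · exact Or.inr ⟨j, rfl⟩

lemma ext_pIdx_qIdx {y z : EuclideanSpace ℝ (Fin (2 * (m + 1 + 1)))}
    (hp : ∀ j, y (pIdx j) = z (pIdx j)) (hq : ∀ j, y (qIdx j) = z (qIdx j)) : y = z := by
  ext i
  rcases pIdx_or_qIdx i with ⟨j, rfl⟩ | ⟨j, rfl⟩
  · exact hp j
  · exact hq j

lemma mem_parabolicRegion_iff {y : EuclideanSpace ℝ (Fin (2 * (m + 1 + 1)))} :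
    y ∈ parabolicRegion (m + 1) ↔ 0 < y (pIdx 0) + y (pIdx 1) ^ 2 ∧
      ∀ k : Fin m, 0 < y (pIdx k.succ.succ) := by
  refine and_congr Iff.rfl ⟨fun h k => h _ ?_ ?_, fun h i hi hin => ?_⟩
  · rw [pIdx_val]; simp
  · rw [pIdx_val]; simp only [Fin.val_succ]; omega
  · have := h ⟨i - 2, by omega⟩
    convert this
    refine Fin.ext ?_
    rw [pIdx_val]
    simp only [Fin.val_succ]
    omega

/-- The linear part of the action of a unit. -/
def unitAction (m : ℕ) : (Fin (m + 2) → ℝ) →* (Fin (2 * (m + 1 + 1)) → ℝ) :=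
  MonoidHom.pi fun i => Sum.elim
    -- The coordinate `pIdx 0` is scaled like the square of the coordinate `pIdx 1`, so that `y
    -- (pIdx 0) + y (pIdx 1) ^ 2` is homogeneous.
    (Fin.cons (α := fun _ => (Fin (m + 2) → ℝ) →* ℝ) ((Pi.evalMonoidHom (fun _ => ℝ) 1) ^ 2)
      fun j => Pi.evalMonoidHom (fun _ => ℝ) j.succ)
    (fun j => Pi.evalMonoidHom (fun _ => ℝ) j) ((coordEquiv m).symm i)

lemma unitAction_p_zero (u : Fin (m + 2) → ℝ) : unitAction m u (pIdx 0) = u 1 ^ 2 := by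
  simp [unitAction, pIdx]

lemma unitAction_p_succ (u : Fin (m + 2) → ℝ) (j : Fin (m + 1)) :
    unitAction m u (pIdx j.succ) = u j.succ := by
  simp [unitAction, pIdx]

lemma unitAction_q (u : Fin (m + 2) → ℝ) (j : Fin (m + 2)) :
    unitAction m u (qIdx j) = u j := by
  simp [unitAction, qIdx]

/-- The translation by a vector of positions. -/
def positionVec (b : Fin (m + 2) → ℝ) (i : Fin (2 * (m + 1 + 1))) : ℝ :=
  Sum.elim 0 b ((coordEquiv m).symm i)

@[simp]
lemma positionVec_p (b : Fin (m + 2) → ℝ) (j) : positionVec b (pIdx j) = 0 := by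
  simp [positionVec, pIdx]

@[simp]
lemma positionVec_q (b : Fin (m + 2) → ℝ) (j) : positionVec b (qIdx j) = b j := by
  simp [positionVec, qIdx]

/-- The transformation given by a unit and a translation. -/
def cuspPerm (u : (Fin (m + 2) → ℝ)ˣ) (b : Fin (m + 2) → ℝ) :
    Equiv.Perm (EuclideanSpace ℝ (Fin (2 * (m + 1 + 1)))) :=
  diagPerm (Units.map (unitAction m) u) (positionVec b)

lemma cuspPerm_p_zero (u : (Fin (m + 2) → ℝ)ˣ) (b : Fin (m + 2) → ℝ) (y) :
    cuspPerm u b y (pIdx 0) = u.1 1 ^ 2 * y (pIdx 0) := by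
  rw [cuspPerm, diagPerm_apply, positionVec_p, add_zero, Units.coe_map, unitAction_p_zero]

lemma cuspPerm_p_succ (u : (Fin (m + 2) → ℝ)ˣ) (b : Fin (m + 2) → ℝ) (y) (j : Fin (m + 1)) :
    cuspPerm u b y (pIdx j.succ) = u.1 j.succ * y (pIdx j.succ) := by
  rw [cuspPerm, diagPerm_apply, positionVec_p, add_zero, Units.coe_map, unitAction_p_succ]

lemma cuspPerm_q (u : (Fin (m + 2) → ℝ)ˣ) (b : Fin (m + 2) → ℝ) (y) (j : Fin (m + 2)) :
    cuspPerm u b y (qIdx j) = u.1 j * y (qIdx j) + b j := by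
  rw [cuspPerm, diagPerm_apply, positionVec_q, Units.coe_map, unitAction_q]

lemma cuspPerm_one : cuspPerm (m := m) 1 0 = 1 := by
  ext1 y
  refine ext_pIdx_qIdx (fun j => ?_) fun j => by simp [cuspPerm_q]
  refine Fin.cases ?_ (fun j => ?_) j
  · simp [cuspPerm_p_zero]
  · simp [cuspPerm_p_succ]

/-- The group of transformations given by the totally positive units of norm one and
the translations of a ring `R`. -/
def cuspGroup (R : Subring (Fin (m + 2) → ℝ)) :
    Subgroup (Equiv.Perm (EuclideanSpace ℝ (Fin (2 * (m + 1 + 1))))) where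
  carrier := {γ | ∃ u ∈ positiveUnits R, ∃ b ∈ R, cuspPerm u b = γ}
  one_mem' := ⟨1, one_mem _, 0, zero_mem _, cuspPerm_one⟩
  mul_mem' := by
    rintro _ _ ⟨u, hu, b, hb, rfl⟩ ⟨v, hv, c, hc, rfl⟩
    refine ⟨u * v, mul_mem hu hv, u.1 * c + b, add_mem (mul_mem hu.1 hc) hb, ?_⟩
    ext1 y
    refine ext_pIdx_qIdx (fun j => ?_) fun j => by simp [cuspPerm_q]; ring
    refine Fin.cases ?_ (fun j => ?_) j
    · simp [cuspPerm_p_zero]; ring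
    · simp [cuspPerm_p_succ]; ring
  inv_mem' := by
    rintro _ ⟨u, hu, b, hb, rfl⟩
    refine ⟨u⁻¹, inv_mem hu, -((u⁻¹).1 * b), neg_mem (mul_mem hu.2.1 hb), ?_⟩
    rw [eq_comm, inv_eq_iff_mul_eq_one]
    have hne : ∀ j, u.1 j ≠ 0 := fun j => (hu.2.2.1 j).ne'
    ext1 y
    refine ext_pIdx_qIdx (fun j => ?_) fun j => ?_
    · refine Fin.cases ?_ (fun j => ?_) j
      · simp only [Equiv.Perm.coe_mul, Function.comp_apply, cuspPerm_p_zero, units_pi_inv_apply,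
          Equiv.Perm.coe_one, id_eq]
        have := hne 1
        field_simp
      · simp only [Equiv.Perm.coe_mul, Function.comp_apply, cuspPerm_p_succ, units_pi_inv_apply,
          Equiv.Perm.coe_one, id_eq]
        have := hne j.succ
        field_simp
    · simp only [Equiv.Perm.coe_mul, Function.comp_apply, cuspPerm_q, units_pi_inv_apply,
        Equiv.Perm.coe_one, id_eq, Pi.neg_apply, Pi.mul_apply]
      have := hne j
      field_simp
      ring

/-- The positive functions which are scaled by the coordinates `u (j + 1)` of a unit. -/
def cuspScale (j : Fin (m + 1)) (y : EuclideanSpace ℝ (Fin (2 * (m + 1 + 1)))) : ℝ :=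
  Fin.cases (√(y (pIdx 0) + y (pIdx 1) ^ 2)) (fun k : Fin m => y (pIdx k.succ.succ)) j

@[simp]
lemma cuspScale_zero (y : EuclideanSpace ℝ (Fin (2 * (m + 1 + 1)))) :
    cuspScale 0 y = √(y (pIdx 0) + y (pIdx 1) ^ 2) := rfl

@[simp]
lemma cuspScale_succ (k : Fin m) (y : EuclideanSpace ℝ (Fin (2 * (m + 1 + 1)))) :
    cuspScale k.succ y = y (pIdx k.succ.succ) := rfl

lemma mem_parabolicRegion_iff_cuspScale {y : EuclideanSpace ℝ (Fin (2 * (m + 1 + 1)))} :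
    y ∈ parabolicRegion (m + 1) ↔ ∀ j, 0 < cuspScale j y := by
  rw [mem_parabolicRegion_iff, Fin.forall_fin_succ, cuspScale_zero, Real.sqrt_pos]
  rfl

lemma continuous_cuspScale (j : Fin (m + 1)) : Continuous (cuspScale (m := m) j) := by
  refine Fin.cases ?_ (fun k => ?_) j
  · change Continuous fun y : EuclideanSpace ℝ (Fin (2 * (m + 1 + 1))) =>
      √(y (pIdx 0) + y (pIdx 1) ^ 2)
    fun_prop
  · change Continuous fun y : EuclideanSpace ℝ (Fin (2 * (m + 1 + 1))) => y (pIdx k.succ.succ)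
    fun_prop

lemma cuspScale_cuspPerm {u : (Fin (m + 2) → ℝ)ˣ} (hu : ∀ j, 0 < u.1 j) (b : Fin (m + 2) → ℝ)
    (j : Fin (m + 1)) (y) : cuspScale j (cuspPerm u b y) = u.1 j.succ * cuspScale j y := by
  refine Fin.cases ?_ (fun k => ?_) j
  · have h1 : cuspPerm u b y (pIdx 1) = u.1 1 * y (pIdx 1) := cuspPerm_p_succ u b y 0
    rw [cuspScale_zero, cuspScale_zero, cuspPerm_p_zero, h1, mul_pow, ← mul_add,
      Real.sqrt_mul (sq_nonneg _), Real.sqrt_sq (hu 1).le]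
    rfl
  · rw [cuspScale_succ, cuspScale_succ, cuspPerm_p_succ]

/-- The momenta. -/
def cuspP (j : Fin (m + 2)) (y : EuclideanSpace ℝ (Fin (2 * (m + 1 + 1)))) : ℝ :=
  Fin.cases (y (pIdx 1) * ∏ k : Fin m, y (pIdx k.succ.succ)) (fun j => (cuspScale j y)⁻¹) j

/-- The positions. -/
def cuspQ (j : Fin (m + 2)) (y : EuclideanSpace ℝ (Fin (2 * (m + 1 + 1)))) : ℝ := y (qIdx j)

@[simp]
lemma cuspP_zero (y : EuclideanSpace ℝ (Fin (2 * (m + 1 + 1)))) :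
    cuspP 0 y = y (pIdx 1) * ∏ k : Fin m, y (pIdx k.succ.succ) := rfl

@[simp]
lemma cuspP_succ (j : Fin (m + 1)) (y : EuclideanSpace ℝ (Fin (2 * (m + 1 + 1)))) :
    cuspP j.succ y = (cuspScale j y)⁻¹ := rfl

/-- For `j = 0` the momentum is multiplied by all the `u i` with `i ≥ 1`, and their product is `(u
0)⁻¹` because `u` has norm one. -/
lemma cuspP_cuspPerm {u : (Fin (m + 2) → ℝ)ˣ} (hu : ∀ j, 0 < u.1 j) (hu1 : ∏ j, u.1 j = 1)
    (b : Fin (m + 2) → ℝ) (j : Fin (m + 2)) (y) :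
    cuspP j (cuspPerm u b y) = (u.1 j)⁻¹ * cuspP j y := by
  refine Fin.cases ?_ (fun k => ?_) j
  · have h1 : cuspPerm u b y (pIdx 1) = u.1 1 * y (pIdx 1) := cuspPerm_p_succ u b y 0
    simp only [cuspP_zero, h1, cuspPerm_p_succ, Finset.prod_mul_distrib]
    rw [Fin.prod_univ_succ, Fin.prod_univ_succ, Fin.succ_zero_eq_one] at hu1
    rw [← eq_inv_of_mul_eq_one_right hu1]
    ring
  · rw [cuspP_succ, cuspP_succ, cuspScale_cuspPerm hu, mul_inv]

lemma contDiffAt_cuspP {y} (hy : y ∈ parabolicRegion (m + 1)) (j : Fin (m + 2)) :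
    ContDiffAt ℝ ∞ (cuspP j) y := by
  have hc : ∀ i, ContDiffAt ℝ ∞ (fun y : EuclideanSpace ℝ (Fin (2 * (m + 1 + 1))) => y i) y :=
    fun i => by fun_prop
  refine Fin.cases ?_ (fun j => ?_) j
  · exact (hc _).mul (contDiffAt_prod fun k _ => hc _)
  · refine ContDiffAt.inv ?_ (mem_parabolicRegion_iff_cuspScale.1 hy j).ne'
    refine Fin.cases ?_ (fun k => hc _) j
    exact ((hc _).add ((hc _).pow 2)).sqrt hy.1.ne'

lemma contDiffAt_cuspQ (y) (j : Fin (m + 2)) : ContDiffAt ℝ ∞ (cuspQ j) y := by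
  unfold cuspQ
  fun_prop

lemma fderiv_cuspQ (y v) (j : Fin (m + 2)) : fderiv ℝ (cuspQ j) y v = v (qIdx j) := by
  have h : HasFDerivAt (cuspQ j) _ y := hasFDerivAt_coord (qIdx j) y
  rw [h.fderiv]
  rfl

lemma fderiv_cuspP_zero (y v : EuclideanSpace ℝ (Fin (2 * (m + 1 + 1)))) :
    fderiv ℝ (cuspP 0) y v =
      y (pIdx 1) * ∑ k : Fin m, (∏ l ∈ Finset.univ.erase k, y (pIdx l.succ.succ)) *
        v (pIdx k.succ.succ) + (∏ k : Fin m, y (pIdx k.succ.succ)) * v (pIdx 1) := by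
  have h : HasFDerivAt (cuspP 0) _ y := (hasFDerivAt_coord (pIdx 1) y).mul
    (HasFDerivAt.finsetProd (u := Finset.univ)
      fun (k : Fin m) _ => hasFDerivAt_coord (pIdx k.succ.succ) y)
  rw [h.fderiv]
  simp

lemma fderiv_cuspP_one {y} (hy : y ∈ parabolicRegion (m + 1)) (v) :
    fderiv ℝ (cuspP 1) y v = (-(1 / (2 * √(y (pIdx 0) + y (pIdx 1) ^ 2))) /
      √(y (pIdx 0) + y (pIdx 1) ^ 2) ^ 2) * (v (pIdx 0) + 2 * y (pIdx 1) * v (pIdx 1)) := by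
  have h : HasFDerivAt (cuspP 1) _ y := hasFDerivAt_inv_sqrt_parabola (pIdx 0) (pIdx 1) hy.1
  rw [h.fderiv]
  rfl

lemma fderiv_cuspP_succ_succ {y} (hy : y ∈ parabolicRegion (m + 1)) (v) (k : Fin m) :
    fderiv ℝ (cuspP k.succ.succ) y v = -(y (pIdx k.succ.succ) ^ 2)⁻¹ * v (pIdx k.succ.succ) := by
  have h : HasFDerivAt (cuspP k.succ.succ) _ y :=
    HasDerivAt.comp_hasFDerivAt (h₂ := fun x => x⁻¹) y
      (hasDerivAt_inv ((mem_parabolicRegion_iff.1 hy).2 k).ne')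
      (hasFDerivAt_coord (pIdx k.succ.succ) y)
  rw [h.fderiv]
  rfl

/-- The product of all momenta is `y (pIdx 1) / √(y (pIdx 0) + y (pIdx 1) ^ 2)`, so the half-space
condition reads `|∏ P_j| ≤ 1`, and the two signs of `y (pIdx 1)` give the two boundary levels. -/
theorem liouvilleData_cusp {R : Subring (Fin (m + 2) → ℝ)}
    (hfin : ∀ C : ℝ, {x | x ∈ R ∧ ∀ j, |x j| ≤ C}.Finite)
    (hcov : ∃ C : ℝ, ∀ q : Fin (m + 2) → ℝ, ∃ b ∈ R, ∀ j, |q j + b j| ≤ C)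
    (hunits : ∃ C : ℝ, ∀ t : Fin (m + 1) → ℝ, ∃ u ∈ positiveUnits R,
      ∀ i, |t i + Real.log (u.1 i.succ)| ≤ C) :
    LiouvilleData (m + 1) (cuspGroup R) (parabolicRegion (m + 1)) (pqForm cuspP cuspQ) where
  isOpen := isOpen_parabolicRegion _
  affine := by
    rintro _ ⟨u, hu, b, hb, rfl⟩
    exact diagPerm_affine _ _
  scale_zero := by
    rintro _ ⟨u, hu, b, hb, rfl⟩
    exact ⟨_, pow_pos (hu.2.2.1 1) 2, cuspPerm_p_zero u b⟩
  scale_one := by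
    rintro _ ⟨u, hu, b, hb, rfl⟩
    exact ⟨_, hu.2.2.1 1, fun y => cuspPerm_p_succ u b y 0⟩
  mapsTo := by
    rintro _ ⟨u, hu, b, hb, rfl⟩ y hy
    rw [mem_parabolicRegion_iff_cuspScale] at hy ⊢
    intro j
    rw [cuspScale_cuspPerm hu.2.2.1]
    exact mul_pos (hu.2.2.1 _) (hy j)
  free := by
    rintro _ ⟨u, hu, b, hb, rfl⟩ y hy h
    have h1 : ∀ j : Fin (m + 1), u.1 j.succ = 1 := fun j => by
      have h2 := cuspScale_cuspPerm hu.2.2.1 b j y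
      rw [h] at h2
      exact mul_right_cancel₀ (mem_parabolicRegion_iff_cuspScale.1 hy j).ne'
        (by rw [one_mul]; exact h2.symm)
    have h0 : u.1 0 = 1 := by
      have h2 := hu.2.2.2
      rwa [Fin.prod_univ_succ, Finset.prod_eq_one fun j _ => h1 j, mul_one] at h2
    have hu1 : u = 1 := Units.ext (funext fun j => Fin.cases h0 h1 j)
    have hb0 : b = 0 := by
      funext j
      have h2 := cuspPerm_q u b y j
      rw [h, hu1] at h2
      simpa using h2
    rw [hu1, hb0, cuspPerm_one]
  finite := by
    intro K hK hKc
    have hpos : ∀ j, ∀ y ∈ K, 0 < cuspScale (m := m) j y :=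
      fun j y hy => mem_parabolicRegion_iff_cuspScale.1 (hK hy) j
    -- A positive function scaled by each `u j` is needed, `u 0` included; norm one makes the
    -- inverse product of the scales such a function. This bounds `u`, then `b`, and a lattice has
    -- finitely many bounded elements.
    let h : Fin (m + 2) → EuclideanSpace ℝ (Fin (2 * (m + 1 + 1))) → ℝ := fun j y =>
      Fin.cases (∏ k, cuspScale k y)⁻¹ (fun j => cuspScale j y) j
    have hh : ∀ j, ∀ y ∈ K, 0 < h j y := fun j y hy =>
      Fin.cases (inv_pos.2 (Finset.prod_pos fun k _ => hpos k y hy)) (fun j => hpos j y hy) j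
    have hhc : ∀ j, ContinuousOn (h j) K := fun j =>
      Fin.cases (ContinuousOn.inv₀ (continuous_finsetProd _ fun k _ =>
          continuous_cuspScale k).continuousOn
        fun y hy => (Finset.prod_pos fun k _ => hpos k y hy).ne')
        (fun j => (continuous_cuspScale j).continuousOn) j
    have hhu : ∀ u ∈ positiveUnits R, ∀ b j y, h j (cuspPerm u b y) = u.1 j * h j y := by
      intro u hu b j y
      refine Fin.cases ?_ (fun j => cuspScale_cuspPerm hu.2.2.1 b j y) j
      change (∏ k, cuspScale k (cuspPerm u b y))⁻¹ = u.1 0 * (∏ k, cuspScale k y)⁻¹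
      have h2 := hu.2.2.2
      rw [Fin.prod_univ_succ] at h2
      simp only [cuspScale_cuspPerm hu.2.2.1, Finset.prod_mul_distrib]
      rw [mul_inv, ← eq_inv_of_mul_eq_one_left h2]
    obtain ⟨C, hC⟩ := exists_bound_of_pos hKc hhc hh
    obtain ⟨B, hB⟩ := hKc.isBounded.exists_norm_le
    have hBq : ∀ y ∈ K, ∀ i, |y i| ≤ B := fun y hy i => (PiLp.norm_apply_le y i).trans (hB y hy)
    have hfinu : {u | u ∈ positiveUnits R ∧ ∀ j, |u.1 j| ≤ C * C}.Finite := by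
      refine Set.Finite.of_finite_image ((hfin (C * C)).subset ?_) Units.val_injective.injOn
      rintro _ ⟨u, hu, rfl⟩
      exact ⟨hu.1.1, hu.2⟩
    refine ((hfinu.prod (hfin (B + C * C * B))).image fun x => cuspPerm x.1 x.2).subset ?_
    rintro _ ⟨⟨u, hu, b, hb, rfl⟩, y, hy, hy'⟩
    have hub : ∀ j, |u.1 j| ≤ C * C := by
      intro j
      have e := hhu u hu b j y
      rw [eq_comm, ← eq_mul_inv_iff_mul_eq₀ (hh j y hy).ne'] at e
      rw [abs_of_pos (hu.2.2.1 j), e]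
      exact mul_le_mul (hC j _ hy').1 (hC j _ hy).2 (inv_nonneg.2 (hh j y hy).le)
        ((hh j _ hy').le.trans (hC j _ hy').1)
    refine ⟨(u, b), ⟨⟨hu, hub⟩, hb, fun j => ?_⟩, rfl⟩
    have e : b j = cuspPerm u b y (qIdx j) - u.1 j * y (qIdx j) := by
      rw [cuspPerm_q]; ring
    change |b j| ≤ _
    rw [e]
    refine (abs_sub _ _).trans (add_le_add (hBq _ hy' _) ?_)
    rw [abs_mul]
    exact mul_le_mul (hub j) (hBq _ hy _) (abs_nonneg _) ((abs_nonneg _).trans (hub j))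
  cocompact := by
    obtain ⟨C, hC⟩ := hcov
    obtain ⟨D, hD⟩ := hunits
    -- Units bring the logarithms of the scales into `[-D, D]` and translations bring the positions
    -- into `[-C, C]`. The coordinates `pIdx 0` and `pIdx 1` need no separate bound, since `0 ≤ y 0`
    -- controls them by the scale of index `0`.
    refine ⟨{y | 0 ≤ y 0 ∧ (∀ j, cuspScale j y ∈ Icc (Real.exp (-D)) (Real.exp D)) ∧
      ∀ j, |y (qIdx j)| ≤ C}, fun y hy => ?_, ?_, fun y hy h0 => ?_⟩
    · exact mem_parabolicRegion_iff_cuspScale.2 fun j => (Real.exp_pos _).trans_le (hy.2.1 j).1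
    · refine EuclideanSpace.isCompact_of_abs_le
        (C := max (max (Real.exp D ^ 2) (Real.exp D)) C) ?_ ?_
      · have c0 : Continuous fun y : EuclideanSpace ℝ (Fin (2 * (m + 1 + 1))) => y 0 := by fun_prop
        have c1 : IsClosed {y : EuclideanSpace ℝ (Fin (2 * (m + 1 + 1))) |
            ∀ j, cuspScale j y ∈ Icc (Real.exp (-D)) (Real.exp D)} := by
          rw [ofPred_forall]
          exact isClosed_iInter fun j => isClosed_Icc.preimage (continuous_cuspScale j)
        have c2 : IsClosed {y : EuclideanSpace ℝ (Fin (2 * (m + 1 + 1))) |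
            ∀ j, |y (qIdx j)| ≤ C} := by
          rw [ofPred_forall]
          exact isClosed_iInter fun j => isClosed_le (by fun_prop) continuous_const
        exact (isClosed_le continuous_const c0).inter (c1.inter c2)
      · rintro y ⟨h0, h1, h2⟩ i
        have hs : y (pIdx 0) + y (pIdx 1) ^ 2 ≤ Real.exp D ^ 2 := by
          have := (h1 0).2
          rw [cuspScale_zero] at this
          exact (Real.sqrt_le_left (Real.exp_pos D).le).1 this
        rcases pIdx_or_qIdx i with ⟨j, rfl⟩ | ⟨j, rfl⟩
        · refine le_trans ?_ (le_max_left _ _)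
          refine Fin.cases ?_ (fun j => Fin.cases ?_ (fun k => ?_) j) j
          · refine le_trans ?_ (le_max_left _ _)
            rw [zero_eq_pIdx] at h0
            rw [abs_of_nonneg h0]
            linarith [sq_nonneg (y (pIdx 1))]
          · refine le_trans (abs_le_of_sq_le_sq ?_ (Real.exp_pos D).le) (le_max_right _ _)
            have : 0 ≤ y (pIdx 0) := h0
            change y (pIdx 1) ^ 2 ≤ _
            linarith
          · refine le_trans ?_ (le_max_right _ _)
            have := h1 k.succ
            rw [cuspScale_succ] at this
            rw [abs_of_pos ((Real.exp_pos _).trans_le this.1)]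
            exact this.2
        · exact (h2 j).trans (le_max_right _ _)
    · obtain ⟨u, hu, hut⟩ := hD fun j => Real.log (cuspScale j y)
      -- The translation is chosen after the unit, for the positions already multiplied by `u`.
      obtain ⟨b, hb, hqb⟩ := hC fun j => u.1 j * y (qIdx j)
      refine ⟨_, ⟨u, hu, b, hb, rfl⟩, ?_, fun j => ?_, fun j => ?_⟩
      · rw [zero_eq_pIdx] at h0 ⊢
        rw [cuspPerm_p_zero]
        positivity
      · have hj := mem_parabolicRegion_iff_cuspScale.1 hy j
        have hp := mul_pos (hu.2.2.1 j.succ) hj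
        have h1 := abs_le.1 (hut j)
        rw [← Real.log_mul hj.ne' (hu.2.2.1 _).ne', mul_comm] at h1
        rw [cuspScale_cuspPerm hu.2.2.1]
        exact ⟨(Real.le_log_iff_exp_le hp).1 h1.1, (Real.log_le_iff_le_exp hp).1 h1.2⟩
      · rw [cuspPerm_q]
        exact hqb j
  connected := isConnected_parabolicRegion _
  one_ne_zero := fun y => one_ne_zero_of_mem_parabolicRegion
  exists_pos := by
    obtain ⟨y, hy, h0, h1⟩ := exists_mem_parabolicRegion (m + 1) one_ne_zero
    exact ⟨y, hy, h0, by rw [h1]; exact one_pos⟩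
  exists_neg := by
    obtain ⟨y, hy, h0, h1⟩ := exists_mem_parabolicRegion (m + 1) (neg_ne_zero.2 one_ne_zero)
    exact ⟨y, hy, h0, by rw [h1]; norm_num⟩
  smooth := fun y hy => contDiffAt_pqForm (contDiffAt_cuspP hy) (contDiffAt_cuspQ y)
  invariant := by
    rintro _ ⟨u, hu, b, hb, rfl⟩ a ha y hy
    refine pqForm_pullback (isOpen_parabolicRegion _)
      (fun j y _ => (contDiffAt_cuspQ y j).differentiableAt (by simp)) a (fun y hy => ?_) u.1 b
      (fun j => (hu.2.2.1 j).ne') (fun j y _ => ?_) (fun j y _ => ?_) hy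
    · rw [mem_parabolicRegion_iff_cuspScale] at hy ⊢
      intro j
      rw [← ha, cuspScale_cuspPerm hu.2.2.1]
      exact mul_pos (hu.2.2.1 _) (hy j)
    · rw [← ha, cuspP_cuspPerm hu.2.2.1 hu.2.2.2]
    · rw [← ha]
      exact cuspPerm_q u b y j
  nondegenerate := by
    intro y hy v hv
    refine extDeriv_pqForm_nondegenerate (by simp) (contDiffAt_cuspP hy) (contDiffAt_cuspQ y)
      (fun v hP hQ => ?_) v hv
    have hyk := (mem_parabolicRegion_iff.1 hy).2
    have hk : ∀ k : Fin m, v (pIdx k.succ.succ) = 0 := fun k => by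
      have h1 := hP k.succ.succ
      rw [fderiv_cuspP_succ_succ hy] at h1
      exact (mul_eq_zero.1 h1).resolve_left (neg_ne_zero.2 (inv_ne_zero (pow_pos (hyk k) 2).ne'))
    have h1 : v (pIdx 1) = 0 := by
      have h1 := hP 0
      rw [fderiv_cuspP_zero] at h1
      simp only [hk, mul_zero, Finset.sum_const_zero, zero_add] at h1
      exact (mul_eq_zero.1 h1).resolve_left (Finset.prod_pos fun k _ => hyk k).ne'
    have h0 : v (pIdx 0) = 0 := by
      have h2 := hP 1
      rw [fderiv_cuspP_one hy, h1, mul_zero, add_zero] at h2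
      refine (mul_eq_zero.1 h2).resolve_left ?_
      have h3 := Real.sqrt_pos.2 (mem_parabolicRegion_iff.1 hy).1
      exact div_ne_zero (neg_ne_zero.2 (by positivity)) (by positivity)
    refine ext_pIdx_qIdx (fun j => ?_) fun j => ?_
    · exact Fin.cases h0 (fun j => Fin.cases h1 hk j) j
    · rw [← fderiv_cuspQ y v j]
      exact hQ j
  liouville := by
    intro y hy h0
    have hyk := (mem_parabolicRegion_iff.1 hy).2
    -- Solving `dP_j(Z) = P_j`: every scale must change by its negative. The `m` factors in `P_0`
    -- then contribute `-m`, so `y (pIdx 1)` gets the factor `1 + m`. The coordinate `pIdx 0` is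
    -- what remains of `-2 (y (pIdx 0) + y (pIdx 1) ^ 2)`.
    let z : Fin (m + 2) → ℝ := Fin.cons (-2 * y (pIdx 0) - (4 + 2 * m) * y (pIdx 1) ^ 2)
      (Fin.cons ((1 + m) * y (pIdx 1)) fun k : Fin m => -y (pIdx k.succ.succ))
    let Z : EuclideanSpace ℝ (Fin (2 * (m + 1 + 1))) :=
      WithLp.toLp 2 fun i => Sum.elim z 0 ((coordEquiv m).symm i)
    have hZp : ∀ j, Z (pIdx j) = z j := fun j => by simp [Z, pIdx]
    have hZq : ∀ j, Z (qIdx j) = 0 := fun j => by simp [Z, qIdx]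
    have hZ0 : Z (pIdx 0) = -2 * y (pIdx 0) - (4 + 2 * m) * y (pIdx 1) ^ 2 := hZp 0
    have hZ1 : Z (pIdx 1) = (1 + m) * y (pIdx 1) := hZp 1
    have hZk : ∀ k : Fin m, Z (pIdx k.succ.succ) = -y (pIdx k.succ.succ) := fun k => hZp _
    refine ⟨Z, ?_, extDeriv_pqForm_liouville (contDiffAt_cuspP hy) (contDiffAt_cuspQ y)
      (fun j => ?_) (fun j => by rw [fderiv_cuspQ, hZq])⟩
    · have h1 := (mem_parabolicRegion_iff.1 hy).1
      rw [zero_eq_pIdx] at h0 ⊢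
      rw [h0, zero_add] at h1
      rw [hZ0, h0]
      have : (0 : ℝ) ≤ m := Nat.cast_nonneg m
      nlinarith
    · refine Fin.cases ?_ (fun j => Fin.cases ?_ (fun k => ?_) j) j
      · rw [fderiv_cuspP_zero, cuspP_zero, hZ1]
        have h2 : ∀ k : Fin m, (∏ l ∈ Finset.univ.erase k, y (pIdx l.succ.succ)) *
            Z (pIdx k.succ.succ) = -∏ l : Fin m, y (pIdx l.succ.succ) := fun k => by
          rw [hZk, mul_neg, Finset.prod_erase_mul _ _ (Finset.mem_univ k)]
        simp only [h2, Finset.sum_const, Finset.card_univ, Fintype.card_fin, nsmul_eq_mul]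
        ring
      · rw [Fin.succ_zero_eq_one, fderiv_cuspP_one hy, hZ0, hZ1]
        change _ = (√(y (pIdx 0) + y (pIdx 1) ^ 2))⁻¹
        have h1 := (mem_parabolicRegion_iff.1 hy).1
        have h3 := Real.sqrt_pos.2 h1
        have h4 : -2 * y (pIdx 0) - (4 + 2 * m) * y (pIdx 1) ^ 2 +
            2 * y (pIdx 1) * ((1 + m) * y (pIdx 1)) =
            -2 * √(y (pIdx 0) + y (pIdx 1) ^ 2) ^ 2 := by
          rw [Real.sq_sqrt h1.le]; ring
        rw [h4]
        field_simp
      · rw [fderiv_cuspP_succ_succ hy, hZk, cuspP_succ, cuspScale_succ]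
        have := hyk k
        field_simp

end HigherDimension

end

/-- In every positive even dimension `2 * (n + 1)` there is a connected Liouville domain whose
boundary is disconnected. -/
theorem mainTheorem5 (n : ℕ) :
    ∃ (W : Type) (_ : TopologicalSpace W)
      (_ : ChartedSpace (EuclideanHalfSpace (2 * (n + 1))) W)
      (Ω : DiffForm (𝓡∂ (2 * (n + 1))) W 2),
      IsLiouvilleDomain W Ω ∧ ConnectedSpace W ∧
        ¬ IsPreconnected ((𝓡∂ (2 * (n + 1))).boundary W) := by
  -- With a single coordinate the only unit of norm one is `1`, so dimension two has its own group.
  rcases n with _ | m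
  · exact liouvilleData_surface.exists_liouvilleDomain
  · obtain ⟨R, hfin, hcov, hunits⟩ := exists_subring_lattice (m + 1)
    exact (liouvilleData_cusp hfin hcov hunits).exists_liouvilleDomain
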